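/- For a finite undirected graph $G=(V,E)$ with capacities $c:V\to\mathbb N$, a set $S\subseteq V$ is a \emph{capacitated dominating set} if there is a function $f:V\setminus S\to S$ such that $f(v)$ is a neighbour of $v$ for every $v\in V\setminus S$ and $|f^{-1}(w)|\le c(w)$ for every $w\in S$. Let $\mathrm{opt}(G,c)$ denote the smallest size of a capacitated dominating set. There is a $5/3$-approximation algorithm for the Capacitated Dominating Set problem that runs in $O(1.57^n)$ time and polynomial space, where $n=|V|$. That is, there is a single deterministic algorithm that, given any graph $G$ on $n$ vertices (by its adjacency matrix) and any capacities $c$, outputs a capacitated dominating set $S$ of $G$ with $|S|\le\frac53\,\mathrm{opt}(G,c)$. It makes $O(1.57^n)$ steps on a random access machine on which additions, truncated subtractions, comparisons with zero and indirect memory accesses take one step each, and the number of bits of memory it uses is at all times bounded by a polynomial in the number of bits of the input. The constant in the time bound does not depend on the graph or on the capacities. -/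

import Mathlib

open Filter Asymptotics

namespace CapDom

/-! ### Capacitated dominating sets -/

/-- `S` is a capacitated dominating set of `G` with capacities `c`: there is a dominating function
`f`, of which only the restriction to the complement of `S` matters, sending every vertex outside
`S` to a neighbour of it in `S`, so that each `w ∈ S` receives at most `c w` vertices. -/
def IsCapDomSet {V : Type*} (G : SimpleGraph V) (c : V → ℕ) (S : Finset V) : Prop :=
  ∃ f : V → V, (∀ v, v ∉ S → f v ∈ S ∧ G.Adj v (f v)) ∧
    ∀ w ∈ S, Set.encard {v | v ∉ S ∧ f v = w} ≤ (c w : ℕ∞)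

/-- The smallest possible size of a capacitated dominating set of a finite graph. -/
noncomputable def capDomNumber {V : Type*} (G : SimpleGraph V) (c : V → ℕ) : ℕ :=
  sInf {k | ∃ S : Finset V, IsCapDomSet G c S ∧ S.card = k}

/-- The whole vertex set is a capacitated dominating set, so the infimum above is a minimum. -/
theorem isCapDomSet_univ {V : Type*} [Fintype V] (G : SimpleGraph V) (c : V → ℕ) :
    IsCapDomSet G c Finset.univ :=
  ⟨id, fun v hv => absurd (Finset.mem_univ v) hv, fun w _ => by simp⟩

/-! ### A random access machine, programmed by structured programs

The memory consists of registers and of arrays, all holding natural numbers. A program mentions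
only finitely many registers and finitely many arrays; array cells are addressed indirectly, through
the contents of a register. -/

/-- The elementary operations. -/
inductive Instr where
  /-- `r := k` -/
  | const (r k : ℕ)
  /-- `r := a + b` -/
  | add (r a b : ℕ)
  /-- `r := max (a - b) 0` -/
  | sub (r a b : ℕ)
  /-- `r := A[i]` -/
  | load (r A i : ℕ)
  /-- `A[i] := r` -/
  | store (A i r : ℕ)

/-- Programs. -/
inductive Prog where
  | skip
  | instr (x : Instr)
  | seq (p q : Prog)
  /-- if register `r` is nonzero then `p` else `q` -/
  | cond (r : ℕ) (p q : Prog)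
  /-- while register `r` is nonzero do `p` -/
  | loop (r : ℕ) (p : Prog)

/-- The contents of the memory: `reg r` is the number in register `r`, and `arr A i` is the number
in cell `i` of array `A`. -/
structure Memory where
  reg : ℕ → ℕ
  arr : ℕ → ℕ → ℕ

/-- The effect of an elementary operation. -/
def Instr.apply : Instr → Memory → Memory
  | .const r k, m => { m with reg := Function.update m.reg r k }
  | .add r a b, m => { m with reg := Function.update m.reg r (m.reg a + m.reg b) }
  | .sub r a b, m => { m with reg := Function.update m.reg r (m.reg a - m.reg b) }
  | .load r A i, m => { m with reg := Function.update m.reg r (m.arr A (m.reg i)) }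
  | .store A i r, m =>
      { m with arr := Function.update m.arr A (Function.update (m.arr A) (m.reg i) (m.reg r)) }

/-- A configuration: the list of the programs that remain to be executed, in this order, and the
memory. The length of this list is bounded by the size of the program that is run, so the list is
a finite control. -/
structure Config where
  todo : List Prog
  mem : Memory

/-- One step of the machine: one elementary operation, one test, or one unfolding of a
composition. The machine has halted when nothing remains to be executed. -/
def Config.step : Config → Config
  | ⟨[], m⟩ => ⟨[], m⟩
  | ⟨.skip :: l, m⟩ => ⟨l, m⟩
  | ⟨.instr x :: l, m⟩ => ⟨l, x.apply m⟩
  | ⟨.seq p q :: l, m⟩ => ⟨p :: q :: l, m⟩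
  | ⟨.cond r p q :: l, m⟩ => ⟨(if m.reg r ≠ 0 then p else q) :: l, m⟩
  | ⟨.loop r p :: l, m⟩ => ⟨if m.reg r ≠ 0 then p :: .loop r p :: l else l, m⟩

/-- The configuration that the program `P`, started on the memory `m`, reaches after `t` steps. -/
def exec (P : Prog) (m : Memory) (t : ℕ) : Config :=
  Config.step^[t] ⟨[P], m⟩

/-- `P`, started on `m`, halts after at most `t` steps. -/
def HaltsWithin (P : Prog) (m : Memory) (t : ℕ) : Prop :=
  (exec P m t).todo = []

/-- The memory is confined to `b`: all numbers in it have at most `b` binary digits, and only the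
first `b` cells of each array are in use. As a program accesses a fixed number of registers and
arrays, it then uses `O(b ^ 2)` bits. -/
def Memory.Within (m : Memory) (b : ℕ) : Prop :=
  (∀ r, (m.reg r).size ≤ b) ∧ (∀ A i, (m.arr A i).size ≤ b) ∧ ∀ A i, b ≤ i → m.arr A i = 0

/-- Throughout the run of `P` on `m`, the memory is confined to `b`. -/
def RunsWithinSpace (P : Prog) (m : Memory) (b : ℕ) : Prop :=
  ∀ t, (exec P m t).mem.Within b

/-! ### Input and output -/

open Classical in
/-- The memory presenting a graph on `n` vertices with capacities: register `0` holds `n`, array `0`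
holds the capacities, array `1` holds the adjacency matrix row by row, and all else is `0`. -/
noncomputable def inputMemory {n : ℕ} (G : SimpleGraph (Fin n)) (c : Fin n → ℕ) : Memory where
  reg r := if r = 0 then n else 0
  arr A i :=
    if A = 0 then (if h : i < n then c ⟨i, h⟩ else 0)
    else if A = 1 then (if ∃ u v : Fin n, G.Adj u v ∧ i = u * n + v then 1 else 0)
    else 0

/-- The number of bits of the input: the adjacency matrix and the capacities in binary. -/
def inputSize {n : ℕ} (c : Fin n → ℕ) : ℕ :=
  n ^ 2 + ∑ v, (c v).size

/-- The vertex set presented as an output: the vertices `v` for which cell `v` of array `2` is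
nonzero. -/
def outputSet (n : ℕ) (m : Memory) : Finset (Fin n) :=
  Finset.univ.filter fun v => m.arr 2 v ≠ 0

end CapDom

/-! Guess a small set `U` of vertices that may be used to full capacity, and solve the rest by one
maximum matching. Give each vertex of `U` as many copies as its capacity (at most `n`), every other
vertex one copy, and join copies of adjacent vertices when one of them may dominate the other
(`copyAdj`). Each edge of a matching can be oriented so that it dominates exactly one vertex, so a
matching with `a` edges yields a capacitated dominating set of size `n - a` (`card_dominated`,
`isCapDomSet_of_isMatch`).

The ratio comes from an optimal solution `S`, whose vertices `w` dominate `d w` vertices each, where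
`|S| + ∑ d w = n`. Let `U` consist of the `⌈n/6⌉` vertices of `S` with the largest `d w` (all of `S`
if it is smaller). The matching that serves all vertices dominated by `U`, and one for every other
`w` with `d w > 0`, loses only `∑ (d w - 1)` over `S \ U`, and `exists_few_excess` bounds this by
`2|S|/3`. Hence `n - a ≤ 5|S|/3` (`exists_good_matching`), and a maximum matching is at least as
good. As `U` is unknown, all sets of at most `⌈n/6⌉` vertices are tried. By weighting a set `W` with
`5 ^ (-|W|)` their number is seen to be `O((6/5 · 5^(1/6))^n)`, which is `O(1.5696^n)`; the gap to
`1.57` absorbs all polynomial factors (`card_smallSets_le`, `time_isBigO`). They are enumerated in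
place in the order of binary numbers, so space stays polynomial.

Maximum matchings are found without contracting blossoms. A set `D` of vertices is kept, each `d` in
it together with a matching `R d` of the current size that exposes `d`. The program follows
alternating walks from the current matching `M` to all `R d`, tries single exchanges on the way, and
tries to move exposed vertices along edges inside `D`. Whatever goes wrong reveals either a larger
matching or a new element of `D`; this happens a polynomial number of times. If nothing goes wrong,
then `Stuck` holds, and the Tutte–Berge bound shows that `M` is maximum (`Stuck.le_card`): with `A`
the boundary of `D`, call a vertex exceptional if `M` exposes it or matches it into `A`. There are
at least `k + |A|` exceptional vertices, and no two lie in the same component of `D`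
(`Stuck.not_reach`, in the spirit of Gallai's lemma, resting on `Chain.inv`). So their components
are odd, and any matching must expose a vertex of each of them or match one into `A`.

The machine part is handled by a small language of commands whose loops all run exactly `N = n²`
times and whose registers stay below `N + 11`. A single theorem, `simulates`, gives polynomial time
and space for every command; only the outermost loop over the sets `U` is an unbounded machine loop.
Capacities are never copied into the state, only compared with registers, which is why the running
time does not depend on them. -/

namespace CapDom

/-! ### Runs of the machine -/

/-- `c` becomes `c'` within `T` steps, with the memory confined to `b` throughout. -/
def Exec (b T : ℕ) (c c' : Config) : Prop :=
  ∃ t ≤ T, Config.step^[t] c = c' ∧ ∀ i ≤ t, (Config.step^[i] c).mem.Within b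

theorem Exec.refl {b T : ℕ} {c : Config} (h : c.mem.Within b) : Exec b T c c :=
  ⟨0, Nat.zero_le _, rfl, fun i hi => by obtain rfl : i = 0 := by omega
                                         exact h⟩

theorem Exec.mono {b T T' : ℕ} {c c' : Config} (h : Exec b T c c') (hT : T ≤ T') :
    Exec b T' c c' := by
  obtain ⟨t, ht, h1, h2⟩ := h
  exact ⟨t, ht.trans hT, h1, h2⟩

theorem Exec.trans {b T T' : ℕ} {c c' c'' : Config} (h : Exec b T c c') (h' : Exec b T' c' c'') :
    Exec b (T + T') c c'' := by
  obtain ⟨t, ht, h1, h2⟩ := h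
  obtain ⟨t', ht', h1', h2'⟩ := h'
  refine ⟨t' + t, by omega, ?_, fun i hi => ?_⟩
  · rw [Function.iterate_add_apply, h1, h1']
  · rcases le_total i t with hit | hit
    · exact h2 i hit
    · obtain ⟨j, rfl⟩ := Nat.exists_eq_add_of_le' hit
      rw [Function.iterate_add_apply, h1]
      exact h2' j (by omega)

theorem Exec.head {b T : ℕ} {c c' : Config} (h : c.mem.Within b) (h' : Exec b T c.step c') :
    Exec b (T + 1) c c' := by
  obtain ⟨t', ht', h1', h2'⟩ := h'
  refine ⟨t' + 1, by omega, h1', fun i hi => ?_⟩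
  rcases i with _ | i
  · exact h
  · exact h2' i (by omega)

theorem Exec.within_right {b T : ℕ} {c c' : Config} (h : Exec b T c c') : c'.mem.Within b := by
  obtain ⟨t, -, h1, h2⟩ := h
  simpa [h1] using h2 t le_rfl

theorem Exec.seq {b T T' : ℕ} {p q : Prog} {l : List Prog} {m m' m'' : Memory}
    (hm : m.Within b) (h : Exec b T ⟨p :: q :: l, m⟩ ⟨q :: l, m'⟩)
    (h' : Exec b T' ⟨q :: l, m'⟩ ⟨l, m''⟩) :
    Exec b (T + T' + 1) ⟨.seq p q :: l, m⟩ ⟨l, m''⟩ :=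
  Exec.head hm (h.trans h')

theorem iterate_step_of_halted {c : Config} (h : c.todo = []) (t : ℕ) :
    Config.step^[t] c = c := by
  obtain ⟨l, m⟩ := c
  obtain rfl : l = [] := h
  exact Function.iterate_fixed rfl t

/-- A halted configuration is a fixed point of the step function, so confinement up to the halting
time is confinement for ever. -/
theorem Exec.halts {b T : ℕ} {P : Prog} {m m' : Memory} (h : Exec b T ⟨[P], m⟩ ⟨[], m'⟩) :
    exec P m T = ⟨[], m'⟩ ∧ RunsWithinSpace P m b := by
  obtain ⟨t, ht, h1, h2⟩ := h
  have key : ∀ u, t ≤ u → exec P m u = ⟨[], m'⟩ := by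
    intro u hu
    obtain ⟨j, rfl⟩ := Nat.exists_eq_add_of_le' hu
    rw [exec, Function.iterate_add_apply, h1]
    exact iterate_step_of_halted rfl j
  refine ⟨key T ht, fun u => ?_⟩
  rcases le_total u t with hu | hu
  · exact h2 u hu
  · rw [key u hu]
    have := h2 t le_rfl
    rwa [h1] at this

/-! ### Updating the memory -/

/-- The memory `m` with `x` in register `r`. -/
def Memory.setReg (m : Memory) (r x : ℕ) : Memory := { m with reg := Function.update m.reg r x }

/-- The memory `m` with `x` in cell `i` of array `A`. -/
def Memory.setArr (m : Memory) (A i x : ℕ) : Memory :=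
  { m with arr := Function.update m.arr A (Function.update (m.arr A) i x) }

theorem Memory.reg_setReg (m : Memory) (r x r' : ℕ) :
    (m.setReg r x).reg r' = if r' = r then x else m.reg r' := by
  simp [Memory.setReg, Function.update_apply]

theorem Memory.arr_setReg (m : Memory) (r x : ℕ) : (m.setReg r x).arr = m.arr := rfl

theorem Memory.reg_setArr (m : Memory) (A i x : ℕ) : (m.setArr A i x).reg = m.reg := rfl

theorem Memory.arr_setArr (m : Memory) (A i x A' i' : ℕ) :
    (m.setArr A i x).arr A' i' = if A' = A ∧ i' = i then x else m.arr A' i' := by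
  by_cases hA : A' = A
  · subst hA
    simp [Memory.setArr, Function.update_apply]
  · simp [Memory.setArr, hA]

theorem Memory.Within.setReg {m : Memory} {b r x : ℕ} (h : m.Within b) (hx : x.size ≤ b) :
    (m.setReg r x).Within b := by
  refine ⟨fun r' => ?_, h.2.1, h.2.2⟩
  rw [Memory.reg_setReg]
  split_ifs
  · exact hx
  · exact h.1 r'

theorem Memory.Within.setArr {m : Memory} {b A i x : ℕ} (h : m.Within b) (hx : x.size ≤ b)
    (hi : i < b) : (m.setArr A i x).Within b := by
  refine ⟨h.1, fun A' i' => ?_, fun A' i' hi' => ?_⟩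
  · rw [Memory.arr_setArr]
    split_ifs
    · exact hx
    · exact h.2.1 A' i'
  · rw [Memory.arr_setArr, if_neg (by omega)]
    exact h.2.2 A' i' hi'

/-- This crude bound suffices throughout: the space bound `b` is polynomial, and it serves as a
bound for values, hence for numbers of digits, and for array indices alike. -/
theorem size_le_of_le {x b : ℕ} (h : x ≤ b) : x.size ≤ b :=
  Nat.size_le.2 (lt_of_le_of_lt h Nat.lt_two_pow_self)

theorem size_mono {x y b : ℕ} (h : x ≤ y) (hy : y.size ≤ b) : x.size ≤ b :=
  (Nat.size_le_size h).trans hy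

/-! ### A language of bounded loops

The commands below act on registers and on two-dimensional arrays with index range
`{0, …, N - 1}²`, where `N` is a parameter of the environment. All their values stay small, and
all their loops run exactly `N` times, so that their compilations into machine programs run in
polynomial time and space. -/

/-- The parameters of a run: the range of the loops, and the two input arrays. -/
structure Env where
  N : ℕ
  cap : ℕ → ℕ
  adj : ℕ → ℕ

/-- The states that commands transform. -/
structure St where
  reg : ℕ → ℕ
  arr : ℕ → ℕ → ℕ → ℕ

/-- Commands. -/
inductive Cmd where
  | skip
  | set (r k : ℕ)
  | mov (r a : ℕ)
  | inc (r : ℕ)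
  | sub (r a b : ℕ)
  | eq (r a b : ℕ)
  | load (r A i j : ℕ)
  | store (A i j r : ℕ)
  | adj (r i : ℕ)
  | ltCap (r j v : ℕ)
  | seq (p q : Cmd)
  | cond (r : ℕ) (p q : Cmd)
  | rep (i : ℕ) (p : Cmd)

/-- The state `s` with `x` in register `r`. -/
def St.setReg (s : St) (r x : ℕ) : St := { s with reg := fun r' => if r' = r then x else s.reg r' }

/-- The state `s` with `x` in cell `(i, j)` of array `A`. -/
def St.setArr (s : St) (A i j x : ℕ) : St :=
  { s with arr := fun A' i' j' => if A' = A ∧ i' = i ∧ j' = j then x else s.arr A' i' j' }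

@[simp] theorem St.reg_setReg (s : St) (r x r' : ℕ) :
    (s.setReg r x).reg r' = if r' = r then x else s.reg r' := rfl

@[simp] theorem St.arr_setReg (s : St) (r x : ℕ) : (s.setReg r x).arr = s.arr := rfl

@[simp] theorem St.reg_setArr (s : St) (A i j x : ℕ) : (s.setArr A i j x).reg = s.reg := rfl

@[simp] theorem St.arr_setArr (s : St) (A i j x A' i' j' : ℕ) :
    (s.setArr A i j x).arr A' i' j' = if A' = A ∧ i' = i ∧ j' = j then x else s.arr A' i' j' := rfl

/-- Apply `f 0`, …, `f (n - 1)` in this order. -/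
def iter (f : ℕ → St → St) : ℕ → St → St
  | 0, s => s
  | n + 1, s => f n (iter f n s)

/-- The state transformation that a command denotes. -/
def Cmd.run (e : Env) : Cmd → St → St
  | .skip, s => s
  | .set r k, s => s.setReg r (min k 10)
  | .mov r a, s => s.setReg r (s.reg a)
  | .inc r, s => s.setReg r (if s.reg r < e.N then s.reg r + 1 else s.reg r)
  | .sub r a b, s => s.setReg r (s.reg a - s.reg b)
  | .eq r a b, s => s.setReg r (if s.reg a = s.reg b then 1 else 0)
  | .load r A i j, s =>
      s.setReg r (if s.reg i < e.N ∧ s.reg j < e.N then s.arr A (s.reg i) (s.reg j) else 0)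
  | .store A i j r, s =>
      if s.reg i < e.N ∧ s.reg j < e.N then s.setArr A (s.reg i) (s.reg j) (s.reg r) else s
  | .adj r i, s => s.setReg r (e.adj (s.reg i))
  | .ltCap r j v, s => s.setReg r (if s.reg j < e.cap (s.reg v) then 1 else 0)
  | .seq p q, s => q.run e (p.run e s)
  | .cond r p q, s => if s.reg r ≠ 0 then p.run e s else q.run e s
  | .rep i p, s => iter (fun k s' => p.run e (s'.setReg i k)) e.N s

theorem iter_induction {f : ℕ → St → St} {n : ℕ} {s : St} (I : ℕ → St → Prop) (h0 : I 0 s)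
    (h : ∀ k s', k < n → I k s' → I (k + 1) (f k s')) : I n (iter f n s) := by
  suffices ∀ k ≤ n, I k (iter f k s) from this n le_rfl
  intro k hk
  induction k with
  | zero => exact h0
  | succ k ih => exact h k _ hk (ih (by omega))

/-- The registers that a command may change. -/
def Cmd.wregs : Cmd → List ℕ
  | .skip => []
  | .set r _ => [r]
  | .mov r _ => [r]
  | .inc r => [r]
  | .sub r _ _ => [r]
  | .eq r _ _ => [r]
  | .load r _ _ _ => [r]
  | .store _ _ _ _ => []
  | .adj r _ => [r]
  | .ltCap r _ _ => [r]
  | .seq p q => p.wregs ++ q.wregs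
  | .cond _ p q => p.wregs ++ q.wregs
  | .rep i p => i :: p.wregs

/-- The arrays that a command may change. -/
def Cmd.warrs : Cmd → List ℕ
  | .store A _ _ _ => [A]
  | .seq p q => p.warrs ++ q.warrs
  | .cond _ p q => p.warrs ++ q.warrs
  | .rep _ p => p.warrs
  | _ => []

/-- The frame rule. Together with `Cmd.run_arr` it reduces the survival of an invariant under a
command to a syntactic check of finite lists. -/
theorem Cmd.run_reg (e : Env) {p : Cmd} {r : ℕ} (h : r ∉ p.wregs) (s : St) :
    (p.run e s).reg r = s.reg r := by
  induction p generalizing s with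
  | seq p q hp hq =>
    simp only [Cmd.wregs, List.mem_append, not_or] at h
    simp [Cmd.run, hp h.1, hq h.2]
  | cond c p q hp hq =>
    simp only [Cmd.wregs, List.mem_append, not_or] at h
    simp only [Cmd.run]
    split_ifs
    exacts [hp h.1 s, hq h.2 s]
  | rep i p hp =>
    simp only [Cmd.wregs, List.mem_cons, not_or] at h
    refine iter_induction (fun _ s' => s'.reg r = s.reg r) rfl fun k s' _ hs' => ?_
    simp [hp h.2, hs', h.1]
  | store A i j x =>
    simp only [Cmd.run]
    split_ifs <;> rfl
  | _ => simp_all [Cmd.run, Cmd.wregs]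

theorem Cmd.run_arr (e : Env) {p : Cmd} {A : ℕ} (h : A ∉ p.warrs) (s : St) :
    (p.run e s).arr A = s.arr A := by
  induction p generalizing s with
  | seq p q hp hq =>
    simp only [Cmd.warrs, List.mem_append, not_or] at h
    simp [Cmd.run, hp h.1, hq h.2]
  | cond c p q hp hq =>
    simp only [Cmd.warrs, List.mem_append, not_or] at h
    simp only [Cmd.run]
    split_ifs
    exacts [hp h.1 s, hq h.2 s]
  | rep i p hp =>
    simp only [Cmd.warrs] at h
    refine iter_induction (fun _ s' => s'.arr A = s.arr A) rfl fun k s' _ hs' => ?_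
    simp [hp h, hs']
  | store A' i j x =>
    simp only [Cmd.warrs, List.mem_singleton] at h
    simp only [Cmd.run]
    split_ifs
    · funext i' j'
      simp [h]
    · rfl
  | _ => simp [Cmd.run]

end CapDom

namespace CapDom

/-! ### Compilation of commands -/

/-- The program that performs the given elementary operations. -/
def blk : List Instr → Prog
  | [] => .skip
  | x :: xs => .seq (.instr x) (blk xs)

/-- The given elementary operations keep the memory confined to `b`. -/
def Safe (b : ℕ) : List Instr → Memory → Prop
  | [], _ => True
  | x :: xs, m => (x.apply m).Within b ∧ Safe b xs (x.apply m)

theorem Exec.blk {b : ℕ} {l : List Prog} (xs : List Instr) {m : Memory} (hm : m.Within b)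
    (h : Safe b xs m) :
    Exec b (2 * xs.length + 1) ⟨CapDom.blk xs :: l, m⟩ ⟨l, xs.foldl (fun m x => x.apply m) m⟩ := by
  induction xs generalizing m with
  | nil => exact Exec.head hm (Exec.refl (T := 0) hm)
  | cons x xs ih =>
    have h1 : Exec b 1 ⟨.instr x :: CapDom.blk xs :: l, m⟩ ⟨CapDom.blk xs :: l, x.apply m⟩ :=
      Exec.head hm (Exec.refl (T := 0) h.1)
    exact (Exec.seq hm h1 (ih h.1 h.2)).mono (by simp; omega)

@[simp] theorem Instr.apply_const (r k : ℕ) (m : Memory) :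
    (Instr.const r k).apply m = m.setReg r k := rfl

@[simp] theorem Instr.apply_add (r x y : ℕ) (m : Memory) :
    (Instr.add r x y).apply m = m.setReg r (m.reg x + m.reg y) := rfl

@[simp] theorem Instr.apply_sub (r x y : ℕ) (m : Memory) :
    (Instr.sub r x y).apply m = m.setReg r (m.reg x - m.reg y) := rfl

@[simp] theorem Instr.apply_load (r A i : ℕ) (m : Memory) :
    (Instr.load r A i).apply m = m.setReg r (m.arr A (m.reg i)) := rfl

@[simp] theorem Instr.apply_store (A i r : ℕ) (m : Memory) :
    (Instr.store A i r).apply m = m.setArr A (m.reg i) (m.reg r) := rfl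

/-- The machine program for a command inside `d` loops: machine register `1` holds `N`, registers
`2`, `3`, `4` are scratch space, register `5` holds `0`, and the odd registers from `11` on count
the iterations of loops; machine array `3` holds the multiples of `N`. -/
def Cmd.compile : ℕ → Cmd → Prog
  | _, .skip => .skip
  | _, .set r k => blk [.const (2 * r + 10) (min k 10)]
  | _, .mov r a => blk [.add (2 * r + 10) (2 * a + 10) 5]
  | _, .inc r => blk [.sub 2 1 (2 * r + 10), .const 3 1, .sub 2 3 2, .sub 3 3 2,
      .add (2 * r + 10) (2 * r + 10) 3]
  | _, .sub r a b => blk [.sub (2 * r + 10) (2 * a + 10) (2 * b + 10)]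
  | _, .eq r a b => blk [.sub 2 (2 * a + 10) (2 * b + 10), .sub 3 (2 * b + 10) (2 * a + 10),
      .add 2 2 3, .const 3 1, .sub (2 * r + 10) 3 2]
  | _, .load r A i j => .seq (blk [.sub 2 1 (2 * i + 10), .sub 3 1 (2 * j + 10)])
      (.cond 2 (.cond 3
        (blk [.load 2 3 (2 * i + 10), .add 2 2 (2 * j + 10), .load (2 * r + 10) (2 * A + 2) 2])
        (blk [.const (2 * r + 10) 0])) (blk [.const (2 * r + 10) 0]))
  | _, .store A i j r => .seq (blk [.sub 2 1 (2 * i + 10), .sub 3 1 (2 * j + 10)])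
      (.cond 2 (.cond 3
        (blk [.load 2 3 (2 * i + 10), .add 2 2 (2 * j + 10), .store (2 * A + 2) 2 (2 * r + 10)])
        .skip) .skip)
  | _, .adj r i => blk [.load (2 * r + 10) 1 (2 * i + 10)]
  | _, .ltCap r j v => blk [.load 2 0 (2 * v + 10), .sub 2 2 (2 * j + 10), .const 3 1, .sub 2 3 2,
      .sub (2 * r + 10) 3 2]
  | d, .seq p q => .seq (p.compile d) (q.compile d)
  | d, .cond r p q => .cond (2 * r + 10) (p.compile d) (q.compile d)
  | d, .rep i p => .seq (blk [.const (2 * d + 11) 0, .sub 2 1 (2 * d + 11)])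
      (.loop 2 (.seq (blk [.add (2 * i + 10) (2 * d + 11) 5]) (.seq (p.compile (d + 1))
        (blk [.const 2 1, .add (2 * d + 11) (2 * d + 11) 2, .sub 2 1 (2 * d + 11)]))))

/-- A bound for the running time of the compilation of a command. -/
def Cmd.cost : Cmd → ℕ → ℕ
  | .seq p q, N => p.cost N + q.cost N + 1
  | .cond _ p q, N => p.cost N + q.cost N + 1
  | .rep _ p, N => 7 + N * (p.cost N + 13)
  | _, _ => 16

/-- The machine memory `m` represents the state `s`. -/
structure Rel (e : Env) (s : St) (m : Memory) : Prop where
  hN : m.reg 1 = e.N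
  zero : m.reg 5 = 0
  cap : m.arr 0 = e.cap
  adj : m.arr 1 = e.adj
  mul : ∀ i < e.N, m.arr 3 i = i * e.N
  reg : ∀ r, m.reg (2 * r + 10) = s.reg r
  arr : ∀ A i j, i < e.N → j < e.N → m.arr (2 * A + 2) (i * e.N + j) = s.arr A i j
  reg_le : ∀ r, s.reg r ≤ e.N + 10
  arr_le : ∀ A i j, i < e.N → j < e.N → s.arr A i j ≤ e.N + 10

theorem Rel.setReg {e : Env} {s : St} {m : Memory} (h : Rel e s m) {r x : ℕ} (hx : x ≤ e.N + 10) :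
    Rel e (s.setReg r x) (m.setReg (2 * r + 10) x) where
  hN := by simp [Memory.reg_setReg, h.hN]
  zero := by simp [Memory.reg_setReg, h.zero]
  cap := h.cap
  adj := h.adj
  mul := h.mul
  reg r' := by simp [Memory.reg_setReg, h.reg]
  arr := h.arr
  reg_le r' := by
    simp only [St.reg_setReg]
    split_ifs
    exacts [hx, h.reg_le r']
  arr_le := h.arr_le

/-- The state occupies the even machine registers from `10` on; registers `1` and `5` are reserved.
All others may change freely. -/
theorem Rel.scratch {e : Env} {s : St} {m : Memory} (h : Rel e s m) {r x : ℕ}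
    (hr : r ≠ 1 ∧ r ≠ 5 ∧ (r < 10 ∨ r % 2 = 1)) : Rel e s (m.setReg r x) where
  hN := by rw [Memory.reg_setReg, if_neg (by omega), h.hN]
  zero := by rw [Memory.reg_setReg, if_neg (by omega), h.zero]
  cap := h.cap
  adj := h.adj
  mul := h.mul
  reg r' := by rw [Memory.reg_setReg, if_neg (by omega), h.reg]
  arr := h.arr
  reg_le := h.reg_le
  arr_le := h.arr_le

theorem index_inj {N i j i' j' : ℕ} (hj : j < N) (hj' : j' < N) :
    i * N + j = i' * N + j' ↔ i = i' ∧ j = j' := by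
  refine ⟨fun h => ?_, fun ⟨h, h'⟩ => by rw [h, h']⟩
  have h1 := congrArg (· / N) h
  have hN : 0 < N := by omega
  simp only [mul_comm _ N, Nat.mul_add_div hN, Nat.div_eq_of_lt hj, Nat.div_eq_of_lt hj',
    add_zero] at h1
  subst h1
  exact ⟨rfl, by omega⟩

theorem index_lt {N i j : ℕ} (hi : i < N) (hj : j < N) : i * N + j < N * N := by
  have : (i + 1) * N ≤ N * N := Nat.mul_le_mul_right _ hi
  rw [add_one_mul] at this
  omega

theorem Rel.setArr {e : Env} {s : St} {m : Memory} (h : Rel e s m) {A i j x : ℕ}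
    (hj : j < e.N) (hx : x ≤ e.N + 10) :
    Rel e (s.setArr A i j x) (m.setArr (2 * A + 2) (i * e.N + j) x) where
  hN := h.hN
  zero := h.zero
  cap := by
    funext v
    rw [Memory.arr_setArr, if_neg (by omega), h.cap]
  adj := by
    funext v
    rw [Memory.arr_setArr, if_neg (by omega), h.adj]
  mul v hv := by rw [Memory.arr_setArr, if_neg (by omega), h.mul v hv]
  reg := h.reg
  arr A' i' j' hi' hj' := by
    simp [Memory.arr_setArr, index_inj hj' hj, h.arr A' i' j' hi' hj']
  reg_le := h.reg_le
  arr_le A' i' j' hi' hj' := by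
    rw [St.arr_setArr]
    split_ifs
    exacts [hx, h.arr_le A' i' j' hi' hj']

/-- The outcome of running the compilation of `p` on the memory `m` that represents `s`. -/
def Simulates (e : Env) (b d : ℕ) (p : Cmd) (s : St) (m : Memory) : Prop :=
  ∀ l, ∃ m', Exec b (p.cost e.N) ⟨p.compile d :: l, m⟩ ⟨l, m'⟩ ∧ Rel e (p.run e s) m' ∧
    ∀ h < d, m'.reg (2 * h + 11) = m.reg (2 * h + 11)

theorem simulates_blk {e : Env} {b d : ℕ} {p : Cmd} {s : St} {m : Memory} {xs : List Instr}
    (hm : m.Within b) (hp : p.compile d = blk xs) (hc : 2 * xs.length + 1 ≤ p.cost e.N)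
    (hs : Safe b xs m) (hr : Rel e (p.run e s) (xs.foldl (fun m x => x.apply m) m))
    (hd : ∀ h < d, (xs.foldl (fun m x => x.apply m) m).reg (2 * h + 11) = m.reg (2 * h + 11)) :
    Simulates e b d p s m := fun l =>
  ⟨_, by rw [hp]; exact (Exec.blk xs hm hs).mono hc, hr, hd⟩

/-- By induction on the command. Values of the state are at most `N + 10` and array indices are
below `N²`, so everything the compiled code computes is at most `N² + 2N + 40`, except for
capacities, which are already in the memory and are only decreased in scratch registers. The loop
counters of the `d` enclosing loops must survive, because the counter, and not the loop variable
visible to the body, controls a loop. -/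
theorem simulates (e : Env) (b : ℕ) (hb : e.N * e.N + 2 * e.N + 40 ≤ b) (hadj : ∀ i, e.adj i ≤ 1)
    (p : Cmd) : ∀ d s m, Rel e s m → m.Within b → Simulates e b d p s m := by
  have sz : ∀ x, x ≤ e.N * e.N + 2 * e.N + 40 → x.size ≤ b := fun x hx =>
    size_le_of_le (hx.trans hb)
  induction p with
  | skip =>
    intro d s m hr hm l
    exact ⟨m, Exec.head hm (Exec.refl (T := 15) hm), hr, fun _ _ => rfl⟩
  | set r k =>
    intro d s m hr hm
    have h1 : (min k 10).size ≤ b := sz _ (by omega)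
    refine simulates_blk hm rfl (by simp [Cmd.cost]) ⟨hm.setReg h1, trivial⟩
      (hr.setReg (by omega)) fun h _ => ?_
    simp [Memory.reg_setReg]
    omega
  | mov r a =>
    intro d s m hr hm
    have ha := hr.reg_le a
    refine simulates_blk hm rfl (by simp [Cmd.cost]) ⟨hm.setReg ?_, trivial⟩ ?_ fun h _ => ?_
    · simpa [hr.zero] using hm.1 _
    · simp only [List.foldl, Instr.apply_add, hr.zero, hr.reg, add_zero]
      exact hr.setReg ha
    · simp [Memory.reg_setReg]
      omega
  | inc r =>
    intro d s m hr hm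
    have ha := hr.reg_le r
    -- With truncated subtraction, `1 - (1 - x)` is the indicator of `x > 0`; here it decides
    -- whether the increment takes place.
    have key : s.reg r + (1 - (1 - (e.N - s.reg r)))
        = if s.reg r < e.N then s.reg r + 1 else s.reg r := by split_ifs <;> omega
    refine simulates_blk hm rfl (by simp [Cmd.cost]) ?_ ?_ fun h _ => ?_
    · have h1 := sz (e.N - s.reg r) (by omega)
      have h2 := sz 1 (by omega)
      have h3 := sz (1 - (e.N - s.reg r)) (by omega)
      have h4 := sz (1 - (1 - (e.N - s.reg r))) (by omega)
      have h5 := sz (s.reg r + (1 - (1 - (e.N - s.reg r)))) (by omega)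
      simp [Safe, Memory.reg_setReg, hr.hN, hr.reg, hm.setReg h1]
      all_goals with_reducible repeat' (first | assumption | apply Memory.Within.setReg | apply Memory.Within.setArr | apply And.intro)
    · simp only [List.foldl, Instr.apply_add, Instr.apply_sub, Instr.apply_const,
        Memory.reg_setReg, hr.hN, hr.reg]
      simp only [Cmd.run, ← key]
      simp
      exact ((((hr.scratch (by simp)).scratch (by simp)).scratch (by simp)).scratch
        (by simp)).setReg (by omega)
    · simp [Memory.reg_setReg]
      omega
  | sub r x y =>
    intro d s m hr hm
    have ha := hr.reg_le x
    refine simulates_blk hm rfl (by simp [Cmd.cost]) ⟨hm.setReg ?_, trivial⟩ ?_ fun h _ => ?_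
    · rw [hr.reg, hr.reg]
      exact sz _ (by omega)
    · simp only [List.foldl, Instr.apply_sub, hr.reg]
      exact hr.setReg (by omega)
    · simp [Memory.reg_setReg]
      omega
  | eq r x y =>
    intro d s m hr hm
    have hx := hr.reg_le x
    have hy := hr.reg_le y
    have key : 1 - (s.reg x - s.reg y + (s.reg y - s.reg x))
        = if s.reg x = s.reg y then 1 else 0 := by split_ifs <;> omega
    refine simulates_blk hm rfl (by simp [Cmd.cost]) ?_ ?_ fun h _ => ?_
    · have h1 := sz (s.reg x - s.reg y) (by omega)
      have h2 := sz (s.reg y - s.reg x) (by omega)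
      have h3 := sz (s.reg x - s.reg y + (s.reg y - s.reg x)) (by omega)
      have h4 := sz 1 (by omega)
      have h5 := sz (1 - (s.reg x - s.reg y + (s.reg y - s.reg x))) (by omega)
      simp [Safe, Memory.reg_setReg, hr.reg, hm.setReg h1]
      all_goals with_reducible repeat' (first | assumption | apply Memory.Within.setReg | apply Memory.Within.setArr | apply And.intro)
    · simp only [List.foldl, Instr.apply_add, Instr.apply_sub, Instr.apply_const,
        Memory.reg_setReg, hr.reg]
      simp only [Cmd.run, ← key]
      simp
      exact ((((hr.scratch (by simp)).scratch (by simp)).scratch (by simp)).scratch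
        (by simp)).setReg (by omega)
    · simp [Memory.reg_setReg]
      omega
  | load r A i j =>
    intro d s m hr hm l
    have hi := hr.reg_le i
    have hj := hr.reg_le j
    set m1 := (m.setReg 2 (e.N - s.reg i)).setReg 3 (e.N - s.reg j) with hm1
    have w1 : m1.Within b := (hm.setReg (sz _ (by omega))).setReg (sz _ (by omega))
    have r1 : Rel e s m1 := (hr.scratch (by simp)).scratch (by simp)
    have e1 : ∀ l, Exec b 5 ⟨blk [.sub 2 1 (2 * i + 10), .sub 3 1 (2 * j + 10)] :: l, m⟩
        ⟨l, m1⟩ := by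
      intro l
      have := Exec.blk (l := l) [.sub 2 1 (2 * i + 10), .sub 3 1 (2 * j + 10)] hm (by
        have h1 := sz (e.N - s.reg i) (by omega)
        have h2 := sz (e.N - s.reg j) (by omega)
        simp [Safe, Memory.reg_setReg, hr.hN, hr.reg, hm.setReg h1]
        all_goals with_reducible repeat' (assumption))
      simpa [Memory.reg_setReg, hr.hN, hr.reg, hm1] using this
    have g2 : m1.reg 2 = e.N - s.reg i := by simp [hm1, Memory.reg_setReg]
    have g3 : m1.reg 3 = e.N - s.reg j := by simp [hm1, Memory.reg_setReg]
    have hid : ∀ h, m1.reg (2 * h + 11) = m.reg (2 * h + 11) := by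
      intro h
      simp [hm1, Memory.reg_setReg]
    have e0 : ∀ l, Exec b 3 ⟨blk [.const (2 * r + 10) 0] :: l, m1⟩
        ⟨l, m1.setReg (2 * r + 10) 0⟩ := fun l =>
      Exec.blk (l := l) [.const (2 * r + 10) 0] w1 ⟨w1.setReg (by simp), trivial⟩
    by_cases h : s.reg i < e.N ∧ s.reg j < e.N
    · set m2 := (m1.setReg 2 (s.reg i * e.N)).setReg 2 (s.reg i * e.N + s.reg j) with hm2
      have hlt := index_lt h.1 h.2
      have r2 : Rel e s m2 := (r1.scratch (by simp)).scratch (by simp)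
      have hv := hr.arr A _ _ h.1 h.2
      have hv' := hr.arr_le A _ _ h.1 h.2
      refine ⟨m2.setReg (2 * r + 10) (s.arr A (s.reg i) (s.reg j)), ?_, ?_, ?_⟩
      · refine (Exec.seq hm (e1 _) (Exec.head w1 (T := 8) ?_)).mono (by simp [Cmd.cost])
        simp only [Config.step, g2]
        rw [if_pos (by omega)]
        refine Exec.head w1 (T := 7) ?_
        simp only [Config.step, g3]
        rw [if_pos (by omega)]
        have := Exec.blk (b := b) (l := l) [.load 2 3 (2 * i + 10), .add 2 2 (2 * j + 10),
          .load (2 * r + 10) (2 * A + 2) 2] w1 (by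
            have h1 := sz (s.reg i * e.N) (by omega)
            have h2 := sz (s.reg i * e.N + s.reg j) (by omega)
            have h3 := sz (s.arr A (s.reg i) (s.reg j)) (by omega)
            simp [Safe, Memory.reg_setReg, r1.reg, r1.mul _ h.1, w1.setReg h1,
              Memory.arr_setReg, r1.arr A _ _ h.1 h.2]
            all_goals with_reducible repeat' (first | assumption | apply Memory.Within.setReg | apply Memory.Within.setArr | apply And.intro))
        simpa [Memory.reg_setReg, r1.reg, r1.mul _ h.1, Memory.arr_setReg,
          r1.arr A _ _ h.1 h.2, hm2] using this
      · simp only [Cmd.run, if_pos h]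
        exact r2.setReg hv'
      · intro h _
        have : 2 * h + 11 ≠ 2 * r + 10 := by omega
        simp [hm2, Memory.reg_setReg, this, hid]
    · refine ⟨m1.setReg (2 * r + 10) 0, ?_, ?_, ?_⟩
      · refine (Exec.seq hm (e1 _) (Exec.head w1 (T := 4) ?_)).mono (by simp [Cmd.cost])
        simp only [Config.step, g2]
        by_cases hi' : s.reg i < e.N
        · rw [if_pos (by omega)]
          refine Exec.head w1 (T := 3) ?_
          simp only [Config.step, g3]
          rw [if_neg (by omega)]
          exact e0 l
        · rw [if_neg (by omega)]
          exact (e0 l).mono (by simp)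
      · simp only [Cmd.run, if_neg h]
        exact r1.setReg (by omega)
      · intro h _
        have : 2 * h + 11 ≠ 2 * r + 10 := by omega
        simp [Memory.reg_setReg, this, hid]
  | store A i j r =>
    intro d s m hr hm l
    have hi := hr.reg_le i
    have hj := hr.reg_le j
    have hx := hr.reg_le r
    set m1 := (m.setReg 2 (e.N - s.reg i)).setReg 3 (e.N - s.reg j) with hm1
    have w1 : m1.Within b := (hm.setReg (sz _ (by omega))).setReg (sz _ (by omega))
    have r1 : Rel e s m1 := (hr.scratch (by simp)).scratch (by simp)
    have e1 : ∀ l, Exec b 5 ⟨blk [.sub 2 1 (2 * i + 10), .sub 3 1 (2 * j + 10)] :: l, m⟩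
        ⟨l, m1⟩ := by
      intro l
      have := Exec.blk (l := l) [.sub 2 1 (2 * i + 10), .sub 3 1 (2 * j + 10)] hm (by
        have h1 := sz (e.N - s.reg i) (by omega)
        have h2 := sz (e.N - s.reg j) (by omega)
        simp [Safe, Memory.reg_setReg, hr.hN, hr.reg, hm.setReg h1]
        all_goals with_reducible repeat' (assumption))
      simpa [Memory.reg_setReg, hr.hN, hr.reg, hm1] using this
    have g2 : m1.reg 2 = e.N - s.reg i := by simp [hm1, Memory.reg_setReg]
    have g3 : m1.reg 3 = e.N - s.reg j := by simp [hm1, Memory.reg_setReg]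
    have hid : ∀ h, m1.reg (2 * h + 11) = m.reg (2 * h + 11) := by
      intro h
      simp [hm1, Memory.reg_setReg]
    by_cases h : s.reg i < e.N ∧ s.reg j < e.N
    · set m2 := (m1.setReg 2 (s.reg i * e.N)).setReg 2 (s.reg i * e.N + s.reg j) with hm2
      have hlt := index_lt h.1 h.2
      have r2 : Rel e s m2 := (r1.scratch (by simp)).scratch (by simp)
      refine ⟨m2.setArr (2 * A + 2) (s.reg i * e.N + s.reg j) (s.reg r), ?_, ?_, ?_⟩
      · refine (Exec.seq hm (e1 _) (Exec.head w1 (T := 8) ?_)).mono (by simp [Cmd.cost])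
        simp only [Config.step, g2]
        rw [if_pos (by omega)]
        refine Exec.head w1 (T := 7) ?_
        simp only [Config.step, g3]
        rw [if_pos (by omega)]
        have := Exec.blk (b := b) (l := l) [.load 2 3 (2 * i + 10), .add 2 2 (2 * j + 10),
          .store (2 * A + 2) 2 (2 * r + 10)] w1 (by
            have h1 := sz (s.reg i * e.N) (by omega)
            have h2 := sz (s.reg i * e.N + s.reg j) (by omega)
            have h3 := sz (s.reg r) (by omega)
            have h4 : s.reg i * e.N + s.reg j < b := by omega
            simp [Safe, Memory.reg_setReg, r1.reg, r1.mul _ h.1, w1.setReg h1]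
            all_goals with_reducible repeat' (first | assumption | apply Memory.Within.setReg | apply Memory.Within.setArr | apply And.intro))
        simpa [Memory.reg_setReg, r1.reg, r1.mul _ h.1, hm2] using this
      · simp only [Cmd.run, if_pos h]
        exact r2.setArr h.2 hx
      · intro h _
        simp [hm2, Memory.reg_setArr, Memory.reg_setReg, hid]
    · refine ⟨m1, ?_, ?_, fun h _ => hid h⟩
      · refine (Exec.seq hm (e1 _) (Exec.head w1 (T := 4) ?_)).mono (by simp [Cmd.cost])
        have e0 : Exec b 3 ⟨Prog.skip :: l, m1⟩ ⟨l, m1⟩ :=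
          Exec.head w1 (Exec.refl (T := 2) w1)
        simp only [Config.step, g2]
        by_cases hi' : s.reg i < e.N
        · rw [if_pos (by omega)]
          refine Exec.head w1 (T := 3) ?_
          simp only [Config.step, g3]
          rw [if_neg (by omega)]
          exact e0
        · rw [if_neg (by omega)]
          exact e0.mono (by simp)
      · simp only [Cmd.run, if_neg h]
        exact r1
  | adj r i =>
    intro d s m hr hm
    have ha := hadj (s.reg i)
    refine simulates_blk hm rfl (by simp [Cmd.cost]) ⟨hm.setReg (hm.2.1 _ _), trivial⟩ ?_
      fun h _ => ?_
    · simp only [List.foldl, Instr.apply_load, hr.reg, hr.adj]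
      exact hr.setReg (by omega)
    · simp [Memory.reg_setReg]
      omega
  | ltCap r j v =>
    intro d s m hr hm
    have key : 1 - (1 - (e.cap (s.reg v) - s.reg j))
        = if s.reg j < e.cap (s.reg v) then 1 else 0 := by split_ifs <;> omega
    refine simulates_blk hm rfl (by simp [Cmd.cost]) ?_ ?_ fun h _ => ?_
    · have h1 : (e.cap (s.reg v)).size ≤ b := by
        rw [← hr.cap]
        exact hm.2.1 _ _
      have h2 := size_mono (Nat.sub_le (e.cap (s.reg v)) (s.reg j)) h1
      have h3 : Nat.size 1 ≤ b := sz 1 (by omega)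
      have h4 := sz (1 - (e.cap (s.reg v) - s.reg j)) (by omega)
      have h5 := sz (1 - (1 - (e.cap (s.reg v) - s.reg j))) (by omega)
      simp [Safe, Memory.reg_setReg, hr.reg, hr.cap, hm.setReg h1]
      all_goals with_reducible repeat' (first | assumption | apply Memory.Within.setReg | apply Memory.Within.setArr | apply And.intro)
    · simp only [List.foldl, Instr.apply_sub, Instr.apply_const, Instr.apply_load,
        Memory.reg_setReg, hr.reg, hr.cap]
      simp only [Cmd.run, ← key]
      simp
      exact ((((hr.scratch (by simp)).scratch (by simp)).scratch (by simp)).scratch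
        (by simp)).setReg (by omega)
    · simp [Memory.reg_setReg]
      omega
  | seq p q hp hq =>
    intro d s m hr hm l
    obtain ⟨m1, e1, r1, h1⟩ := hp d s m hr hm (q.compile d :: l)
    obtain ⟨m2, e2, r2, h2⟩ := hq d _ m1 r1 e1.within_right l
    exact ⟨m2, Exec.seq hm e1 e2, r2, fun h hh => (h2 h hh).trans (h1 h hh)⟩
  | cond r p q hp hq =>
    intro d s m hr hm l
    by_cases h : s.reg r = 0
    · obtain ⟨m1, e1, r1, h1⟩ := hq d s m hr hm l
      refine ⟨m1, (Exec.head hm (T := q.cost e.N) ?_).mono (by simp only [Cmd.cost]; omega),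
        by simpa [Cmd.run, h] using r1, h1⟩
      simpa [Cmd.compile, Config.step, hr.reg, h] using e1
    · obtain ⟨m1, e1, r1, h1⟩ := hp d s m hr hm l
      refine ⟨m1, (Exec.head hm (T := p.cost e.N) ?_).mono (by simp only [Cmd.cost]; omega),
        by simpa [Cmd.run, h] using r1, h1⟩
      simpa [Cmd.compile, Config.step, hr.reg, h] using e1
  | rep i p hp =>
    intro d s m hr hm l
    set f : ℕ → St → St := fun k s' => p.run e (s'.setReg i k) with hf
    set B : Prog := .seq (blk [.add (2 * i + 10) (2 * d + 11) 5]) (.seq (p.compile (d + 1))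
      (blk [.const 2 1, .add (2 * d + 11) (2 * d + 11) 2, .sub 2 1 (2 * d + 11)])) with hB
    set m1 := (m.setReg (2 * d + 11) 0).setReg 2 e.N with hm1
    have w1 : m1.Within b := (hm.setReg (by simp)).setReg (sz _ (by omega))
    have r1 : Rel e s m1 := (hr.scratch (by omega)).scratch (by simp)
    -- Here `j` rounds are still to be run, which is what the tested register `2` holds at the head
    -- of the loop, and `k` rounds have been run, which is what the hidden counter holds.
    have loop : ∀ j k s' m', j + k = e.N → Rel e s' m' → m'.Within b → m'.reg 2 = j →
        m'.reg (2 * d + 11) = k → ∃ m'', Exec b (1 + j * (p.cost e.N + 13))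
          ⟨.loop 2 B :: l, m'⟩ ⟨l, m''⟩ ∧
          (s' = iter f k s → Rel e (iter f e.N s) m'') ∧
          ∀ h < d, m''.reg (2 * h + 11) = m'.reg (2 * h + 11) := by
      intro j
      induction j with
      | zero =>
        intro k s' m' hk hr' hm' h2 h3
        refine ⟨m', (Exec.head hm' (T := 0) ?_).mono (by omega), ?_, fun _ _ => rfl⟩
        · simp only [Config.step, h2]
          exact Exec.refl hm'
        · rintro rfl
          obtain rfl : k = e.N := by omega
          exact hr'
      | succ j ih =>
        intro k s' m' hk hr' hm' h2 h3
        set ma := m'.setReg (2 * i + 10) k with hma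
        have wa : ma.Within b := hm'.setReg (sz _ (by omega))
        have ra : Rel e (s'.setReg i k) ma := hr'.setReg (by omega)
        have ea : ∀ l, Exec b 3 ⟨blk [.add (2 * i + 10) (2 * d + 11) 5] :: l, m'⟩ ⟨l, ma⟩ := by
          intro l
          have := Exec.blk (b := b) (l := l) [.add (2 * i + 10) (2 * d + 11) 5] hm'
            ⟨by simpa [h3, hr'.zero] using wa, trivial⟩
          simpa [h3, hr'.zero] using this
        obtain ⟨mb, eb, rb, hb'⟩ := hp (d + 1) _ ma ra wa
          (blk [.const 2 1, .add (2 * d + 11) (2 * d + 11) 2, .sub 2 1 (2 * d + 11)] ::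
            .loop 2 B :: l)
        have wb : mb.Within b := eb.within_right
        have hbd : mb.reg (2 * d + 11) = k := by
          rw [hb' d (by omega), hma, Memory.reg_setReg, if_neg (by omega), h3]
        set mc := ((mb.setReg 2 1).setReg (2 * d + 11) (k + 1)).setReg 2 (e.N - (k + 1)) with hmc
        have wc : mc.Within b := ((wb.setReg (sz _ (by omega))).setReg (sz _ (by omega))).setReg
          (sz _ (by omega))
        have rc : Rel e (f k s') mc := ((rb.scratch (by simp)).scratch (by omega)).scratch
          (by simp)
        have ec : Exec b 7 ⟨blk [.const 2 1, .add (2 * d + 11) (2 * d + 11) 2,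
            .sub 2 1 (2 * d + 11)] :: .loop 2 B :: l, mb⟩ ⟨.loop 2 B :: l, mc⟩ := by
          have := Exec.blk (b := b) (l := .loop 2 B :: l) [.const 2 1,
            .add (2 * d + 11) (2 * d + 11) 2, .sub 2 1 (2 * d + 11)] wb (by
              have h1 := sz 1 (by omega)
              have h2 := sz (k + 1) (by omega)
              have h3 := sz (e.N - (k + 1)) (by omega)
              simp [Safe, Memory.reg_setReg, hbd, rb.hN, wb.setReg h1]
              all_goals with_reducible repeat' (first | assumption | apply Memory.Within.setReg | apply Memory.Within.setArr | apply And.intro))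
          simpa [Memory.reg_setReg, hbd, rb.hN, hmc] using this
        obtain ⟨md, ed, rd, hd⟩ := ih (k + 1) _ mc (by omega) rc wc
          (by simp [hmc, Memory.reg_setReg]; omega) (by simp [hmc, Memory.reg_setReg])
        refine ⟨md, ?_, ?_, ?_⟩
        · have step : Exec b (1 + (3 + (p.cost e.N + 7 + 1) + 1)) ⟨.loop 2 B :: l, m'⟩
              ⟨.loop 2 B :: l, mc⟩ := by
            rw [add_comm 1]
            refine Exec.head hm' ?_
            simp only [Config.step, h2]
            rw [if_pos (by omega)]
            exact Exec.seq hm' (ea _) (Exec.seq wa eb ec)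
          refine (step.trans ed).mono ?_
          rw [Nat.add_one_mul]
          omega
        · rintro rfl
          exact rd rfl
        · intro h hh
          have a1 : 2 * h + 11 ≠ 2 * d + 11 := by omega
          have a2 : 2 * h + 11 ≠ 2 * i + 10 := by omega
          rw [hd h hh, ← (by rw [hma, Memory.reg_setReg, if_neg a2] :
            ma.reg (2 * h + 11) = m'.reg (2 * h + 11)), ← hb' h (by omega)]
          simp [hmc, Memory.reg_setReg]
          omega
    obtain ⟨m2, e2, r2, h2⟩ := loop e.N 0 s m1 (by omega) r1 w1 (by simp [hm1, Memory.reg_setReg])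
      (by simp [hm1, Memory.reg_setReg])
    refine ⟨m2, ?_, r2 rfl, ?_⟩
    · have e1 : Exec b 5 ⟨blk [.const (2 * d + 11) 0, .sub 2 1 (2 * d + 11)] :: .loop 2 B :: l, m⟩
          ⟨.loop 2 B :: l, m1⟩ := by
        have := Exec.blk (b := b) (l := .loop 2 B :: l)
          [.const (2 * d + 11) 0, .sub 2 1 (2 * d + 11)] hm (by
            have h0 := sz 0 (by omega)
            have h1 := sz e.N (by omega)
            simp [Safe, Memory.reg_setReg, hr.hN]
            all_goals with_reducible repeat' (first | assumption | apply Memory.Within.setReg | apply Memory.Within.setArr | apply And.intro))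
        simpa [Memory.reg_setReg, hr.hN, hm1] using this
      exact (Exec.seq hm e1 e2).mono (by simp only [Cmd.cost]; omega)
    · intro h hh
      rw [h2 h hh]
      simp [hm1, Memory.reg_setReg]
      omega

/-- Commands nest only finitely many loops of length `N`, so the degree is bounded by the nesting
depth plus the degrees added by `comb`. -/
theorem Cmd.cost_le (p : Cmd) : ∃ C k : ℕ, ∀ N, p.cost N ≤ C * (N + 1) ^ k := by
  have one : ∀ (N k : ℕ), 1 ≤ (N + 1) ^ k := fun N k => Nat.one_le_pow _ _ (by omega)
  have comb : ∀ {a b : ℕ → ℕ}, (∃ C k : ℕ, ∀ N, a N ≤ C * (N + 1) ^ k) →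
      (∃ C k : ℕ, ∀ N, b N ≤ C * (N + 1) ^ k) →
      ∃ C k : ℕ, ∀ N, a N + b N + 1 ≤ C * (N + 1) ^ k := by
    rintro a b ⟨C, k, h⟩ ⟨C', k', h'⟩
    refine ⟨C + C' + 1, k + k', fun N => ?_⟩
    have h1 := h N
    have h2 := h' N
    have h3 : C * (N + 1) ^ k ≤ C * (N + 1) ^ (k + k') :=
      Nat.mul_le_mul_left _ (Nat.pow_le_pow_right (by omega) (by omega))
    have h4 : C' * (N + 1) ^ k' ≤ C' * (N + 1) ^ (k + k') :=
      Nat.mul_le_mul_left _ (Nat.pow_le_pow_right (by omega) (by omega))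
    have h5 := one N (k + k')
    rw [add_mul, add_mul]
    omega
  induction p with
  | seq p q hp hq => exact comb hp hq
  | cond r p q hp hq => exact comb hp hq
  | rep i p hp =>
    obtain ⟨C, k, h⟩ := hp
    refine ⟨C + 20, k + 1, fun N => ?_⟩
    have h1 := one N (k + 1)
    have h2 : N * p.cost N ≤ C * (N + 1) ^ (k + 1) := by
      calc N * p.cost N ≤ (N + 1) * (C * (N + 1) ^ k) := Nat.mul_le_mul (by omega) (h N)
        _ = C * (N + 1) ^ (k + 1) := by ring
    have h3 : N ≤ (N + 1) ^ (k + 1) := by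
      calc N ≤ (N + 1) ^ 1 := by rw [pow_one]; omega
        _ ≤ _ := Nat.pow_le_pow_right (by omega) (by omega)
    simp only [Cmd.cost]
    rw [mul_add, add_mul]
    omega
  | _ => exact ⟨16, 0, fun N => by simp [Cmd.cost]⟩

end CapDom

/-! ### Combinatorics of matchings: exchanges, alternating walks, a certificate of maximality. -/

namespace CapDom

/-! ### Matchings

A matching of a graph on the vertices below `N` is an involution that moves every vertex along an
edge or fixes it; the fixed vertices are the exposed ones. -/

/-- `adj` is the adjacency relation of a graph on the vertices below `N`. -/
structure IsGraph (N : ℕ) (adj : ℕ → ℕ → Prop) : Prop where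
  symm : ∀ {u v}, adj u v → adj v u
  irrefl : ∀ {v}, ¬ adj v v
  lt : ∀ {u v}, adj u v → u < N

/-- The vertices that `m` exposes. -/
def exposed (N : ℕ) (m : ℕ → ℕ) : Finset ℕ := (Finset.range N).filter fun v => m v = v

@[simp] theorem mem_exposed {N : ℕ} {m : ℕ → ℕ} {v : ℕ} : v ∈ exposed N m ↔ v < N ∧ m v = v := by
  simp [exposed]

/-- `m` is a matching that exposes `k` vertices. -/
structure IsMatch (N : ℕ) (adj : ℕ → ℕ → Prop) (k : ℕ) (m : ℕ → ℕ) : Prop where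
  inv : ∀ v, m (m v) = v
  adj : ∀ {v}, m v ≠ v → adj v (m v)
  card : (exposed N m).card = k

/-- The matching `m` after `v`, exposed by it, is matched to `u`, exposing the partner of `u`. -/
def sw (m : ℕ → ℕ) (v u : ℕ) : ℕ → ℕ := fun x =>
  if x = m u then m u else if x = u then v else if x = v then u else m x

/-- The matching `m` after the two exposed vertices `u` and `v` are matched. -/
def aug (m : ℕ → ℕ) (v u : ℕ) : ℕ → ℕ := fun x => if x = u then v else if x = v then u else m x

variable {N k : ℕ} {adj : ℕ → ℕ → Prop} {m m' : ℕ → ℕ}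

theorem IsMatch.inj (hm : IsMatch N adj k m) {u v : ℕ} (h : m u = m v) : u = v := by
  rw [← hm.inv u, h, hm.inv]

theorem IsMatch.lt (hG : IsGraph N adj) (hm : IsMatch N adj k m) {v : ℕ} (hv : v < N) :
    m v < N := by
  by_cases h : m v = v
  · rwa [h]
  · exact hG.lt (hG.symm (hm.adj h))

theorem sw_self {v : ℕ} (h : m v = v) : sw m v v = m := by
  funext x
  simp only [sw, h]
  split_ifs with h1 <;> simp_all

theorem sw_eq_self_iff (hG : IsGraph N adj) (hm : IsMatch N adj k m) {v u : ℕ} (hv : m v = v)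
    (ha : adj v u) (hu : m u ≠ u) (x : ℕ) : sw m v u x = x ↔ m x = x ∧ x ≠ v ∨ x = m u := by
  have hvu : v ≠ u := fun h => hG.irrefl (h ▸ ha)
  have hw : m (m u) = u := hm.inv u
  have hwv : m u ≠ v := fun h => hvu (by rw [← hw, h, hv])
  simp only [sw]
  split_ifs with h1 h2 h3
  · simp [h1]
  · subst h2
    simp [hvu, hu, h1]
  · subst h3
    simp [h1, Ne.symm hvu]
  · simp [h1, h3]

theorem IsMatch.sw (hG : IsGraph N adj) (hm : IsMatch N adj k m) {v u : ℕ} (hv : m v = v)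
    (ha : adj v u) (hu : m u ≠ u) : IsMatch N adj k (sw m v u) := by
  have hvu : v ≠ u := fun h => hG.irrefl (h ▸ ha)
  have hw : m (m u) = u := hm.inv u
  have hwv : m u ≠ v := fun h => hvu (by rw [← hw, h, hv])
  have hvN : v < N := hG.lt ha
  have huN : u < N := hG.lt (hG.symm ha)
  refine ⟨fun x => ?_, fun {x} hx => ?_, ?_⟩
  · by_cases h1 : x = m u
    · simp [CapDom.sw, h1]
    by_cases h2 : x = u
    · subst h2
      simp [CapDom.sw, h1, hvu, Ne.symm hwv]
    by_cases h3 : x = v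
    · subst h3
      simp [CapDom.sw, h1, h2, Ne.symm hu]
    have h4 : m x ≠ m u := fun h => h2 (hm.inj h)
    have h5 : m x ≠ u := fun h => h1 (by rw [← h, hm.inv])
    have h6 : m x ≠ v := fun h => h3 (by rw [← hm.inv x, h, hv])
    simp [CapDom.sw, h1, h2, h3, h4, h5, h6, hm.inv]
  · simp only [CapDom.sw] at hx ⊢
    split_ifs at hx ⊢ with h1 h2 h3
    · exact absurd h1.symm hx
    · exact h2 ▸ hG.symm ha
    · exact h3 ▸ ha
    · exact hm.adj hx
  · have : exposed N (CapDom.sw m v u) = insert (m u) ((exposed N m).erase v) := by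
      ext x
      rw [mem_exposed, sw_eq_self_iff hG hm hv ha hu, Finset.mem_insert, Finset.mem_erase,
        mem_exposed]
      constructor
      · tauto
      · rintro (h | h)
        · exact ⟨h ▸ hm.lt hG huN, Or.inr h⟩
        · tauto
    rw [this, Finset.card_insert_of_notMem, Finset.card_erase_of_mem, hm.card]
    · have : 0 < (exposed N m).card := Finset.card_pos.2 ⟨v, by simp [hvN, hv]⟩
      rw [hm.card] at this
      omega
    · simp [hvN, hv]
    · simp [hw, hu.symm]

theorem IsMatch.aug (hG : IsGraph N adj) (hm : IsMatch N adj k m) {v u : ℕ} (hv : m v = v)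
    (ha : adj v u) (hu : m u = u) : ∃ k', k' + 2 = k ∧ IsMatch N adj k' (aug m v u) := by
  have hvu : v ≠ u := fun h => hG.irrefl (h ▸ ha)
  have hvN : v < N := hG.lt ha
  have huN : u < N := hG.lt (hG.symm ha)
  have hE : exposed N (CapDom.aug m v u) = ((exposed N m).erase v).erase u := by
    ext x
    simp only [mem_exposed, Finset.mem_erase, CapDom.aug]
    by_cases h1 : x = u
    · simp [h1, hvu]
    by_cases h2 : x = v
    · simp [h2, hvu, Ne.symm hvu]
    · simp [h1, h2]
  have hc : ((exposed N m).erase v).card + 1 = k := by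
    rw [Finset.card_erase_add_one (by simp [hvN, hv]), hm.card]
  have hc' : (((exposed N m).erase v).erase u).card + 1 = ((exposed N m).erase v).card :=
    Finset.card_erase_add_one (by simp [huN, hu, Ne.symm hvu])
  refine ⟨(exposed N (CapDom.aug m v u)).card, by rw [hE]; omega, fun x => ?_, fun {x} hx => ?_,
    rfl⟩
  · by_cases h1 : x = u
    · subst h1
      simp [CapDom.aug, hvu]
    by_cases h2 : x = v
    · subst h2
      simp [CapDom.aug, h1]
    have h3 : m x ≠ u := fun h => h1 (by rw [← hm.inv x, h, hu])
    have h4 : m x ≠ v := fun h => h2 (by rw [← hm.inv x, h, hv])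
    simp [CapDom.aug, h1, h2, h3, h4, hm.inv]
  · simp only [CapDom.aug] at hx ⊢
    split_ifs at hx ⊢ with h1 h2
    · exact h1 ▸ hG.symm ha
    · exact h2 ▸ ha
    · exact hm.adj hx

/-! ### Walks in the union of two matchings -/

/-- From the matching `m`, which exposes `g₀`, repeatedly match the exposed vertex `g` as `m'` does;
all matchings on the way, except for the last one, satisfy `Φ`. The sets collect the vertices that
were exposed and those to which they were matched. -/
inductive Walk (Φ : (ℕ → ℕ) → Prop) (m m' : ℕ → ℕ) (g₀ : ℕ) :
    (ℕ → ℕ) → ℕ → Finset ℕ → Finset ℕ → Prop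
  | start : Walk Φ m m' g₀ m g₀ ∅ ∅
  | step {μ g G U} : Walk Φ m m' g₀ μ g G U → Φ μ → m' g ≠ g → μ (m' g) ≠ m' g →
      Walk Φ m m' g₀ (sw μ g (m' g)) (μ (m' g)) (insert g G) (insert (m' g) U)

theorem Walk.mono {Φ Ψ : (ℕ → ℕ) → Prop} (h : ∀ μ, Φ μ → Ψ μ) {g₀ g : ℕ} {μ : ℕ → ℕ}
    {G U : Finset ℕ} (hw : Walk Φ m m' g₀ μ g G U) : Walk Ψ m m' g₀ μ g G U := by
  induction hw with
  | start => exact .start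
  | step _ h1 h2 h3 ih => exact .step ih (h _ h1) h2 h3

theorem Walk.head {Φ : (ℕ → ℕ) → Prop} {g₀ g : ℕ} {μ : ℕ → ℕ}
    {G U : Finset ℕ} (hw : Walk Φ m m' g₀ μ g G U) (h : Φ μ) : Φ m := by
  induction hw with
  | start => exact h
  | step _ h1 _ _ ih => exact ih h1

/-- What is known about the course of a walk. -/
structure WalkInv (N : ℕ) (adj : ℕ → ℕ → Prop) (k : ℕ) (m m' : ℕ → ℕ) (g₀ : ℕ)
    (μ : ℕ → ℕ) (g : ℕ) (G U : Finset ℕ) : Prop where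
  lt : g < N
  sub : ∀ x ∈ G ∪ U, x < N
  cardG : U.card = G.card
  disj : ∀ x ∈ G, x ∉ U
  notG : g ∉ G
  notU : g ∉ U
  mapG : ∀ x ∈ G, m' x ∈ U
  mapU : ∀ x ∈ U, m' x ∈ G
  back : ∀ x ∈ U, m x ∈ insert g G
  fwd : ∀ x ∈ insert g G, x ≠ g₀ → m x ∈ U
  fix : μ g = g
  inside : ∀ x ∈ G ∪ U, μ x = m' x
  outside : ∀ x, x ∉ G → x ∉ U → x ≠ g → μ x = m x
  start : g₀ ∈ insert g G
  isMatch : IsMatch N adj k μ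
  expose : ∀ x, μ x = x ↔ m x = x ∧ x ≠ g₀ ∨ x = g

/-- A walk traces a path of the union of `m` and `m'` from an endpoint. Both maps are involutions,
so a path cannot run into itself, and its vertices split into the side `insert g G` of exposed
vertices and the side `U`; the current matching agrees with `m'` behind the exposed vertex and with
`m` off the path. -/
theorem Walk.inv (hG : IsGraph N adj) {k' : ℕ} (hm : IsMatch N adj k m)
    (hm' : IsMatch N adj k' m') {g₀ : ℕ} (h0 : m g₀ = g₀) (hN : g₀ < N) {Φ : (ℕ → ℕ) → Prop}
    {μ : ℕ → ℕ} {g : ℕ} {G U : Finset ℕ} (hw : Walk Φ m m' g₀ μ g G U) :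
    WalkInv N adj k m m' g₀ μ g G U := by
  induction hw with
  | start =>
    constructor <;> first | assumption | simp
    intro x
    by_cases hx : x = g₀ <;> simp [hx, h0]
  | @step μ g G U _ _ h1 h2 ih =>
    have hu1 : m' g ∉ U := fun h => ih.notG (by simpa [hm'.inv] using ih.mapU _ h)
    have hu2 : m' g ∉ G := fun h => ih.notU (by simpa [hm'.inv] using ih.mapG _ h)
    have hmu : μ (m' g) = m (m' g) := ih.outside _ hu2 hu1 h1
    have hadj : adj g (m' g) := hm'.adj (by simpa using h1)
    rw [hmu] at h2 ⊢
    -- If the newly exposed vertex had been exposed before, its `m`-partner `m' g` would be in `U`,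
    -- or would be the start `g₀`; both have been excluded.
    have hw1 : m (m' g) ∉ insert g G := by
      intro h
      by_cases h3 : m (m' g) = g₀
      · have : m' g = g₀ := by rw [← hm.inv (m' g), h3, h0]
        have h4 := ih.start
        rw [← this, Finset.mem_insert] at h4
        tauto
      · have := ih.fwd _ h h3
        rw [hm.inv] at this
        exact hu1 this
    have hw2 : m (m' g) ∉ U := by
      intro h
      have := ih.back _ h
      rw [hm.inv, Finset.mem_insert] at this
      tauto
    rw [Finset.mem_insert, not_or] at hw1
    have hgm : m g = g → g = g₀ := by
      intro h
      by_contra h'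
      exact ih.notU (h ▸ ih.fwd g (Finset.mem_insert_self _ _) h')
    have hsw : ∀ x, x ≠ m (m' g) → x ≠ m' g → x ≠ g → CapDom.sw μ g (m' g) x = μ x := by
      intro x a b c
      simp [CapDom.sw, hmu, a, b, c]
    have hsw1 : CapDom.sw μ g (m' g) g = m' g := by
      simp [CapDom.sw, hmu, Ne.symm hw1.1, h1.symm]
    have hsw2 : CapDom.sw μ g (m' g) (m' g) = g := by
      simp [CapDom.sw, hmu, h2.symm]
    constructor
    · exact hm.lt hG (hG.lt (hG.symm hadj))
    · intro x hx
      simp only [Finset.mem_union, Finset.mem_insert] at hx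
      rcases hx with (rfl | hx) | (rfl | hx)
      · exact ih.lt
      · exact ih.sub x (by simp [hx])
      · exact hG.lt (hG.symm hadj)
      · exact ih.sub x (by simp [hx])
    · rw [Finset.card_insert_of_notMem hu1, Finset.card_insert_of_notMem ih.notG, ih.cardG]
    · intro x hx hx'
      rw [Finset.mem_insert] at hx hx'
      rcases hx with rfl | hx
      · exact hx'.elim (fun h => h1 h.symm) ih.notU
      · rcases hx' with rfl | hx'
        exacts [hu2 hx, ih.disj x hx hx']
    · simp [hw1]
    · simp [hw2, h2]
    · intro x hx
      rw [Finset.mem_insert] at hx ⊢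
      rcases hx with rfl | hx
      exacts [Or.inl rfl, Or.inr (ih.mapG x hx)]
    · intro x hx
      rw [Finset.mem_insert] at hx ⊢
      rcases hx with rfl | hx
      exacts [Or.inl (hm'.inv g), Or.inr (ih.mapU x hx)]
    · intro x hx
      rw [Finset.mem_insert] at hx
      rcases hx with rfl | hx
      · exact Finset.mem_insert_self _ _
      · exact Finset.mem_insert_of_mem (ih.back x hx)
    · intro x hx hx'
      rw [Finset.mem_insert] at hx
      rcases hx with rfl | hx
      · simp [hm.inv]
      · exact Finset.mem_insert_of_mem (ih.fwd x hx hx')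
    · simp [CapDom.sw, hmu]
    · intro x hx
      by_cases hxg : x = g
      · rw [hxg, hsw1]
      by_cases hxu : x = m' g
      · rw [hxu, hsw2, hm'.inv]
      have hx' : x ∈ G ∪ U := by
        simp only [Finset.mem_union, Finset.mem_insert] at hx ⊢
        tauto
      rw [hsw x _ hxu hxg, ih.inside x hx']
      rintro rfl
      simp only [Finset.mem_union] at hx'
      tauto
    · intro x a b c
      rw [Finset.mem_insert, not_or] at a b
      rw [hsw x c b.1 a.1, ih.outside x a.2 b.2 a.1]
    · exact Finset.mem_insert_of_mem ih.start
    · exact ih.isMatch.sw hG ih.fix hadj (by rwa [hmu])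
    · intro x
      rw [sw_eq_self_iff hG ih.isMatch ih.fix hadj (by rwa [hmu]), ih.expose, hmu]
      constructor
      · rintro (⟨h | h, h'⟩ | h)
        · exact Or.inl h
        · exact absurd h h'
        · exact Or.inr h
      · rintro (h | h)
        · refine Or.inl ⟨Or.inl h, ?_⟩
          rintro rfl
          exact h.2 (hgm h.1)
        · exact Or.inr h

/-- Induction along the exposed side of a walk. The hypothesis mentions `m` instead of the current
matching, since the two agree at the vertex about to be released. -/
theorem Walk.forall_mem {Φ : (ℕ → ℕ) → Prop} {g₀ : ℕ} {μ : ℕ → ℕ} {g : ℕ} {G U : Finset ℕ}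
    (hG : IsGraph N adj) {k' : ℕ} (hm : IsMatch N adj k m) (hm' : IsMatch N adj k' m')
    (h0 : m g₀ = g₀) (hN : g₀ < N) (P : ℕ → Prop) (hP0 : P g₀)
    (hP : ∀ x, P x → m' x ≠ x → P (m (m' x))) (hw : Walk Φ m m' g₀ μ g G U) :
    P g ∧ ∀ x ∈ G, P x := by
  induction hw with
  | start => exact ⟨hP0, by simp⟩
  | @step μ g G U hw _ h1 h2 ih =>
    have hi := hw.inv hG hm hm' h0 hN
    have hu1 : m' g ∉ U := fun h => hi.notG (by simpa [hm'.inv] using hi.mapU _ h)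
    have hu2 : m' g ∉ G := fun h => hi.notU (by simpa [hm'.inv] using hi.mapG _ h)
    rw [hi.outside _ hu2 hu1 h1]
    exact ⟨hP g ih.1 h1, by simpa using ih⟩

theorem Walk.forall_good {Φ : (ℕ → ℕ) → Prop} {g₀ : ℕ} {μ : ℕ → ℕ} {g : ℕ} {G U : Finset ℕ}
    (hG : IsGraph N adj) {k' : ℕ} (hm : IsMatch N adj k m) (hm' : IsMatch N adj k' m')
    (h0 : m g₀ = g₀) (hN : g₀ < N) (hw : Walk Φ m m' g₀ μ g G U) :
    ∀ x ∈ G, ∃ ν, Φ ν ∧ ν x = x := by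
  induction hw with
  | start => simp
  | @step μ g G U hw h h1 h2 ih =>
    intro x hx
    rw [Finset.mem_insert] at hx
    rcases hx with rfl | hx
    · exact ⟨μ, h, (hw.inv hG hm hm' h0 hN).fix⟩
    · exact ih x hx

/-- A set that is closed under both matchings contains all of a walk or nothing of it. -/
theorem Walk.closed {Φ : (ℕ → ℕ) → Prop} {g₀ : ℕ} {μ : ℕ → ℕ} {g : ℕ} {G U : Finset ℕ}
    (hG : IsGraph N adj) {k' : ℕ} (hm : IsMatch N adj k m) (hm' : IsMatch N adj k' m')
    (h0 : m g₀ = g₀) (hN : g₀ < N) {C : Set ℕ} (hC : ∀ x ∈ C, m x ∈ C) (hC' : ∀ x ∈ C, m' x ∈ C)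
    (hw : Walk Φ m m' g₀ μ g G U) :
    (g ∈ C → g₀ ∈ C) ∧ (g₀ ∈ C → g ∈ C ∧ (∀ x ∈ G, x ∈ C) ∧ ∀ x ∈ U, x ∈ C) := by
  induction hw with
  | start => simp
  | @step μ g G U hw _ h1 h2 ih =>
    have hi := hw.inv hG hm hm' h0 hN
    have hu1 : m' g ∉ U := fun h => hi.notG (by simpa [hm'.inv] using hi.mapU _ h)
    have hu2 : m' g ∉ G := fun h => hi.notU (by simpa [hm'.inv] using hi.mapG _ h)
    rw [hi.outside _ hu2 hu1 h1]
    constructor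
    · intro h
      have h3 := hC' _ (hC _ h)
      rw [hm.inv, hm'.inv] at h3
      exact ih.1 h3
    · intro h
      obtain ⟨a, b, c⟩ := ih.2 h
      refine ⟨hC _ (hC' _ a), ?_, ?_⟩
      · intro x hx
        rw [Finset.mem_insert] at hx
        rcases hx with rfl | hx
        exacts [a, b x hx]
      · intro x hx
        rw [Finset.mem_insert] at hx
        rcases hx with rfl | hx
        exacts [hC' _ a, c x hx]

/-- If no walk from a vertex that `m` exposes meets an obstacle, then every vertex that `m'`
exposes is the end of such a walk. -/
theorem exists_walk_to (hG : IsGraph N adj) (hm : IsMatch N adj k m) (hm' : IsMatch N adj k m')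
    {Φ : (ℕ → ℕ) → Prop}
    (h : ∀ g < N, m g = g → ∃ μ g' G U, Walk Φ m m' g μ g' G U ∧ Φ μ ∧ m' g' = g')
    {x : ℕ} (hxN : x < N) (hx : m' x = x) :
    ∃ g μ G U, g < N ∧ m g = g ∧ Walk Φ m m' g μ x G U ∧ Φ μ := by
  choose! μ e G U hw hΦ he using h
  have hmaps : Set.MapsTo e (exposed N m) (exposed N m') := by
    intro g hg
    simp only [Finset.mem_coe, mem_exposed] at hg ⊢
    exact ⟨((hw g hg.1 hg.2).inv hG hm hm' hg.2 hg.1).lt, he g hg.1 hg.2⟩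
  -- Walks with the same end have the same start: the vertices of one form a set closed under both
  -- involutions, which therefore contains the start of the other, and a vertex exposed by `m` can
  -- occur on a walk only as its start.
  have hinj : Set.InjOn e (exposed N m) := by
    intro g hg g' hg' hgg
    simp only [Finset.mem_coe, mem_exposed] at hg hg'
    have w := hw g hg.1 hg.2
    have w' := hw g' hg'.1 hg'.2
    have i' := w'.inv hG hm hm' hg'.2 hg'.1
    set C : Set ℕ := {y | y ∈ insert (e g') (G g') ∨ y ∈ U g'} with hCdef
    have hC : ∀ y ∈ C, m y ∈ C := by
      rintro y (hy | hy)
      · by_cases hyg : y = g'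
        · rw [hyg, hg'.2]
          exact Or.inl i'.start
        · exact Or.inr (i'.fwd y hy hyg)
      · exact Or.inl (i'.back y hy)
    have hC' : ∀ y ∈ C, m' y ∈ C := by
      rintro y (hy | hy)
      · rw [Finset.mem_insert] at hy
        rcases hy with rfl | hy
        · rw [he g' hg'.1 hg'.2]
          exact Or.inl (Finset.mem_insert_self _ _)
        · exact Or.inr (i'.mapG y hy)
      · exact Or.inl (Finset.mem_insert_of_mem (i'.mapU y hy))
    have hgC : g ∈ C := (w.closed hG hm hm' hg.2 hg.1 hC hC').1
      (by rw [hgg]; exact Or.inl (Finset.mem_insert_self _ _))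
    have hd : ∀ y ∈ insert (e g') (G g'), y ∉ U g' := by
      intro y hy
      rw [Finset.mem_insert] at hy
      rcases hy with rfl | hy
      exacts [i'.notU, i'.disj y hy]
    rcases hgC with hgC | hgC
    · by_contra hne
      have := i'.fwd g hgC hne
      rw [hg.2] at this
      exact hd g hgC this
    · have := i'.back g hgC
      rw [hg.2] at this
      exact absurd hgC (hd g this)
  -- Both matchings expose `k` vertices, so the injective map from starts to ends is onto. This is
  -- where equality of the sizes is used.
  have hsurj := Finset.surjOn_of_injOn_of_card_le e hmaps hinj (by rw [hm.card, hm'.card])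
  obtain ⟨g, hg, rfl⟩ := hsurj (by simp [hxN, hx] : x ∈ (exposed N m' : Set ℕ))
  simp only [Finset.mem_coe, mem_exposed] at hg
  exact ⟨g, μ g, G g, U g, hg.1, hg.2, hw g hg.1 hg.2, hΦ g hg.1 hg.2⟩

end CapDom

namespace CapDom

variable {N k : ℕ} {adj : ℕ → ℕ → Prop} {m m' : ℕ → ℕ}

/-! ### A criterion for a matching to be maximum

`D` is a set of vertices `d`, each exposed by a known matching `R d`; all known matchings have the
same size. -/

/-- All vertices that are exposed by `m`, or by `m` after one exchange, belong to `D`, and `m` has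
no exposed neighbours. -/
def Good (N : ℕ) (adj : ℕ → ℕ → Prop) (D : Set ℕ) (m : ℕ → ℕ) : Prop :=
  ∀ v < N, m v = v → v ∈ D ∧ ∀ u, adj v u → m u ≠ u ∧ m u ∈ D

/-- The walk from `g` in the union of `m` and `m'` is not obstructed, and all matchings on it
satisfy `Φ`. -/
def WalkOK (Φ : (ℕ → ℕ) → Prop) (m m' : ℕ → ℕ) (g : ℕ) : Prop :=
  ∃ μ g' G U, Walk Φ m m' g μ g' G U ∧ Φ μ ∧ m' g' = g'

/-- The vertices reachable from `p` inside `D`. -/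
def Reach (adj : ℕ → ℕ → Prop) (D : Set ℕ) : ℕ → ℕ → Prop :=
  Relation.ReflTransGen fun r t => adj r t ∧ r ∈ D ∧ t ∈ D

/-- Matchings obtained from `m`, which exposes `p`, by moving the exposed vertex along edges
inside `D`. -/
inductive Chain (N : ℕ) (adj : ℕ → ℕ → Prop) (D : Set ℕ) (R : ℕ → ℕ → ℕ) (p : ℕ) (m : ℕ → ℕ) :
    ℕ → (ℕ → ℕ) → Prop
  | base : Chain N adj D R p m p m
  | step {r μ t ν g G U} : Chain N adj D R p m r μ → t ∈ D → adj r t →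
      (∀ g < N, μ g = g → ∀ u, u = g ∨ adj g u →
        WalkOK (Good N adj D) (sw μ g u) (R t) (μ u)) →
      g < N → μ g = g → Walk (Good N adj D) μ (R t) g ν t G U → Good N adj D ν →
      Chain N adj D R p m t ν

/-- The exposed vertex `p` of `m` can be moved to all vertices reachable from it. -/
def Movable (N : ℕ) (adj : ℕ → ℕ → Prop) (D : Set ℕ) (R : ℕ → ℕ → ℕ) (m : ℕ → ℕ) (p : ℕ) : Prop :=
  Good N adj D m ∧ ∀ t, Reach adj D p t → ∃ ν, Chain N adj D R p m t ν

/-- Like `Good`, with `Movable` for all the matchings concerned. -/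
def Heavy (N : ℕ) (adj : ℕ → ℕ → Prop) (D : Set ℕ) (R : ℕ → ℕ → ℕ) (m : ℕ → ℕ) : Prop :=
  Good N adj D m ∧ ∀ v < N, m v = v → ∀ u, u = v ∨ adj v u → Movable N adj D R (sw m v u) (m u)

/-- The matchings `R d` are matchings that expose `k` vertices, among them `d`. -/
def IsFamily (N : ℕ) (adj : ℕ → ℕ → Prop) (k : ℕ) (D : Set ℕ) (R : ℕ → ℕ → ℕ) : Prop :=
  ∀ d ∈ D, d < N ∧ IsMatch N adj k (R d) ∧ R d d = d

/-- The boundary of `D`. -/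
def Bdry (adj : ℕ → ℕ → Prop) (D : Set ℕ) (a : ℕ) : Prop := a ∉ D ∧ ∃ d ∈ D, adj d a

/-- The vertices that `m` exposes or matches into the boundary of `D`. -/
def Exc (adj : ℕ → ℕ → Prop) (D : Set ℕ) (m : ℕ → ℕ) (q : ℕ) : Prop := m q = q ∨ Bdry adj D (m q)

variable {D : Set ℕ} {R : ℕ → ℕ → ℕ}

theorem Reach.symm (hG : IsGraph N adj) {p q : ℕ} (h : Reach adj D p q) : Reach adj D q p := by
  induction h with
  | refl => exact .refl
  | tail _ h ih => exact .head ⟨hG.symm h.1, h.2.2, h.2.1⟩ ih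

/-- Every vertex on the exposed side is at some moment exposed by a `Good` matching, and such
vertices belong to `D`. -/
theorem Walk.subset_good {g₀ : ℕ} {μ : ℕ → ℕ} {g : ℕ} {G U : Finset ℕ} {k' : ℕ}
    (hG : IsGraph N adj) (hm : IsMatch N adj k m) (hm' : IsMatch N adj k' m')
    (h0 : m g₀ = g₀) (hN : g₀ < N) (hw : Walk (Good N adj D) m m' g₀ μ g G U)
    (hμ : Good N adj D μ) : ∀ x ∈ insert g G, x ∈ D := by
  have hi := hw.inv hG hm hm' h0 hN
  intro x hx
  rw [Finset.mem_insert] at hx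
  rcases hx with rfl | hx
  · exact (hμ x hi.lt hi.fix).1
  · obtain ⟨ν, hν, hx'⟩ := hw.forall_good hG hm hm' h0 hN x hx
    exact (hν x (hi.sub x (by simp [hx])) hx').1

/-- What is known about the matchings in a chain. -/
structure ChainInv (N : ℕ) (adj : ℕ → ℕ → Prop) (k : ℕ) (D : Set ℕ) (p : ℕ) (m : ℕ → ℕ)
    (t : ℕ) (ν : ℕ → ℕ) : Prop where
  isMatch : IsMatch N adj k ν
  fix : ν t = t
  lt : t < N
  good : Good N adj D ν
  exc : ∀ q, Exc adj D m q → q ≠ p → Exc adj D ν q ∧ q ≠ t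

/-- The heart of the criterion: moving an exposed vertex along an edge `r t` inside `D` leaves all
other exceptional vertices exceptional. The exposed vertex moves along the walk from `r` to `t`. An
exceptional vertex could suffer only if its boundary partner were on this walk; but the walk
together with the edge `r t` is an odd cycle, and running round it in the opposite sense exposes the
vertices of its other side, so that all of it would lie in `D`. -/
theorem Chain.inv (hG : IsGraph N adj) (hR : IsFamily N adj k D R) {p t : ℕ} {ν : ℕ → ℕ}
    (hm : IsMatch N adj k m) (hp : m p = p) (hpN : p < N) (hgood : Good N adj D m)
    (hc : Chain N adj D R p m t ν) : ChainInv N adj k D p m t ν := by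
  induction hc with
  | base => exact ⟨hm, hp, hpN, hgood, fun q hq hqp => ⟨hq, hqp⟩⟩
  | @step r μ t ν g G U hc htD hrt hall hgN hg hw hν ih =>
    obtain ⟨htN, hRt, hRtt⟩ := hR t htD
    have hi := hw.inv hG ih.isMatch hRt hg hgN
    obtain ⟨-, hr2⟩ := ih.good r ih.lt ih.fix
    obtain ⟨hmt, hmtD⟩ := hr2 t hrt
    have hrtne : r ≠ t := fun h => hG.irrefl (h ▸ hrt)
    have hDG := hw.subset_good hG ih.isMatch hRt hg hgN hν
    -- Otherwise the new matching would expose both ends of the edge `r t`, contradicting `Good`.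
    have hgr : g = r := by
      by_contra hne
      have h1 : ν r = r := (hi.expose r).2 (Or.inl ⟨ih.fix, Ne.symm hne⟩)
      exact ((hν r ih.lt h1).2 t hrt).1 hi.fix
    subst hgr
    refine ⟨hi.isMatch, hi.fix, hi.lt, hν, fun q hq hqp => ?_⟩
    obtain ⟨hq1, hqr⟩ := ih.exc q hq hqp
    have hqt : q ≠ t := by
      rintro rfl
      rcases hq1 with h | h
      · exact hmt h
      · exact h.1 hmtD
    refine ⟨?_, hqt⟩
    rcases hq1 with hq1 | hq1
    · exact Or.inl ((hi.expose q).2 (Or.inl ⟨hq1, hqr⟩))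
    right
    by_cases hqU : q ∈ U
    · exact absurd (hDG _ (hi.back q hqU)) hq1.1
    by_cases hqG : q ∈ G
    swap
    · rwa [hi.outside q hqG hqU hqt]
    exfalso
    have haU : μ q ∈ U := hi.fwd q (Finset.mem_insert_of_mem hqG) hqr
    -- After `r` is matched to `t`, the former partner `y` of `t` is exposed, and the walk from `y`
    -- towards `R t` follows the first walk backwards.
    obtain ⟨μ₂, e, G₂, U₂, hw2, hμ₂, he⟩ := hall g ih.lt ih.fix t (Or.inr hrt)
    set y := μ t with hy
    have hyU : y ∈ U := hi.fwd t (Finset.mem_insert_self _ _) (Ne.symm hrtne)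
    have hyN : y < N := hi.sub y (by simp [hyU])
    have hm5 := ih.isMatch.sw hG ih.fix hrt hmt
    have hyg : y ≠ g := by
      intro h
      have := ih.isMatch.inv t
      rw [← hy, h, ih.fix] at this
      exact hrtne this
    have h5y : sw μ g t y = y := by simp [sw, hy]
    have h5t : sw μ g t t = g := by simp [sw, ← hy, hmt.symm]
    have h5g : sw μ g t g = t := by simp [sw, ← hy, hrtne, hyg.symm]
    have h5 : ∀ x, x ≠ y → x ≠ t → x ≠ g → sw μ g t x = μ x := by
      intro x a b c
      simp [sw, ← hy, a, b, c]
    have hi2 := hw2.inv hG hm5 hRt h5y hyN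
    have hDG2 := hw2.subset_good hG hm5 hRt h5y hyN hμ₂
    have hd : ∀ x ∈ insert t G, x ∉ U := by
      intro x hx
      rw [Finset.mem_insert] at hx
      rcases hx with rfl | hx
      exacts [hi.notU, hi.disj x hx]
    -- the second walk alternates between the two sides of the first one
    have hside := hw2.forall_mem hG hm5 hRt h5y hyN (fun x => x ∈ U ∨ x = t) (Or.inl hyU) (by
      intro x hx hRx
      rcases hx with hx | rfl
      swap
      · exact absurd hRtt hRx
      have hxG := hi.mapU x hx
      by_cases h1 : R t x = g
      · rw [h1, h5g]
        exact Or.inr rfl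
      have h2 : R t x ≠ t := fun h => hi.notG (h ▸ hxG)
      have h3 : R t x ≠ y := fun h => hi.disj _ hxG (h ▸ hyU)
      rw [h5 _ h3 h2 h1]
      exact Or.inl (hi.fwd _ (Finset.mem_insert_of_mem hxG) h1))
    have het : e = t := by
      rcases hside.1 with h | h
      · have h1 := hi.mapU e h
        rw [he] at h1
        exact absurd h (hi.disj e h1)
      · exact h
    subst het
    -- the second walk covers the first one
    set C : Set ℕ := {x | x ∈ insert e G₂ ∨ x ∈ U₂} with hC
    have hC5 : ∀ x ∈ C, sw μ g e x ∈ C := by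
      rintro x (hx | hx)
      · by_cases hxy : x = y
        · rw [hxy, h5y]
          exact Or.inl hi2.start
        · exact Or.inr (hi2.fwd x hx hxy)
      · exact Or.inl (hi2.back x hx)
    have heC : e ∈ C := Or.inl (Finset.mem_insert_self _ _)
    have hgC : g ∈ C := h5t ▸ hC5 e heC
    have hCμ : ∀ x ∈ C, μ x ∈ C := by
      intro x hx
      by_cases h1 : x = g
      · rw [h1, ih.fix]
        exact hgC
      by_cases h2 : x = e
      · rw [h2]
        exact Or.inl hi2.start
      by_cases h3 : x = y
      · rw [h3, hy, ih.isMatch.inv]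
        exact heC
      · exact h5 x h3 h2 h1 ▸ hC5 x hx
    have hCR : ∀ x ∈ C, R e x ∈ C := by
      rintro x (hx | hx)
      · rw [Finset.mem_insert] at hx
        rcases hx with rfl | hx
        · rw [he]
          exact heC
        · exact Or.inr (hi2.mapG x hx)
      · exact Or.inl (Finset.mem_insert_of_mem (hi2.mapU x hx))
    -- Let `a` be the boundary partner of `q`. As a vertex of the first walk it is on the second
    -- one. On its exposed side it would be in `D`; on the other side, its `R`-partner would be
    -- exposed by the second walk, hence be in `U` or be the end, which is impossible as `a` itself
    -- is in `U`.
    have haC := ((hw.closed hG ih.isMatch hRt hg hgN hCμ hCR).2 hgC).2.2 _ haU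
    rcases haC with h | h
    · exact hq1.1 (hDG2 _ h)
    · have h1 := hi2.mapU _ h
      rcases hside.2 _ h1 with h2 | h2
      · have h3 := hi.mapU _ h2
        rw [hRt.inv] at h3
        exact hi.disj _ h3 haU
      · exact hi2.notG (h2 ▸ h1)

/-- A chain to `t` never makes the exposed vertex coincide with another exceptional vertex, yet it
ends with `t` exposed. -/
theorem Movable.not_exc (hG : IsGraph N adj) (hR : IsFamily N adj k D R) {p t : ℕ}
    (hm : IsMatch N adj k m) (hp : m p = p) (hpN : p < N) (h : Movable N adj D R m p)
    (ht : Reach adj D p t) (htp : t ≠ p) : ¬ Exc adj D m t := by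
  obtain ⟨ν, hν⟩ := h.2 t ht
  exact fun hexc => ((hν.inv hG hR hm hp hpN h.1).exc t hexc htp).2 rfl

/-- The known matchings give no way to a larger matching or to a larger set `D`. -/
structure Stuck (N : ℕ) (adj : ℕ → ℕ → Prop) (k : ℕ) (D : Set ℕ) (R : ℕ → ℕ → ℕ) (M : ℕ → ℕ) :
    Prop where
  family : IsFamily N adj k D R
  isMatch : IsMatch N adj k M
  good : Good N adj D M
  walk : ∀ x ∈ D, ∀ g < N, M g = g → WalkOK (Heavy N adj D R) M (R x) g

theorem Stuck.exists_walk (hG : IsGraph N adj) {M : ℕ → ℕ} (hS : Stuck N adj k D R M) {x : ℕ}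
    (hx : x ∈ D) : ∃ g μ G U, g < N ∧ M g = g ∧ Walk (Heavy N adj D R) M (R x) g μ x G U ∧
      Heavy N adj D R μ :=
  have hxR := hS.family x hx
  exists_walk_to hG hS.isMatch hxR.2.1 (hS.walk x hx) hxR.1 hxR.2.2

/-- Let `a` be adjacent to `x ∈ D` and follow the walk from `M` that exposes `x`. If it passes `a`,
then the partner of `a` gets exposed and is in `D`. If not, then `a` still has its partner, which an
exchange along `x a` would expose. -/
theorem Stuck.bdry (hG : IsGraph N adj) {M : ℕ → ℕ} (hS : Stuck N adj k D R M) {a : ℕ}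
    (ha : Bdry adj D a) : M a ∈ D := by
  obtain ⟨haD, x, hx, hxa⟩ := ha
  obtain ⟨g, μ, G, U, hgN, hg, hw, hμ⟩ := hS.exists_walk hG hx
  have hxR := hS.family x hx
  have hw' := hw.mono fun _ h => h.1
  have hi := hw'.inv hG hS.isMatch hxR.2.1 hg hgN
  have hD := hw'.subset_good hG hS.isMatch hxR.2.1 hg hgN hμ.1
  by_cases h1 : a ∈ U
  · exact hD _ (hi.back a h1)
  by_cases h2 : a ∈ G
  · exact absurd (hD a (Finset.mem_insert_of_mem h2)) haD
  have h3 : a ≠ x := fun h => haD (h ▸ hx)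
  rw [← hi.outside a h2 h1 h3]
  exact ((hμ.1 x hi.lt hi.fix).2 a hxa).2

/-- `M` is the first matching of every walk. An element of `D` is needed to have a walk at all. -/
theorem Stuck.heavy (hG : IsGraph N adj) {M : ℕ → ℕ} (hS : Stuck N adj k D R M) {x : ℕ}
    (hx : x ∈ D) : Heavy N adj D R M := by
  obtain ⟨g, μ, G, U, -, -, hw, hμ⟩ := hS.exists_walk hG hx
  exact hw.head hμ

/-- As in Gallai's lemma, it suffices to reach a matching that exposes one of `p`, `p'` while the
other is still exceptional, since then `Movable.not_exc` applies. If neither is exposed, let `x ∈ D`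
be adjacent to the boundary vertex `M p`. Move to a matching that exposes `x` and exchange along
this edge: this exposes `p`. -/
theorem Stuck.not_reach (hG : IsGraph N adj) {M : ℕ → ℕ} (hS : Stuck N adj k D R M) {p p' : ℕ}
    (hpN : p < N) (hpN' : p' < N) (hp : Exc adj D M p) (hp' : Exc adj D M p') (hne : p ≠ p') :
    ¬ Reach adj D p p' := by
  intro hr
  have hr' := hr.symm hG
  have hpD : p ∈ D := by
    rcases Relation.ReflTransGen.cases_head hr with h | ⟨c, h, -⟩
    exacts [absurd h hne, h.2.1]
  have hpD' : p' ∈ D := by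
    rcases Relation.ReflTransGen.cases_head hr' with h | ⟨c, h, -⟩
    exacts [absurd h.symm hne, h.2.1]
  -- `M` itself exposes neither vertex; the trivial exchange `u = v` in `Heavy` gives `Movable` for
  -- `M`.
  have key : ∀ {q q' : ℕ}, q < N → Reach adj D q q' → q' ≠ q → q ∈ D → Exc adj D M q' →
      M q ≠ q := by
    intro q q' hqN hqq hne hqD hq' hq
    have h1 := (hS.heavy hG hqD).2 q hqN hq q (Or.inl rfl)
    rw [sw_self hq, hq] at h1
    exact h1.not_exc hG hS.family hS.isMatch hq hqN hqq hne hq'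
  have h1 := hp.resolve_left (key hpN hr hne.symm hpD hp')
  have h2 := hp'.resolve_left (key hpN' hr' hne hpD' hp)
  obtain ⟨haD, x, hx, hxa⟩ := h1
  obtain ⟨g, μ, G, U, hgN, hg, hw, hμ⟩ := hS.exists_walk hG hx
  have hxR := hS.family x hx
  -- the walk never exposes one of the two vertices
  have hit : ∀ {μ : ℕ → ℕ} {e : ℕ} {G U : Finset ℕ}, Walk (Heavy N adj D R) M (R x) g μ e G U →
      Heavy N adj D R μ → ∀ q q', q < N → Reach adj D q q' → q ≠ q' → Bdry adj D (M q') →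
      e = q → q' ∉ G → False := by
    intro μ e G U hw hμ q q' hqN hqq hqne hb he hG'
    subst he
    have hw' := hw.mono fun _ h => h.1
    have hi := hw'.inv hG hS.isMatch hxR.2.1 hg hgN
    have hD := hw'.subset_good hG hS.isMatch hxR.2.1 hg hgN hμ.1
    have h3 : q' ∉ U := fun h => hb.1 (hD _ (hi.back q' h))
    have h4 := hμ.2 _ hqN hi.fix _ (Or.inl rfl)
    rw [sw_self hi.fix, hi.fix] at h4
    refine h4.not_exc hG hS.family hi.isMatch hi.fix hqN hqq (Ne.symm hqne) (Or.inr ?_)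
    rwa [hi.outside q' hG' h3 (Ne.symm hqne)]
  -- By induction along the walk: at the first moment when one of the two is exposed, the other
  -- still has its boundary partner.
  have avoid : ∀ {μ : ℕ → ℕ} {e : ℕ} {G U : Finset ℕ}, Walk (Heavy N adj D R) M (R x) g μ e G U →
      Heavy N adj D R μ → p ∉ insert e G ∧ p' ∉ insert e G := by
    intro μ e G U hw
    induction hw with
    | start =>
      intro _
      simp only [Finset.mem_insert, Finset.notMem_empty, or_false]
      constructor
      · rintro rfl
        exact key hpN hr hne.symm hpD hp' hg
      · rintro rfl
        exact key hpN' hr' hne hpD' hp hg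
    | @step μ e G U hw h3 h4 h5 ih =>
      intro h6
      have h7 := ih h3
      have hs := Walk.step hw h3 h4 h5
      constructor
      · intro h
        rw [Finset.mem_insert] at h
        exact h.elim (fun h => hit hs h6 p p' hpN hr hne h2 h.symm h7.2) h7.1
      · intro h
        rw [Finset.mem_insert] at h
        exact h.elim (fun h => hit hs h6 p' p hpN' hr' hne.symm ⟨haD, x, hx, hxa⟩ h.symm h7.1) h7.2
  have hw' := hw.mono fun _ h => h.1
  have hi := hw'.inv hG hS.isMatch hxR.2.1 hg hgN
  have hD := hw'.subset_good hG hS.isMatch hxR.2.1 hg hgN hμ.1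
  have hav := avoid hw hμ
  have hb : ∀ q, Bdry adj D (M q) → q ∉ insert x G → q ∉ U ∧ M q ∉ U ∧ M q ∉ G ∧ M q ≠ x := by
    intro q hq hqx
    have h3 : M q ∉ insert x G := fun h => hq.1 (hD _ h)
    refine ⟨fun h => h3 (hi.back q h), fun h => ?_, fun h => h3 (Finset.mem_insert_of_mem h),
      fun h => h3 (h ▸ Finset.mem_insert_self _ _)⟩
    have := hi.back _ h
    rw [hS.isMatch.inv] at this
    exact hqx this
  obtain ⟨a1, a2, a3, a4⟩ := hb p ⟨haD, x, hx, hxa⟩ hav.1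
  obtain ⟨b1, b2, b3, b4⟩ := hb p' h2 hav.2
  simp only [Finset.mem_insert, not_or] at hav
  have hμa : μ (M p) = p := by rw [hi.outside _ a3 a2 a4, hS.isMatch.inv]
  have hpa : p ≠ M p := fun h => haD (h ▸ hpD)
  -- The walk has left the edge between `p` and `M p` in place, so matching `x` to `M p` exposes
  -- `p`, while `p'` keeps its partner.
  have h3 := hμ.2 x hi.lt hi.fix (M p) (Or.inr hxa)
  rw [hμa] at h3
  have h4 : sw μ x (M p) p = p := by simp [sw, hμa]
  have h5 : sw μ x (M p) p' = M p' := by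
    rw [← hi.outside p' hav.2.2 b1 hav.2.1]
    have : p' ≠ M p := fun h => haD (h ▸ hpD')
    simp [sw, hμa, hne.symm, this, hav.2.1]
  refine h3.not_exc hG hS.family (hi.isMatch.sw hG hi.fix hxa (by rwa [hμa])) h4 hpN hr hne.symm
    (Or.inr ?_)
  rwa [h5]

theorem even_card_of_fixedPointFree {K : Finset ℕ} (h : ∀ x ∈ K, m x ∈ K ∧ m x ≠ x)
    (hinv : ∀ x, m (m x) = x) : Even K.card := by
  have : ∑ _x ∈ K, (1 : ZMod 2) = 0 :=
    Finset.sum_involution (fun x _ => m x) (fun _ _ => by decide) (fun x hx _ => (h x hx).2)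
      (fun x hx => (h x hx).1) fun x _ => hinv x
  rw [Finset.sum_const, nsmul_eq_mul, mul_one] at this
  exact (ZMod.natCast_eq_zero_iff_even).1 this

/-- A matching to which `Stuck` applies is maximum. -/
theorem Stuck.le_card (hG : IsGraph N adj) {M : ℕ → ℕ} (hS : Stuck N adj k D R M) {k' : ℕ}
    (hm' : IsMatch N adj k' m') : k ≤ k' := by
  classical
  set E := (Finset.range N).filter (Exc adj D M) with hE
  set A := (Finset.range N).filter (Bdry adj D) with hA
  have hM := hS.isMatch
  have hBN : ∀ {a}, Bdry adj D a → a < N := fun ⟨_, d, _, h⟩ => hG.lt (hG.symm h)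
  have hED : ∀ e ∈ E, e < N ∧ Exc adj D M e ∧ e ∈ D := by
    intro e he
    simp only [hE, Finset.mem_filter, Finset.mem_range] at he
    refine ⟨he.1, he.2, ?_⟩
    rcases he.2 with h | h
    · exact (hS.good e he.1 h).1
    · have := hS.bdry hG h
      rwa [hM.inv] at this
  -- By `Stuck.bdry` the vertices of `A` are matched to distinct vertices of `D`, and these differ
  -- from the exposed ones.
  have hlow : k + A.card ≤ E.card := by
    have hdis : Disjoint (exposed N M) (A.image M) := by
      rw [Finset.disjoint_left]
      intro x hx hx'
      obtain ⟨a, ha, rfl⟩ := Finset.mem_image.1 hx'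
      simp only [mem_exposed, hM.inv] at hx
      simp only [hA, Finset.mem_filter] at ha
      have := hS.bdry hG ha.2
      rw [← hx.2] at this
      exact ha.2.1 this
    have hsub : exposed N M ∪ A.image M ⊆ E := by
      intro x hx
      rw [Finset.mem_union] at hx
      simp only [hE, Finset.mem_filter, Finset.mem_range]
      rcases hx with hx | hx
      · rw [mem_exposed] at hx
        exact ⟨hx.1, Or.inl hx.2⟩
      · obtain ⟨a, ha, rfl⟩ := Finset.mem_image.1 hx
        simp only [hA, Finset.mem_filter, Finset.mem_range] at ha
        exact ⟨hM.lt hG ha.1, Or.inr (by rw [hM.inv]; exact ha.2)⟩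
    calc k + A.card = (exposed N M ∪ A.image M).card := by
          rw [Finset.card_union_of_disjoint hdis, hM.card,
            Finset.card_image_of_injective _ fun _ _ => hM.inj]
      _ ≤ E.card := Finset.card_le_card hsub
  -- If some component `K` of an exceptional `e` had no such `t`, then `m'` would pair off `K`. But
  -- `M` pairs off `K` without `e`, because `e` is the only exceptional vertex in `K`; so `K` would
  -- be both even and odd.
  have hpick : ∀ e ∈ E, ∃ t, Reach adj D e t ∧ t < N ∧ (m' t = t ∨ Bdry adj D (m' t)) := by
    intro e he
    obtain ⟨heN, heE, heD⟩ := hED e he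
    by_contra hcon
    push Not at hcon
    set K := (Finset.range N).filter (Reach adj D e) with hK
    have hRD : ∀ {t}, Reach adj D e t → t ∈ D := by
      intro t ht
      rcases Relation.ReflTransGen.cases_tail ht with h | ⟨c, -, h⟩
      exacts [h ▸ heD, h.2.2]
    have heK : e ∈ K :=
      Finset.mem_filter.2 ⟨Finset.mem_range.2 heN, Relation.ReflTransGen.refl⟩
    have h1 : Even (K.erase e).card := by
      refine even_card_of_fixedPointFree (m := M) (fun t ht => ?_) hM.inv
      simp only [hK, Finset.mem_erase, Finset.mem_filter, Finset.mem_range] at ht ⊢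
      have hnot : ¬ Exc adj D M t := fun h =>
        hS.not_reach hG heN ht.2.1 heE h (Ne.symm ht.1) ht.2.2
      rw [Exc, not_or] at hnot
      have hMt : M t ∈ D := by
        by_contra h
        exact hnot.2 ⟨h, t, hRD ht.2.2, hM.adj hnot.1⟩
      refine ⟨⟨?_, hM.lt hG ht.2.1, ht.2.2.tail ⟨hM.adj hnot.1, hRD ht.2.2, hMt⟩⟩, hnot.1⟩
      intro h
      have h' : M e = t := by rw [← h, hM.inv]
      rcases heE with h3 | h3
      · exact ht.1 (h'.symm.trans h3)
      · rw [h'] at h3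
        exact h3.1 (hRD ht.2.2)
    have h2 : Even K.card := by
      refine even_card_of_fixedPointFree (m := m') (fun t ht => ?_) hm'.inv
      simp only [hK, Finset.mem_filter, Finset.mem_range] at ht ⊢
      obtain ⟨h3, h4⟩ := hcon t ht.2 ht.1
      have hmt : m' t ∈ D := by
        by_contra h
        exact h4 ⟨h, t, hRD ht.2, hm'.adj h3⟩
      exact ⟨⟨hm'.lt hG ht.1, ht.2.tail ⟨hm'.adj h3, hRD ht.2, hmt⟩⟩, h3⟩
    rw [← Finset.card_erase_add_one heK, Nat.even_add_one] at h2
    exact h2 h1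
  choose! f hf1 hf2 hf3 using hpick
  -- Different exceptional vertices choose `t` in different components, so the images under `m'` are
  -- distinct; each is exposed by `m'` or lies in `A`.
  have hup : E.card ≤ (exposed N m' ∪ A).card := by
    refine Finset.card_le_card_of_injOn (fun e => m' (f e)) (fun e he => ?_) ?_
    · rw [Finset.mem_coe] at he
      simp only [Finset.coe_union, Set.mem_union, Finset.mem_coe, mem_exposed, hA,
        Finset.mem_filter, Finset.mem_range]
      rcases hf3 e he with h | h
      · left
        rw [h]
        exact ⟨hf2 e he, h⟩
      · exact Or.inr ⟨hBN h, h⟩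
    · intro e he e' he' h
      rw [Finset.mem_coe] at he he'
      have h' : f e = f e' := hm'.inj h
      by_contra hne
      obtain ⟨a, b, -⟩ := hED e he
      obtain ⟨a', b', -⟩ := hED e' he'
      exact hS.not_reach hG a a' b b' hne
        ((hf1 e he).trans (h' ▸ (hf1 e' he').symm hG))
  have := Finset.card_union_le (exposed N m') A
  rw [hm'.card] at this
  omega

end CapDom

/-! ### The matching program and its verification. -/

namespace CapDom

/-! ### The matching program

Register `0` holds `0`, register `1` holds `1`, and register `2` tells whether a larger matching has
been found. Array `1` holds the adjacency matrix of the graph, row `0` of array `2` the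
characteristic function of the set `D`, array `3` the matchings that expose the elements of `D`, and
row `0` of array `4` the larger matching. Row `0` of array `11` holds `D` as it was initially. -/

/-- The array `f` represents the matching `m`. -/
def Rep (N : ℕ) (f m : ℕ → ℕ) : Prop := ∀ v < N, f v = m v

/-- Copy row `i` of array `A` to row `j` of array `B`. -/
def copyRow (A i B j : ℕ) : Cmd := .rep 3 (.seq (.load 4 A i 3) (.store B j 3 4))

/-- In row `0` of array `A`, match `v` to `u` and expose `w`. -/
def exchange (A i v u w : ℕ) : Cmd :=
  .seq (.store A i v u) (.seq (.store A i u v) (.store A i w w))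

/-- If `d` is not in `D`, insert it, with the matching in row `0` of array `A`. -/
def addRow (A d : ℕ) (p : Cmd) : Cmd :=
  .seq (.load 9 2 0 d) (.cond 9 .skip (.seq (.store 2 0 d 1) (.seq (copyRow A 0 3 d) p)))

/-- Record the matching in row `0` of array `A`, after `v` and `u` are matched. -/
def augment (A v u : ℕ) : Cmd :=
  .seq (copyRow A 0 4 0) (.seq (.store 4 0 v u) (.seq (.store 4 0 u v) (.set 2 1)))

/-- Record what can be learnt from an edge at a vertex that the matching in row `0` of array `A`
exposes. -/
def visitEdge (A : ℕ) : Cmd :=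
  .seq (.load 9 1 5 6) (.cond 9 (.seq (.load 7 A 0 6) (.seq (.eq 8 7 6)
    (.cond 8 (augment A 5 6) (addRow A 7 (exchange 3 7 5 6 7))))) .skip)

/-- Record what can be learnt from the matching in row `0` of array `A`. -/
def visit (A : ℕ) : Cmd :=
  .rep 5 (.seq (.load 7 A 0 5) (.seq (.eq 8 7 5)
    (.cond 8 (.seq (addRow A 5 .skip) (.rep 6 (visitEdge A))) .skip)))

theorem copyRow_arr (e : Env) {A i B j : ℕ} (hi : i ≠ 3 ∧ i ≠ 4) (hj : j ≠ 3 ∧ j ≠ 4) (hAB : A ≠ B)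
    (s : St) (hi' : s.reg i < e.N) (hj' : s.reg j < e.N) (A' i' j' : ℕ) :
    ((copyRow A i B j).run e s).arr A' i' j' =
      if A' = B ∧ i' = s.reg j ∧ j' < e.N then s.arr A (s.reg i) j' else s.arr A' i' j' := by
  have key := iter_induction (f := fun k s' => (Cmd.seq (.load 4 A i 3) (.store B j 3 4)).run e
    (s'.setReg 3 k)) (n := e.N) (s := s) (fun k s' => s'.reg i = s.reg i ∧ s'.reg j = s.reg j ∧
      ∀ A' i' j', s'.arr A' i' j' =
        if A' = B ∧ i' = s.reg j ∧ j' < k then s.arr A (s.reg i) j' else s.arr A' i' j')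
    ⟨rfl, rfl, by simp⟩ ?_
  · exact key.2.2 A' i' j'
  · rintro k s' hk ⟨h1, h2, h3⟩
    have h5 : (Cmd.seq (.load 4 A i 3) (.store B j 3 4)).run e (s'.setReg 3 k) =
        ((s'.setReg 3 k).setReg 4 (s'.arr A (s.reg i) k)).setArr B (s.reg j) k
          (s'.arr A (s.reg i) k) := by
      simp [Cmd.run, hi, hj, h1, h2, hi', hk, hj']
    rw [h5]
    refine ⟨by simp [hi, h1], by simp [hj, h2], fun A' i' j' => ?_⟩
    simp only [St.arr_setArr, St.arr_setReg, h3, hAB, false_and, if_false]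
    by_cases ha : A' = B ∧ i' = s.reg j
    · obtain ⟨rfl, rfl⟩ := ha
      by_cases h6 : j' = k
      · simp [h6]
      · have : j' < k + 1 ↔ j' < k := by omega
        simp [h6, this]
    · have h6 : ∀ p : Prop, ¬ (A' = B ∧ i' = s.reg j ∧ p) := fun p h => ha ⟨h.1, h.2.1⟩
      simp only [h6, if_false]

/-- The state of the search: what the memory holds. The set `D` and the matchings `R` are known from
the beginning. -/
structure PInv (e : Env) (adj : ℕ → ℕ → Prop) (k : ℕ) (D : Set ℕ) (R : ℕ → ℕ → ℕ) (s : St) :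
    Prop where
  zero : s.reg 0 = 0
  one : s.reg 1 = 1
  graph : ∀ i < e.N, ∀ j < e.N, s.arr 1 i j ≠ 0 ↔ adj i j
  row : ∀ d < e.N, s.arr 2 0 d ≠ 0 → ∃ m, IsMatch e.N adj k m ∧ m d = d ∧ Rep e.N (s.arr 3 d) m
  known : ∀ d ∈ D, s.arr 2 0 d ≠ 0 ∧ Rep e.N (s.arr 3 d) (R d)
  frozen : ∀ d < e.N, s.arr 11 0 d ≠ 0 ↔ d ∈ D
  best : s.reg 2 ≠ 0 → ∃ k' m, k' + 2 = k ∧ IsMatch e.N adj k' m ∧ Rep e.N (s.arr 4 0) m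

/-- A larger matching or a new element of `D` has been found. -/
def Progress (e : Env) (D : Set ℕ) (s : St) : Prop :=
  s.reg 2 ≠ 0 ∨ ∃ d < e.N, d ∉ D ∧ s.arr 2 0 d ≠ 0

variable {e : Env} {k : ℕ} {adj : ℕ → ℕ → Prop} {D : Set ℕ} {R : ℕ → ℕ → ℕ} {m : ℕ → ℕ}

/-- The invariant is preserved from `s` to `s'`, and progress is not lost. -/
def PStep (e : Env) (adj : ℕ → ℕ → Prop) (k : ℕ) (D : Set ℕ) (R : ℕ → ℕ → ℕ) (s s' : St) : Prop :=
  PInv e adj k D R s' ∧ (Progress e D s → Progress e D s')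

theorem PInv.frame {s s' : St} (h : PInv e adj k D R s) (h0 : s'.reg 0 = s.reg 0)
    (h1 : s'.reg 1 = s.reg 1) (h2 : s'.reg 2 = s.reg 2) (a1 : s'.arr 1 = s.arr 1)
    (a2 : s'.arr 2 = s.arr 2) (a3 : s'.arr 3 = s.arr 3) (a4 : s'.arr 4 = s.arr 4)
    (a11 : s'.arr 11 = s.arr 11) : PStep e adj k D R s s' := by
  refine ⟨⟨h0.trans h.zero, h1.trans h.one, ?_, ?_, ?_, ?_, ?_⟩, ?_⟩
  · rw [a1]; exact h.graph
  · rw [a2, a3]; exact h.row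
  · rw [a2, a3]; exact h.known
  · rw [a11]; exact h.frozen
  · rw [h2, a4]; exact h.best
  · rw [Progress, Progress, h2, a2]; exact id

/-- The row of a new vertex `d` may be overwritten: matchings known at the start of the phase belong
to elements of `D`, and `d` is not one of them. -/
theorem PInv.addD {s s' : St} (h : PInv e adj k D R s) {d : ℕ} (hd : d < e.N)
    (hd0 : s.arr 2 0 d = 0) (h0 : s'.reg 0 = s.reg 0) (h1 : s'.reg 1 = s.reg 1)
    (h2 : s'.reg 2 = s.reg 2) (a1 : s'.arr 1 = s.arr 1)
    (a2 : ∀ j, s'.arr 2 0 j = if j = d then 1 else s.arr 2 0 j)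
    (a3 : ∀ j, j ≠ d → s'.arr 3 j = s.arr 3 j) (a4 : s'.arr 4 = s.arr 4)
    (a11 : s'.arr 11 = s.arr 11) (hm : IsMatch e.N adj k m) (hmd : m d = d) (hr : Rep e.N (s'.arr 3 d) m) :
    PInv e adj k D R s' ∧ Progress e D s' := by
  have hdD : d ∉ D := fun hD => (h.known d hD).1 hd0
  refine ⟨⟨h0.trans h.zero, h1.trans h.one, ?_, ?_, ?_, ?_, ?_⟩, ?_⟩
  · rw [a1]; exact h.graph
  · intro d' hd' hne
    by_cases hdd : d' = d
    · subst hdd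
      exact ⟨m, hm, hmd, hr⟩
    · rw [a2, if_neg hdd] at hne
      rw [a3 d' hdd]
      exact h.row d' hd' hne
  · intro d' hd'
    have hdd : d' ≠ d := fun h => hdD (h ▸ hd')
    rw [a2, if_neg hdd, a3 d' hdd]
    exact h.known d' hd'
  · rw [a11]; exact h.frozen
  · rw [h2, a4]; exact h.best
  · exact Or.inr ⟨d, hd, hdD, by simp [a2]⟩

theorem PInv.flag {s s' : St} (h : PInv e adj k D R s) (h0 : s'.reg 0 = s.reg 0)
    (h1 : s'.reg 1 = s.reg 1) (h2 : s'.reg 2 ≠ 0) (a1 : s'.arr 1 = s.arr 1)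
    (a2 : s'.arr 2 = s.arr 2) (a3 : s'.arr 3 = s.arr 3)
    (a11 : s'.arr 11 = s.arr 11) (hr : ∃ k' m, k' + 2 = k ∧ IsMatch e.N adj k' m ∧ Rep e.N (s'.arr 4 0) m) :
    PInv e adj k D R s' ∧ Progress e D s' := by
  refine ⟨⟨h0.trans h.zero, h1.trans h.one, ?_, ?_, ?_, ?_, fun _ => hr⟩, Or.inl h2⟩
  · rw [a1]; exact h.graph
  · rw [a2, a3]; exact h.row
  · rw [a2, a3]; exact h.known
  · rw [a11]; exact h.frozen

theorem PInv.eq_of_not_progress {s : St} (h : PInv e adj k D R s) (hp : ¬ Progress e D s) {d : ℕ}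
    (hd : d < e.N) : s.arr 2 0 d ≠ 0 ↔ d ∈ D := by
  refine ⟨fun h1 => ?_, fun h1 => (h.known d h1).1⟩
  by_contra h2
  exact hp (Or.inr ⟨d, hd, h2, h1⟩)

theorem PStep.refl {s : St} (h : PInv e adj k D R s) : PStep e adj k D R s s := ⟨h, id⟩

theorem PStep.trans {s s' s'' : St} (h : PStep e adj k D R s s') (h' : PStep e adj k D R s' s'') :
    PStep e adj k D R s s'' := ⟨h'.1, h'.2 ∘ h.2⟩

/-- The last store wins, and this is also the order of the cases in `sw`; so no vertices need to be
distinct. -/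
theorem exchange_run {A i v u w : ℕ} {s : St} (hi : s.reg i < e.N) (hv : s.reg v < e.N)
    (hu : s.reg u < e.N) (hw : s.reg w < e.N) : (exchange A i v u w).run e s =
      ((s.setArr A (s.reg i) (s.reg v) (s.reg u)).setArr A (s.reg i) (s.reg u) (s.reg v)).setArr A
        (s.reg i) (s.reg w) (s.reg w) := by
  simp [exchange, Cmd.run, hi, hv, hu, hw]

/-- After an exchange, an array that represented `m` represents `sw m v u`. -/
theorem exchange_rep {A i v u w : ℕ} {s : St} (hi : s.reg i < e.N) (hv : s.reg v < e.N)
    (hu : s.reg u < e.N) (hw : s.reg w < e.N) (hr : Rep e.N (s.arr A (s.reg i)) m)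
    (hm : s.reg w = m (s.reg u)) :
    Rep e.N (((exchange A i v u w).run e s).arr A (s.reg i)) (sw m (s.reg v) (s.reg u)) := by
  rw [exchange_run hi hv hu hw]
  intro x hx
  simp only [St.arr_setArr, true_and, sw, hm, hr x hx]

/-- The continuation `p` adapts the copied row to the matching to be recorded: it is empty for an
exposed vertex, and an exchange for a vertex that an exchange would expose. A vertex that is already
marked either belonged to `D` from the beginning or is itself progress. -/
theorem addRow_spec {A d : ℕ} {p : Cmd} {s : St} (h : PInv e adj k D R s) (hA : A ≠ 2 ∧ A ≠ 3)
    (hd3 : d ∉ [0, 1, 2, 3, 4, 9]) (hd : s.reg d < e.N) (hp : p.wregs = [])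
    (hpa : ∀ A' ∈ p.warrs, A' = 3) (hpo : ∀ s i, i ≠ s.reg d → (p.run e s).arr 3 i = s.arr 3 i)
    (hm : IsMatch e.N adj k m) (hmd : m (s.reg d) = s.reg d)
    (hrep : ∀ s₁ : St, (∀ r, r ∉ [3, 4, 9] → s₁.reg r = s.reg r) →
      (∀ x < e.N, s₁.arr 3 (s.reg d) x = s.arr A 0 x) →
      Rep e.N ((p.run e s₁).arr 3 (s.reg d)) m) :
    PStep e adj k D R s ((addRow A d p).run e s) ∧
      (Progress e D ((addRow A d p).run e s) ∨ s.reg d ∈ D) := by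
  have hN : 0 < e.N := by omega
  simp only [List.mem_cons, not_or, List.not_mem_nil, not_false_eq_true, and_true] at hd3
  set s1 := s.setReg 9 (s.arr 2 0 (s.reg d)) with hs1
  have hrun : (addRow A d p).run e s = if s.arr 2 0 (s.reg d) ≠ 0 then s1 else
      p.run e ((copyRow A 0 3 d).run e (s1.setArr 2 0 (s.reg d) 1)) := by
    simp [addRow, Cmd.run, h.zero, hN, hd, hs1, hd3, h.one]
  have f1 : PStep e adj k D R s s1 := h.frame (by simp [hs1]) (by simp [hs1]) (by simp [hs1])
    rfl rfl rfl rfl rfl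
  rw [hrun]
  split_ifs with h1
  · refine ⟨f1, ?_⟩
    by_cases h2 : Progress e D s1
    · exact Or.inl h2
    · exact Or.inr ((f1.1.eq_of_not_progress h2 hd).1 h1)
  · rw [not_not] at h1
    set s2 := s1.setArr 2 0 (s.reg d) 1 with hs2
    set s3 := (copyRow A 0 3 d).run e s2 with hs3
    have hr2 : ∀ r, r ≠ 9 → s2.reg r = s.reg r := by
      intro r hr
      simp [hs2, hs1, hr]
    have hr3 : ∀ r, r ∉ [3, 4, 9] → s3.reg r = s.reg r := by
      intro r hr
      simp only [List.mem_cons, not_or, List.not_mem_nil, not_false_eq_true, and_true] at hr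
      rw [hs3, Cmd.run_reg e (by simp [copyRow, Cmd.wregs, hr]), hr2 r hr.2.2]
    have hr4 : ∀ r, (p.run e s3).reg r = s3.reg r := fun r =>
      Cmd.run_reg e (by simp [hp]) s3
    have ha3 := copyRow_arr e (A := A) (i := 0) (B := 3) (j := d) (by simp) (by simp [hd3]) hA.2 s2
      (by simp [hr2, h.zero, hN]) (by rw [hr2 d (by simp [hd3])]; exact hd)
    have ha4 : ∀ A', A' ≠ 3 → (p.run e s3).arr A' = s3.arr A' := fun A' hA' =>
      Cmd.run_arr e (fun h => hA' (hpa A' h)) s3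
    have ha5 : ∀ A', A' ≠ 3 → s3.arr A' = s2.arr A' := by
      intro A' hA'
      rw [hs3, Cmd.run_arr e (by simp [copyRow, Cmd.warrs, hA'])]
    have key := h.addD (s' := p.run e s3) (d := s.reg d) (m := m) hd h1
      (by rw [hr4, hr3 0 (by simp)]) (by rw [hr4, hr3 1 (by simp)])
      (by rw [hr4, hr3 2 (by simp)])
      (by
        rw [ha4 1 (by simp), ha5 1 (by simp)]
        funext i j
        simp [hs2, hs1])
      (by
        intro j
        rw [ha4 2 (by simp), ha5 2 (by simp)]
        simp [hs2, hs1])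
      (by
        intro j hj
        rw [hpo _ _ (by rwa [hr3 d (by simp [hd3])])]
        funext x
        rw [hs3, ha3, if_neg (by rw [hr2 d (by simp [hd3])]; tauto)]
        simp [hs2, hs1])
      (by
        rw [ha4 4 (by simp), ha5 4 (by simp)]
        funext i j
        simp [hs2, hs1])
      (by
        rw [ha4 11 (by simp), ha5 11 (by simp)]
        funext i j
        simp [hs2, hs1])
      hm hmd
      (by
        refine hrep s3 hr3 fun x hx => ?_
        rw [hs3, ha3, if_pos ⟨rfl, (hr2 d (by simp [hd3])).symm, hx⟩, hr2 0 (by simp), h.zero]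
        simp [hs2, hs1, hA])
    exact ⟨⟨key.1, fun _ => key.2⟩, Or.inl key.2⟩

end CapDom

/-! ### Visiting a matching: exposed vertices and single exchanges. -/

namespace CapDom

variable {e : Env} {k : ℕ} {adj : ℕ → ℕ → Prop} {D : Set ℕ} {R : ℕ → ℕ → ℕ} {m : ℕ → ℕ}

theorem PInv.setReg {s : St} (h : PInv e adj k D R s) {r x : ℕ} (hr : r ∉ [0, 1, 2]) :
    PStep e adj k D R s (s.setReg r x) := by
  simp only [List.mem_cons, not_or, List.not_mem_nil, not_false_eq_true, and_true] at hr
  refine h.frame ?_ ?_ ?_ rfl rfl rfl rfl rfl <;> simp [Ne.symm hr.1, Ne.symm hr.2.1, Ne.symm hr.2.2]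

/-- A loop of steps, each of which makes progress or establishes `Φ k`, makes progress or
establishes `Φ k` for all `k`; here `J` collects what the body of the loop leaves unchanged. -/
theorem for_spec {k' i : ℕ} {p : Cmd} {Φ : ℕ → Prop} (J : St → Prop) (hi : i ∉ [0, 1, 2])
    (hJi : ∀ s' k, J s' → J (s'.setReg i k))
    (hJ : ∀ k s', k < e.N → J s' → s'.reg i = k → PInv e adj k' D R s' →
      J (p.run e s') ∧ PStep e adj k' D R s' (p.run e s') ∧ (Progress e D (p.run e s') ∨ Φ k))
    {s : St} (hs : J s) (h : PInv e adj k' D R s) :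
    J ((Cmd.rep i p).run e s) ∧ PStep e adj k' D R s ((Cmd.rep i p).run e s) ∧
      (Progress e D ((Cmd.rep i p).run e s) ∨ ∀ k < e.N, Φ k) := by
  refine iter_induction (fun j s' => J s' ∧ PStep e adj k' D R s s' ∧
    (Progress e D s' ∨ ∀ k < j, Φ k)) ⟨hs, .refl h, Or.inr (by simp)⟩ ?_
  rintro j s' hj ⟨h1, h2, h3⟩
  have h4 := h2.1.setReg (r := i) (x := j) hi
  obtain ⟨h5, h6, h7⟩ := hJ j _ hj (hJi s' j h1) (by simp) h4.1
  refine ⟨h5, h2.trans (h4.trans h6), ?_⟩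
  rcases h3 with h3 | h3
  · exact Or.inl (h6.2 (h4.2 h3))
  · rcases h7 with h7 | h7
    · exact Or.inl h7
    · refine Or.inr fun k hk => ?_
      rcases Nat.lt_succ_iff_lt_or_eq.1 hk with hk | rfl
      exacts [h3 k hk, h7]

/-- For an edge from an exposed `v` to `u` there are two cases: if `u` is exposed as well, the
matching is enlarged; otherwise the exchange exposes the partner of `u`, which is recorded unless it
is known. -/
theorem visitEdge_spec (hG : IsGraph e.N adj) {A : ℕ} (hA : A ∉ [1, 2, 3, 4]) {s : St}
    (h : PInv e adj k D R s) (hv : s.reg 5 < e.N) (hu : s.reg 6 < e.N)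
    (hr : Rep e.N (s.arr A 0) m) (hm : IsMatch e.N adj k m) (hmv : m (s.reg 5) = s.reg 5) :
    PStep e adj k D R s ((visitEdge A).run e s) ∧ (Progress e D ((visitEdge A).run e s) ∨
      (adj (s.reg 5) (s.reg 6) → m (s.reg 6) ≠ s.reg 6 ∧ m (s.reg 6) ∈ D)) := by
  simp only [List.mem_cons, not_or, List.not_mem_nil, not_false_eq_true, and_true] at hA
  have hN : 0 < e.N := by omega
  set v := s.reg 5 with hv'
  set u := s.reg 6 with hu'
  have hadj := h.graph v hv u hu
  by_cases ha : adj v u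
  swap
  · have h0 : s.arr 1 v u = 0 := by
      by_contra h0
      exact ha (hadj.1 h0)
    have : (visitEdge A).run e s = s.setReg 9 0 := by
      simp [visitEdge, Cmd.run, ← hv', ← hu', hv, hu, h0]
    rw [this]
    exact ⟨h.setReg (by simp), Or.inr fun h => absurd h ha⟩
  set s1 := ((s.setReg 9 (s.arr 1 v u)).setReg 7 (m u)).setReg 8 (if m u = u then 1 else 0)
    with hs1
  have f1 : PStep e adj k D R s s1 := h.frame (by simp [hs1]) (by simp [hs1]) (by simp [hs1])
    rfl rfl rfl rfl rfl
  have hr1 : ∀ r, r ∉ [7, 8, 9] → s1.reg r = s.reg r := by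
    intro r hr
    simp only [List.mem_cons, not_or, List.not_mem_nil, not_false_eq_true, and_true] at hr
    simp [hs1, hr]
  have hrun : (visitEdge A).run e s = if m u = u then (augment A 5 6).run e s1 else
      (addRow A 7 (exchange 3 7 5 6 7)).run e s1 := by
    have h0 := hadj.2 ha
    by_cases hmu : m u = u <;>
      simp [visitEdge, Cmd.run, ← hv', ← hu', hv, hu, h0, h.zero, hN, hr u hu, hs1, hmu]
  rw [hrun]
  split_ifs with hmu
  · obtain ⟨k', hk', hM⟩ := hm.aug hG hmv ha hmu
    have hc := copyRow_arr e (A := A) (i := 0) (B := 4) (j := 0) (by simp) (by simp) hA.2.2.2 s1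
      (by simp [hr1, h.zero, hN]) (by simp [hr1, h.zero, hN])
    set s2 := (copyRow A 0 4 0).run e s1 with hs2
    have hr2 : ∀ r, r ∉ [3, 4, 7, 8, 9] → s2.reg r = s.reg r := by
      intro r hr
      simp only [List.mem_cons, not_or, List.not_mem_nil, not_false_eq_true, and_true] at hr
      rw [hs2, Cmd.run_reg e (by simp [copyRow, Cmd.wregs, hr]), hr1 r (by simp [hr])]
    have hrun2 : (augment A 5 6).run e s1 = ((s2.setArr 4 0 v u).setArr 4 0 u v).setReg 2 1 := by
      simp [augment, Cmd.run, ← hs2, hr2, h.zero, hN, ← hv', ← hu', hv, hu]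
    have ha2 : ∀ A', A' ≠ 4 → ((augment A 5 6).run e s1).arr A' = s.arr A' := fun A' hA' =>
      Cmd.run_arr e (by simp [augment, copyRow, Cmd.warrs, hA']) s1
    have hz : s1.reg 0 = 0 := by simp [hr1, h.zero]
    have key := h.flag (s' := (augment A 5 6).run e s1) (by simp [hrun2, hr2])
      (by simp [hrun2, hr2]) (by simp [hrun2]) (ha2 1 (by simp)) (ha2 2 (by simp))
      (ha2 3 (by simp)) (ha2 11 (by simp)) ⟨k', _, hk', hM, fun x hx => by
        simp only [hrun2, St.arr_setReg, St.arr_setArr, aug, hc, hz, true_and, hx, if_true]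
        simp [hs1, hr x hx]⟩
    exact ⟨⟨key.1, fun _ => key.2⟩, Or.inl key.2⟩
  · have h7 : s1.reg 7 = m u := by simp [hs1]
    have hmu7 : m u < e.N := hm.lt hG hu
    have key := addRow_spec (A := A) (d := 7) (p := exchange 3 7 5 6 7) (m := sw m v u) f1.1
      ⟨hA.2.1, hA.2.2.1⟩ (by simp) (by rw [h7]; exact hmu7) (by simp [exchange, Cmd.wregs])
      (by simp [exchange, Cmd.warrs]) ?_ (hm.sw hG hmv ha hmu) (by simp [h7, sw]) ?_
    · refine ⟨f1.trans key.1, key.2.imp_right fun h1 _ => ⟨hmu, ?_⟩⟩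
      rwa [h7] at h1
    · intro s' i hi
      funext j
      simp only [exchange, Cmd.run]
      split_ifs <;> simp [hi]
    · intro s2 h2 h3
      have e7 : s2.reg 7 = m u := by rw [h2 7 (by simp), h7]
      have e5 : s2.reg 5 = v := by rw [h2 5 (by simp), hr1 5 (by simp)]
      have e6 : s2.reg 6 = u := by rw [h2 6 (by simp), hr1 6 (by simp)]
      rw [h7, ← e7, ← e5, ← e6]
      refine exchange_rep ?_ ?_ ?_ ?_ ?_ ?_
      · rwa [e7]
      · rwa [e5]
      · rwa [e6]
      · rwa [e7]
      · intro x hx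
        rw [e7, ← h7, h3 x hx]
        simp [hs1, hr x hx]
      · rw [e7, e6]

theorem visit_spec (hG : IsGraph e.N adj) {A : ℕ} (hA : A ∉ [1, 2, 3, 4]) {s : St}
    (h : PInv e adj k D R s) (hr : Rep e.N (s.arr A 0) m) (hm : IsMatch e.N adj k m) :
    PStep e adj k D R s ((visit A).run e s) ∧
      (Progress e D ((visit A).run e s) ∨ Good e.N adj D m) := by
  refine (for_spec (fun s' => Rep e.N (s'.arr A 0) m) (by simp) (fun _ _ h => h) ?_ hr h).2
  intro v s hv hr h5 h
  have hN : 0 < e.N := by omega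
  have hA' := hA
  simp only [List.mem_cons, not_or, List.not_mem_nil, not_false_eq_true, and_true] at hA'
  refine ⟨?_, ?_⟩
  · rw [Cmd.run_arr e (by simp [visitEdge, augment, addRow, copyRow, exchange, Cmd.warrs, hA'])]
    exact hr
  set s1 := (s.setReg 7 (m v)).setReg 8 (if m v = v then 1 else 0) with hs1
  have f1 : PStep e adj k D R s s1 := h.frame (by simp [hs1]) (by simp [hs1]) (by simp [hs1])
    rfl rfl rfl rfl rfl
  have hrun : (Cmd.seq (.load 7 A 0 5) (.seq (.eq 8 7 5)
      (.cond 8 (.seq (addRow A 5 .skip) (.rep 6 (visitEdge A))) .skip))).run e s =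
      if m v = v then (Cmd.rep 6 (visitEdge A)).run e ((addRow A 5 .skip).run e s1) else s1 := by
    by_cases hmv : m v = v <;>
      simp [Cmd.run, h.zero, hN, h5, hv, hr v hv, hs1, hmv]
  rw [hrun]
  split_ifs with hmv
  swap
  · exact ⟨f1, Or.inr fun h => absurd h hmv⟩
  have e5 : s1.reg 5 = v := by simp [hs1, h5]
  have key := addRow_spec (A := A) (d := 5) (p := .skip) (m := m) f1.1
    ⟨hA'.2.1, hA'.2.2.1⟩ (by simp) (by rwa [e5]) rfl (by simp [Cmd.warrs]) (fun _ _ _ => rfl) hm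
    (by rwa [e5]) (fun s2 _ h3 x hx => by
      rw [Cmd.run, h3 x hx]
      exact hr x hx)
  set s2 := (addRow A 5 .skip).run e s1 with hs2
  have e5' : s2.reg 5 = v := by
    rw [hs2, Cmd.run_reg e (by simp [addRow, copyRow, Cmd.wregs]), e5]
  have hr2 : Rep e.N (s2.arr A 0) m := by
    rw [hs2, Cmd.run_arr e (by simp [addRow, copyRow, Cmd.warrs, hA'])]
    exact hr
  obtain ⟨-, h6, h7⟩ := for_spec (p := visitEdge A) (i := 6)
    (Φ := fun u => adj v u → m u ≠ u ∧ m u ∈ D)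
    (fun s' => s'.reg 5 = v ∧ Rep e.N (s'.arr A 0) m) (by simp)
    (fun s' k h => ⟨by simpa using h.1, h.2⟩) (fun u s' hu hJ h6 hI => by
      obtain ⟨hJ1, hJ2⟩ := hJ
      have := visitEdge_spec hG hA hI (by rwa [hJ1]) (by rwa [h6]) hJ2 hm (by rwa [hJ1])
      rw [hJ1, h6] at this
      refine ⟨⟨?_, ?_⟩, this⟩
      · rw [Cmd.run_reg e (by
          simp [visitEdge, augment, addRow, copyRow, exchange, Cmd.wregs]), hJ1]
      · rw [Cmd.run_arr e (by
          simp [visitEdge, augment, addRow, copyRow, exchange, Cmd.warrs, hA'])]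
        exact hJ2) ⟨e5', hr2⟩ key.1.1
  refine ⟨f1.trans (key.1.trans h6), ?_⟩
  rcases h7 with h7 | h7
  · exact Or.inl h7
  rcases key.2 with h8 | h8
  · exact Or.inl (h6.2 h8)
  · rw [e5] at h8
    exact Or.inr fun _ => ⟨h8, fun u hu => h7 u (hG.lt (hG.symm hu)) hu⟩

end CapDom

namespace CapDom

variable {e : Env} {k : ℕ} {adj : ℕ → ℕ → Prop} {D : Set ℕ} {R : ℕ → ℕ → ℕ} {m μ : ℕ → ℕ}

/-- Registers `0` to `2` and arrays `1` to `4` and `11` are all that the invariant speaks of;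
everything else is working space. -/
theorem PInv.cmd {s : St} (h : PInv e adj k D R s) {p : Cmd} (hr : ∀ r ∈ p.wregs, 3 ≤ r)
    (ha : ∀ A ∈ p.warrs, 5 ≤ A ∧ A ≠ 11) : PStep e adj k D R s (p.run e s) := by
  have h1 : ∀ r < 3, (p.run e s).reg r = s.reg r := fun r h =>
    Cmd.run_reg e (fun h' => absurd (hr r h') (by omega)) s
  have h2 : ∀ A, A < 5 ∨ A = 11 → (p.run e s).arr A = s.arr A := fun A h =>
    Cmd.run_arr e (fun h' => absurd (ha A h') (by omega)) s
  exact h.frame (h1 0 (by simp)) (h1 1 (by simp)) (h1 2 (by simp)) (h2 1 (by simp))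
    (h2 2 (by simp)) (h2 3 (by simp)) (h2 4 (by simp)) (h2 11 (by simp))

/-! ### Following a walk -/

/-- Match the vertex in register `ρ` as in row `ρ + 1` of array `3`, and move on to the vertex that
becomes exposed; if this is impossible, set register `ρ + 2`. -/
def walkStep (ρ A : ℕ) : Cmd :=
  .seq (.load (ρ + 4) 3 (ρ + 1) ρ) (.seq (.eq (ρ + 6) (ρ + 4) ρ) (.cond (ρ + 6) (.set (ρ + 2) 1)
    (.seq (.load (ρ + 5) A 0 (ρ + 4)) (.seq (.eq (ρ + 6) (ρ + 5) (ρ + 4))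
      (.cond (ρ + 6) (.set (ρ + 2) 1)
        (.seq (exchange A 0 ρ (ρ + 4) (ρ + 5)) (.mov ρ (ρ + 5))))))))

/-- Follow the walk from the vertex in register `ρ` in the union of the matching in row `0` of array
`A` and that in row `ρ + 1` of array `3`, and execute `V` for all matchings on the way. -/
def walk (ρ A : ℕ) (V : Cmd) : Cmd :=
  .seq (.set (ρ + 2) 0) (.rep (ρ + 3) (.seq V (.cond (ρ + 2) .skip (walkStep ρ A))))

theorem walkStep_run {ρ A : ℕ} {s : St} (h0 : s.reg 0 = 0)
    (hG : IsGraph e.N adj) {m' : ℕ → ℕ} {k' : ℕ} (hm : IsMatch e.N adj k μ)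
    (hm' : IsMatch e.N adj k' m') (hg : s.reg ρ < e.N) (hx : s.reg (ρ + 1) < e.N)
    (hr : Rep e.N (s.arr A 0) μ) (hr' : Rep e.N (s.arr 3 (s.reg (ρ + 1))) m') :
    (m' (s.reg ρ) = s.reg ρ ∨ μ (m' (s.reg ρ)) = m' (s.reg ρ) →
      ((walkStep ρ A).run e s).arr = s.arr ∧ ((walkStep ρ A).run e s).reg ρ = s.reg ρ ∧
      ((walkStep ρ A).run e s).reg (ρ + 2) = 1) ∧
    (m' (s.reg ρ) ≠ s.reg ρ → μ (m' (s.reg ρ)) ≠ m' (s.reg ρ) →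
      Rep e.N (((walkStep ρ A).run e s).arr A 0) (sw μ (s.reg ρ) (m' (s.reg ρ))) ∧
      ((walkStep ρ A).run e s).reg ρ = μ (m' (s.reg ρ)) ∧
      ((walkStep ρ A).run e s).reg (ρ + 2) = s.reg (ρ + 2)) := by
  have hN : 0 < e.N := by omega
  set g := s.reg ρ with hg'
  have hu := hm'.lt hG hg
  have hw := hm.lt hG hu
  have e1 : s.arr 3 (s.reg (ρ + 1)) g = m' g := hr' g hg
  have e2 : s.arr A 0 (m' g) = μ (m' g) := hr _ hu
  refine ⟨fun h => ?_, fun h1 h2 => ?_⟩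
  · by_cases h1 : m' g = g
    · simp [walkStep, Cmd.run, ← hg', hg, hx, e1, h1]
    · have h2 : μ (m' g) = m' g := h.resolve_left h1
      simp [walkStep, Cmd.run, ← hg', hg, hx, e1, h1, hu, hN, h0, e2, h2]
  · simp [walkStep, exchange, Cmd.run, ← hg', hg, hx, e1, h1, hu, hw, hN, h0, e2, h2]
    intro v hv
    simp only [St.arr_setArr, St.arr_setReg, true_and, sw, hr v hv]

theorem walk_wregs (ρ A : ℕ) (V : Cmd) :
    (walk ρ A V).wregs = (ρ + 2) :: (ρ + 3) :: (V.wregs ++ [ρ + 4, ρ + 6, ρ + 2, ρ + 5, ρ + 6,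
      ρ + 2, ρ]) := by
  simp [walk, walkStep, exchange, Cmd.wregs]

theorem walk_warrs (ρ A : ℕ) (V : Cmd) : (walk ρ A V).warrs = V.warrs ++ [A, A, A] := by
  simp [walk, walkStep, exchange, Cmd.warrs]

/-- The result of following a walk. -/
theorem walk_spec (hG : IsGraph e.N adj) (hR : IsFamily e.N adj k D R) {ρ A : ℕ} {V : Cmd}
    {Φ : (ℕ → ℕ) → Prop} (hΦ : ∀ μ, Φ μ → Good e.N adj D μ) (hρ : 3 ≤ ρ) (hA : 5 ≤ A ∧ A ≠ 11)
    (hVr : ∀ r ∈ V.wregs, r < ρ) (hVA : A ∉ V.warrs)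
    (hV : ∀ s μ, PInv e adj k D R s → Rep e.N (s.arr A 0) μ → IsMatch e.N adj k μ →
      PStep e adj k D R s (V.run e s) ∧ (Progress e D (V.run e s) ∨ Φ μ))
    {s : St} (h : PInv e adj k D R s) {x g₀ : ℕ} (hx : x ∈ D) (hsx : s.reg (ρ + 1) = x)
    (hsg : s.reg ρ = g₀) (hg : g₀ < e.N) (hm : IsMatch e.N adj k m) (hmg : m g₀ = g₀)
    (hr : Rep e.N (s.arr A 0) m) :
    PStep e adj k D R s ((walk ρ A V).run e s) ∧ ∃ μ g, g < e.N ∧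
      Rep e.N (((walk ρ A V).run e s).arr A 0) μ ∧ IsMatch e.N adj k μ ∧ μ g = g ∧
      ((walk ρ A V).run e s).reg ρ = g ∧
      (Progress e D ((walk ρ A V).run e s) ∨
        ∃ G U, Walk Φ m (R x) g₀ μ g G U ∧ Φ μ ∧ R x g = g) := by
  obtain ⟨hxN, hRx, hRxx⟩ := hR x hx
  have hVr' : ∀ r, ρ ≤ r → r ∉ V.wregs := fun r h h' => absurd (hVr r h') (by omega)
  have hS : ∀ r ∈ (walkStep ρ A).wregs, 3 ≤ r := by
    simp [walkStep, exchange, Cmd.wregs]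
    omega
  have hS' : ∀ B ∈ (walkStep ρ A).warrs, 5 ≤ B ∧ B ≠ 11 := by
    simp [walkStep, exchange, Cmd.warrs, hA]
  -- Apart from progress, every round before the stop register is set adds one vertex to `G`. The
  -- matching in the array is a correct one in any case.
  have key := iter_induction (f := fun j s' =>
      (Cmd.seq V (.cond (ρ + 2) .skip (walkStep ρ A))).run e (s'.setReg (ρ + 3) j)) (n := e.N)
    (s := s.setReg (ρ + 2) 0) (fun j s' => PStep e adj k D R s s' ∧ s'.reg (ρ + 1) = x ∧
      ∃ μ g, g < e.N ∧ Rep e.N (s'.arr A 0) μ ∧ IsMatch e.N adj k μ ∧ μ g = g ∧ s'.reg ρ = g ∧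
      (Progress e D s' ∨ ∃ G U, Walk Φ m (R x) g₀ μ g G U ∧
        (s'.reg (ρ + 2) ≠ 0 ∧ Φ μ ∧ R x g = g ∨ s'.reg (ρ + 2) = 0 ∧ j ≤ G.card)))
    ⟨h.setReg (by simp; omega), by simp [hsx], m, g₀, hg, hr, hm, hmg, by simp [hsg],
      Or.inr ⟨∅, ∅, .start, Or.inr (by simp)⟩⟩ ?_
  · obtain ⟨h1, h2, μ, g, h3, h4, h5, h6, h7, h8⟩ := key
    refine ⟨h1, μ, g, h3, h4, h5, h6, h7, ?_⟩
    rcases h8 with h8 | ⟨G, U, hw, ⟨-, h8⟩ | ⟨-, h8⟩⟩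
    · exact Or.inl h8
    · exact Or.inr ⟨G, U, hw, h8⟩
    -- The walk has stopped by now: otherwise `G` and the exposed vertex would make up more than `N`
    -- vertices below `N`.
    · have hi := hw.inv hG hm hRx hmg hg
      have : insert g G ⊆ Finset.range e.N := by
        intro y hy
        rw [Finset.mem_insert] at hy
        rw [Finset.mem_range]
        rcases hy with rfl | hy
        exacts [h3, hi.sub y (by simp [hy])]
      have := Finset.card_le_card this
      rw [Finset.card_insert_of_notMem hi.notG, Finset.card_range] at this
      omega
  rintro j s1 hj ⟨h1, h2, μ, g, h3, h4, h5, h6, h7, h8⟩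
  have f1 := h1.1.setReg (r := ρ + 3) (x := j) (by simp)
  set s2 := s1.setReg (ρ + 3) j with hs2
  have hr2 : Rep e.N (s2.arr A 0) μ := h4
  obtain ⟨f2, hΦ2⟩ := hV s2 μ f1.1 hr2 h5
  set s3 := V.run e s2 with hs3
  have hr3 : Rep e.N (s3.arr A 0) μ := by
    rw [hs3, Cmd.run_arr e hVA]
    exact hr2
  have e0 : s3.reg ρ = g := by
    rw [hs3, Cmd.run_reg e (hVr' _ le_rfl), hs2]
    simp [h7]
  have e1 : s3.reg (ρ + 1) = x := by
    rw [hs3, Cmd.run_reg e (hVr' _ (by omega)), hs2]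
    simp [h2]
  have e2 : s3.reg (ρ + 2) = s1.reg (ρ + 2) := by
    rw [hs3, Cmd.run_reg e (hVr' _ (by omega)), hs2]
    simp
  have f3 := f1.trans f2
  simp only [Cmd.run]
  rw [← hs3]
  by_cases hquit : s3.reg (ρ + 2) = 0
  swap
  · rw [if_pos hquit]
    refine ⟨h1.trans f3, e1, μ, g, h3, hr3, h5, h6, e0, ?_⟩
    rcases h8 with h8 | ⟨G, U, hw, h8 | h8⟩
    · exact Or.inl (f3.2 h8)
    · exact Or.inr ⟨G, U, hw, Or.inl (by rwa [e2])⟩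
    · exact absurd (e2.trans h8.1) hquit
  rw [if_neg (not_not.2 hquit)]
  have hrx := (f3.1.known x hx).2
  obtain ⟨w1, w2⟩ := walkStep_run (ρ := ρ) (A := A) f3.1.zero hG h5 hRx
    (by rwa [e0]) (by rwa [e1]) hr3 (by rwa [e1])
  have f4 := f3.1.cmd hS hS'
  have e1' : ((walkStep ρ A).run e s3).reg (ρ + 1) = x := by
    rw [Cmd.run_reg e (by simp [walkStep, exchange, Cmd.wregs]), e1]
  have f5 := h1.trans (f3.trans f4)
  set s4 := (walkStep ρ A).run e s3 with hs4
  rw [e0] at w1 w2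
  by_cases hc : R x g = g ∨ μ (R x g) = R x g
  · obtain ⟨a1, a2, a3⟩ := w1 hc
    refine ⟨f5, e1', μ, g, h3, by rwa [a1], h5, h6, a2, ?_⟩
    rcases h8 with h8 | ⟨G, U, hw, h8⟩
    · exact Or.inl (f4.2 (f3.2 h8))
    rcases hΦ2 with h9 | h9
    · exact Or.inl (f4.2 h9)
    -- A stop at an obstruction would mean that `μ` exposes a neighbour of its exposed vertex `g`,
    -- which `Good` rules out; hence `R x` exposes `g`.
    · refine Or.inr ⟨G, U, hw, Or.inl ⟨by simp [a3], h9, by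
        by_contra h11
        exact ((hΦ μ h9 g h3 h6).2 (R x g) (hRx.adj h11)).1 (hc.resolve_left h11)⟩⟩
  · rw [not_or] at hc
    obtain ⟨a1, a2, a3⟩ := w2 hc.1 hc.2
    refine ⟨f5, e1', sw μ g (R x g), μ (R x g), h5.lt hG (hRx.lt hG h3), a1,
      h5.sw hG h6 (hRx.adj hc.1) hc.2, by simp [sw], a2, ?_⟩
    rcases h8 with h8 | ⟨G, U, hw, h8⟩
    · exact Or.inl (f4.2 (f3.2 h8))
    rcases hΦ2 with h9 | h9
    · exact Or.inl (f4.2 h9)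
    · have hi := hw.inv hG hm hRx hmg hg
      refine Or.inr ⟨_, _, .step hw h9 hc.1 hc.2, Or.inr ⟨by rw [a3, hquit], ?_⟩⟩
      rw [Finset.card_insert_of_notMem hi.notG]
      rcases h8 with h8 | h8
      · exact absurd (by rw [← e2, hquit]) h8.1
      · omega

end CapDom

namespace CapDom

variable {e : Env} {k : ℕ} {adj : ℕ → ℕ → Prop} {D : Set ℕ} {R : ℕ → ℕ → ℕ} {m μ : ℕ → ℕ}

/-! ### Loops over edges -/

/-- Execute `p` if cell `(i, j)` of array `A` is nonzero. -/
def when (r A i j : ℕ) (p : Cmd) : Cmd := .seq (.load r A i j) (.cond r p .skip)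

/-- Execute `p` for all vertices `g` exposed by the matching in row `i` of array `A` and all `u` that
are equal or adjacent to `g`. -/
def eachEdge (A i g u c : ℕ) (p : Cmd) : Cmd :=
  .rep g (.rep u (.seq (.load c A i g) (.seq (.eq c c g) (.cond c (.seq (.eq c u g)
    (.cond c p (when c 1 g u p))) .skip))))

/-- Copy the matching in row `i` of array `A` to row `0` of array `B`, match `g` to `u` in it, and
put the vertex that becomes exposed into register `w`. -/
def branch (A i B g u w c : ℕ) : Cmd :=
  .seq (copyRow A i B 0) (.seq (.load w B 0 u) (.seq (.eq c w u)
    (.cond c .skip (exchange B 0 g u w))))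

theorem eachEdge_wregs (A i g u c : ℕ) (p : Cmd) : (eachEdge A i g u c p).wregs =
    [g, u, c, c, c] ++ (p.wregs ++ c :: p.wregs) := by
  simp [eachEdge, when, Cmd.wregs]

theorem eachEdge_warrs (A i g u c : ℕ) (p : Cmd) :
    (eachEdge A i g u c p).warrs = p.warrs ++ p.warrs := by
  simp [eachEdge, when, Cmd.warrs]

/-- The pairs with `u = g` stand for no exchange at all. The invariant `J` is what the body may rely
on besides `PInv`; it must tolerate changes of the two loop variables and the test register. -/
theorem eachEdge_spec {A i g u c : ℕ} {p : Cmd} {Φ : ℕ → ℕ → Prop} (J : St → Prop)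
    (hi : i ∉ [g, u, c]) (hg : 3 ≤ g) (hu : 3 ≤ u) (hc : 3 ≤ c) (hd : g ≠ u ∧ g ≠ c ∧ u ≠ c)
    (hgp : g ∉ p.wregs)
    (hJr : ∀ s' r x, r ∈ [g, u, c] → J s' → J (s'.setReg r x))
    (hJ : ∀ s', J s' → s'.reg i < e.N ∧ Rep e.N (s'.arr A (s'.reg i)) μ)
    (hp : ∀ s', J s' → PInv e adj k D R s' → s'.reg g < e.N → s'.reg u < e.N →
      μ (s'.reg g) = s'.reg g → (s'.reg u = s'.reg g ∨ adj (s'.reg g) (s'.reg u)) →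
      J (p.run e s') ∧ PStep e adj k D R s' (p.run e s') ∧
        (Progress e D (p.run e s') ∨ Φ (s'.reg g) (s'.reg u)))
    {s : St} (hs : J s) (h : PInv e adj k D R s) :
    J ((eachEdge A i g u c p).run e s) ∧ PStep e adj k D R s ((eachEdge A i g u c p).run e s) ∧
      (Progress e D ((eachEdge A i g u c p).run e s) ∨ ∀ x < e.N, ∀ y < e.N, μ x = x →
        (y = x ∨ adj x y) → Φ x y) := by
  classical
  simp only [List.mem_cons, not_or, List.not_mem_nil, not_false_eq_true, and_true] at hi
  refine for_spec J (by simp; omega) (fun s' x h => hJr s' g x (by simp) h) ?_ hs h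
  intro x s1 hx hJ1 hg1 h1
  have key := for_spec (i := u) (p := Cmd.seq (.load c A i g) (.seq (.eq c c g)
    (.cond c (.seq (.eq c u g) (.cond c p (when c 1 g u p))) .skip))) (Φ := fun y => μ x = x → (y = x ∨ adj x y) → Φ x y)
    (fun s' => J s' ∧ s'.reg g = x) (by simp; omega)
    (fun s' y h => ⟨hJr s' u y (by simp) h.1, by simp [hd.1, h.2]⟩) ?_ ⟨hJ1, hg1⟩ h1
  · exact ⟨key.1.1, key.2⟩
  rintro y s2 hy ⟨hJ2, hg2⟩ hu2 h2
  obtain ⟨hi2, hr2⟩ := hJ s2 hJ2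
  have hax := h2.graph x hx y hy
  have hset : ∀ v, PStep e adj k D R s2 (s2.setReg c v) := fun v => h2.setReg (by simp; omega)
  have hst : ∀ v w, (s2.setReg c v).setReg c w = s2.setReg c w := by
    intro v w
    simp only [St.setReg, St.mk.injEq, and_true]
    funext r
    split_ifs <;> rfl
  have hcg := hd.2.1
  have hcu := hd.2.2
  have hcI := hi.2.2
  have hrun : ∃ v, (Cmd.seq (.load c A i g) (.seq (.eq c c g) (.cond c (.seq (.eq c u g)
      (.cond c p (when c 1 g u p))) .skip))).run e s2 =
      if μ x = x ∧ (y = x ∨ adj x y) then p.run e (s2.setReg c v) else s2.setReg c v := by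
    by_cases hμ : μ x = x
    swap
    · exact ⟨0, by simp [Cmd.run, hi2, hg2, hx, hr2 x hx, hμ, hcg, hst]⟩
    by_cases hxy : y = x
    · exact ⟨1, by simp [Cmd.run, hi2, hg2, hx, hr2 x hx, hμ, hcg, hst, hu2, hxy, hcu]⟩
    · refine ⟨s2.arr 1 x y, ?_⟩
      by_cases ha : adj x y
      · have h0 := hax.2 ha
        simp [Cmd.run, when, hi2, hg2, hx, hr2 x hx, hμ, hcg, hst, hu2, hxy, hcu, ha, hy, h0]
      · have h0 := hax.not.2 ha
        rw [not_not] at h0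
        simp [Cmd.run, when, hi2, hg2, hx, hr2 x hx, hμ, hcg, hst, hu2, hxy, hcu, ha, hy, h0]
  obtain ⟨v, hrun⟩ := hrun
  rw [hrun]
  have hJ3 := hJr s2 c v (by simp) hJ2
  have e1 : (s2.setReg c v).reg g = x := by simp [hcg, hg2]
  have e2 : (s2.setReg c v).reg u = y := by simp [hcu, hu2]
  split_ifs with hcond
  · have h3 := hp _ hJ3 (hset v).1 (by rwa [e1]) (by rwa [e2]) (by rw [e1]; exact hcond.1)
      (by rw [e1, e2]; exact hcond.2)
    rw [e1, e2] at h3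
    refine ⟨⟨h3.1, by rw [Cmd.run_reg e hgp, e1]⟩, (hset v).trans h3.2.1, ?_⟩
    exact h3.2.2.imp_right fun h _ _ => h
  · exact ⟨⟨hJ3, e1⟩, hset v, Or.inr fun a b => absurd ⟨a, b⟩ hcond⟩

/-- The row produced is always a matching that exposes the partner of `u`, even when `u` is exposed
itself and no exchange is made. It is `sw` only if the latter does not happen for an edge, and
`Good` guarantees this. -/
theorem branch_spec (hG : IsGraph e.N adj) {A i B g u w c : ℕ} (hi : i ≠ 3 ∧ i ≠ 4)
    (hAB : A ≠ B) (hd : [0, g, u, w, c, 3, 4].Nodup) {s : St} (h0 : s.reg 0 = 0)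
    (hiN : s.reg i < e.N) (hg : s.reg g < e.N) (hu : s.reg u < e.N)
    (hr : Rep e.N (s.arr A (s.reg i)) μ) (hm : IsMatch e.N adj k μ)
    (hμ : μ (s.reg g) = s.reg g) (ha : s.reg u = s.reg g ∨ adj (s.reg g) (s.reg u)) :
    ((branch A i B g u w c).run e s).reg w = μ (s.reg u) ∧ ∃ μ',
      Rep e.N (((branch A i B g u w c).run e s).arr B 0) μ' ∧ IsMatch e.N adj k μ' ∧
      μ' (μ (s.reg u)) = μ (s.reg u) ∧
      (Good e.N adj D μ → μ' = sw μ (s.reg g) (s.reg u)) := by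
  have hN : 0 < e.N := by omega
  simp only [List.nodup_cons, List.mem_cons, not_or, List.not_mem_nil, not_false_eq_true,
    and_true] at hd
  obtain ⟨⟨d1, d2, d3, d4, d5, d6⟩, ⟨d7, d8, d9, d10, d11⟩, ⟨d12, d13, d14, d15⟩,
    ⟨d16, d17, d18⟩, ⟨d19, d20⟩, -⟩ := hd
  have hcp := copyRow_arr e (A := A) (i := i) (B := B) (j := 0) hi (by simp) hAB s hiN
    (by rwa [h0])
  set s1 := (copyRow A i B 0).run e s with hs1
  have hr1 : ∀ r, r ≠ 3 → r ≠ 4 → s1.reg r = s.reg r := by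
    intro r h3 h4
    rw [hs1, Cmd.run_reg e (by simp [copyRow, Cmd.wregs, h3, h4])]
  have hw := hm.lt hG hu
  have hrep : Rep e.N (s1.arr B 0) μ := by
    intro x hx
    rw [hcp, if_pos ⟨rfl, h0.symm, hx⟩, hr x hx]
  by_cases hc : μ (s.reg u) = s.reg u
  · have hrun : (branch A i B g u w c).run e s = (s1.setReg w (μ (s.reg u))).setReg c 1 := by
      simp [branch, Cmd.run, ← hs1, hr1 0, hr1 u, d14, d15, h0, hN, hu, hrep _ hu, hc]
    rw [hrun]
    refine ⟨by simp [d16], μ, hrep, hm, by rw [hc, hc], fun hgood => ?_⟩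
    rcases ha with ha | ha
    · rw [ha, sw_self hμ]
    · exact absurd hc ((hgood _ hg hμ).2 _ ha).1
  · have hne : s.reg u ≠ s.reg g := fun h => hc (by rw [h, hμ])
    have ha' := ha.resolve_left hne
    have hrun : (branch A i B g u w c).run e s = (exchange B 0 g u w).run e
        ((s1.setReg w (μ (s.reg u))).setReg c 0) := by
      simp [branch, Cmd.run, ← hs1, hr1 0, hr1 u, d14, d15, h0, hN, hu, hrep _ hu, hc, d12]
    rw [hrun]
    set s2 := (s1.setReg w (μ (s.reg u))).setReg c 0 with hs2
    have ew : s2.reg w = μ (s.reg u) := by simp [hs2, d16]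
    have eg : s2.reg g = s.reg g := by simp [hs2, d8, d9, hr1 g d10 d11]
    have eu : s2.reg u = s.reg u := by simp [hs2, d12, d13, hr1 u d14 d15]
    have e0 : s2.reg 0 = 0 := by simp [hs2, d3, d4, hr1 0, h0]
    have key := exchange_rep (A := B) (i := 0) (v := g) (u := u) (w := w) (s := s2) (m := μ)
      (by rwa [e0]) (by rwa [eg]) (by rwa [eu]) (by rwa [ew]) (by rwa [e0]) (by rw [ew, eu])
    rw [e0, eg, eu] at key
    refine ⟨?_, _, key, hm.sw hG hμ ha' hc, by simp [sw], fun _ => rfl⟩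
    rw [Cmd.run_reg e (by simp [exchange, Cmd.wregs]), ew]

theorem branch_wregs (A i B g u w c : ℕ) : (branch A i B g u w c).wregs = [3, 4, w, c] := by
  simp [branch, copyRow, exchange, Cmd.wregs]

theorem branch_warrs (A i B g u w c : ℕ) : (branch A i B g u w c).warrs = [B, B, B, B] := by
  simp [branch, copyRow, exchange, Cmd.warrs]

end CapDom

namespace CapDom

variable {e : Env} {k : ℕ} {adj : ℕ → ℕ → Prop} {D : Set ℕ} {R : ℕ → ℕ → ℕ} {m μ : ℕ → ℕ} {p : ℕ}

/-- The end of a walk is determined by its beginning. -/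
theorem Walk.end_unique {Φ Ψ : (ℕ → ℕ) → Prop} {m' ν ν' : ℕ → ℕ} {g₀ g g' : ℕ}
    {G G' U U' : Finset ℕ} (h : Walk Φ m m' g₀ ν g G U) (h' : Walk Ψ m m' g₀ ν' g' G' U')
    (hg : m' g = g) (hg' : m' g' = g') : g = g' := by
  classical
  -- A walk iterates a deterministic step `F` that rests at its ends. Applying it as often as both
  -- walks together do leads to either end.
  set F : (ℕ → ℕ) × ℕ → (ℕ → ℕ) × ℕ := fun x =>
    if m' x.2 = x.2 ∨ x.1 (m' x.2) = m' x.2 then x else (sw x.1 x.2 (m' x.2), x.1 (m' x.2)) with hF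
  have key : ∀ {Φ : (ℕ → ℕ) → Prop} {ν : ℕ → ℕ} {g : ℕ} {G U : Finset ℕ},
      Walk Φ m m' g₀ ν g G U → ∃ j, F^[j] (m, g₀) = (ν, g) := by
    intro Φ ν g G U h
    induction h with
    | start => exact ⟨0, rfl⟩
    | step _ _ h1 h2 ih =>
      obtain ⟨j, hj⟩ := ih
      refine ⟨j + 1, ?_⟩
      rw [Function.iterate_succ_apply', hj, hF]
      simp [h1, h2]
  obtain ⟨j, hj⟩ := key h
  obtain ⟨j', hj'⟩ := key h'
  have fix : F (ν, g) = (ν, g) := by simp [hF, hg]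
  have fix' : F (ν', g') = (ν', g') := by simp [hF, hg']
  have : (ν, g) = (ν', g') := by
    rw [← Function.iterate_fixed fix j', ← Function.iterate_fixed fix' j, ← hj, ← hj',
      ← Function.iterate_add_apply, ← Function.iterate_add_apply, add_comm]
  exact congrArg Prod.snd this

/-! ### Moving an exposed vertex along edges

Array `9` holds the matchings obtained, row `0` of array `10` tells for which vertices they have
been found. -/

/-- Follow the walk from the vertex in register `g`, in the union of the matching in row `0` of
array `7` and the one known for the vertex in register `13`. -/
def follow (g : ℕ) : Cmd := .seq (.mov 20 g) (.seq (.mov 21 13) (walk 20 7 (visit 7)))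

/-- Follow the walks that start from the matching of the vertex in register `12` after at most one
exchange. -/
def tryWalks : Cmd := eachEdge 9 12 14 15 17 (.seq (branch 9 12 7 14 15 16 18) (follow 16))

/-- Follow the walks that start from the matching of the vertex in register `12`, and record the
result of one that ends in the vertex in register `13`. -/
def moveAlong : Cmd :=
  .rep 14 (.seq (.load 17 9 12 14) (.seq (.eq 17 17 14) (.cond 17 (.seq (copyRow 9 12 7 0)
    (.seq (follow 14) (.seq (.eq 17 20 13) (.cond 17 (.seq (copyRow 7 0 9 13) (.store 10 0 13 1))
      .skip)))) .skip)))

/-- Treat the edge between the vertices in registers `12` and `13`. -/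
def moveEdge : Cmd :=
  when 17 10 0 12 (when 17 11 0 13 (when 17 1 12 13 (.seq (.load 17 10 0 13)
    (.cond 17 .skip (.seq tryWalks moveAlong)))))

/-- Try to move the vertex in register `10`, exposed by the matching in row `0` of array `6`, to all
vertices reachable from it. -/
def move : Cmd :=
  .seq (visit 6) (.seq (.rep 11 (.store 10 0 11 0)) (.seq (copyRow 6 0 9 10) (.seq (.store 10 0 10 1)
    (.rep 11 (.rep 12 (.rep 13 moveEdge))))))

theorem follow_spec (hG : IsGraph e.N adj) (hR : IsFamily e.N adj k D R) {g : ℕ} {s : St}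
    (h : PInv e adj k D R s) {t a : ℕ} (ht : t ∈ D) (hst : s.reg 13 = t) (hsg : s.reg g = a)
    (ha : a < e.N) (hm : IsMatch e.N adj k m) (hma : m a = a) (hr : Rep e.N (s.arr 7 0) m) :
    PStep e adj k D R s ((follow g).run e s) ∧ ∃ ν b, b < e.N ∧
      Rep e.N (((follow g).run e s).arr 7 0) ν ∧ IsMatch e.N adj k ν ∧ ν b = b ∧
      ((follow g).run e s).reg 20 = b ∧
      (Progress e D ((follow g).run e s) ∨
        ∃ G U, Walk (Good e.N adj D) m (R t) a ν b G U ∧ Good e.N adj D ν ∧ R t b = b) := by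
  set s1 := (s.setReg 20 a).setReg 21 t with hs1
  have hrun : (follow g).run e s = (walk 20 7 (visit 7)).run e s1 := by
    simp [follow, Cmd.run, hsg, hst, hs1]
  have f1 : PStep e adj k D R s s1 := h.frame (by simp [hs1]) (by simp [hs1]) (by simp [hs1])
    rfl rfl rfl rfl rfl
  rw [hrun]
  have key := walk_spec hG hR (ρ := 20) (A := 7) (V := visit 7) (Φ := Good e.N adj D)
    (fun _ h => h) (by simp) (by simp)
    (by simp [visit, visitEdge, augment, addRow, copyRow, exchange, Cmd.wregs])
    (by simp [visit, visitEdge, augment, addRow, copyRow, exchange, Cmd.warrs])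
    (fun s μ h hr hm => visit_spec hG (by simp) h hr hm) f1.1 ht (by simp [hs1])
    (by simp [hs1]) ha hm hma hr
  exact ⟨f1.trans key.1, key.2⟩

theorem follow_wregs (g : ℕ) {r : ℕ} (hr : r < 20 ∨ 27 ≤ r) (hr' : r < 2 ∨ 9 < r) :
    r ∉ (follow g).wregs := by
  simp [follow, walk_wregs, visit, visitEdge, augment, addRow, copyRow, exchange, Cmd.wregs]
  omega

theorem follow_warrs (g : ℕ) {A : ℕ} (hA : A ∉ [2, 3, 4, 7]) : A ∉ (follow g).warrs := by
  simp at hA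
  simp [follow, walk_warrs, visit, visitEdge, augment, addRow, copyRow, exchange, Cmd.warrs, hA]

/-- This checks the hypothesis on exchanged matchings in `Chain.step`, on which the argument with
the odd cycle depends. -/
theorem tryWalks_spec (hG : IsGraph e.N adj) (hR : IsFamily e.N adj k D R) {s : St}
    (h : PInv e adj k D R s) {t : ℕ} (ht : t ∈ D) (hst : s.reg 13 = t) (hr : s.reg 12 < e.N)
    (hm : IsMatch e.N adj k μ) (hrep : Rep e.N (s.arr 9 (s.reg 12)) μ) :
    PStep e adj k D R s (tryWalks.run e s) ∧ (Progress e D (tryWalks.run e s) ∨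
      (Good e.N adj D μ → ∀ g < e.N, μ g = g → ∀ u, u = g ∨ adj g u →
        WalkOK (Good e.N adj D) (sw μ g u) (R t) (μ u))) := by
  have hb : ∀ r, r = 12 ∨ r = 13 ∨ r = 14 → r ∉
      (Cmd.seq (branch 9 12 7 14 15 16 18) (follow 16)).wregs := by
    rintro r hr'
    rw [Cmd.wregs, List.mem_append, not_or]
    refine ⟨?_, follow_wregs 16 (by omega) (by omega)⟩
    rcases hr' with rfl | rfl | rfl <;> simp [branch_wregs]
  have key := eachEdge_spec (A := 9) (i := 12) (g := 14) (u := 15) (c := 17)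
    (p := .seq (branch 9 12 7 14 15 16 18) (follow 16)) (μ := μ)
    (Φ := fun g u => Good e.N adj D μ → WalkOK (Good e.N adj D) (sw μ g u) (R t) (μ u))
    (fun s' => s'.reg 12 = s.reg 12 ∧ s'.reg 13 = t ∧ s'.arr 9 = s.arr 9)
    (by simp) (by simp) (by simp) (by simp) (by simp) (hb 14 (by simp))
    (fun s' r x hr' h => by
      simp at hr'
      refine ⟨?_, ?_, h.2.2⟩ <;> rcases hr' with rfl | rfl | rfl <;> simp [h.1, h.2.1])
    (fun s' h => by rw [h.1, h.2.2]; exact ⟨hr, hrep⟩) ?_ ⟨rfl, hst, rfl⟩ h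
  · refine ⟨key.2.1, key.2.2.imp_right fun h1 hgood g hg hμg u hu => h1 g hg u ?_ hμg hu hgood⟩
    rcases hu with rfl | hu
    exacts [hg, hG.lt (hG.symm hu)]
  rintro s' ⟨j1, j2, j3⟩ h' hg hu hμg ha
  refine ⟨⟨?_, ?_, ?_⟩, ?_⟩
  · rw [Cmd.run_reg e (hb 12 (by simp)), j1]
  · rw [Cmd.run_reg e (hb 13 (by simp)), j2]
  · rw [Cmd.run_arr e (by
      rw [Cmd.warrs, List.mem_append, not_or]
      exact ⟨by simp [branch_warrs], follow_warrs 16 (by simp)⟩), j3]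
  · obtain ⟨b1, μ', b2, b3, b4, b5⟩ := branch_spec (D := D) hG (A := 9) (i := 12) (B := 7)
      (g := 14) (u := 15) (w := 16) (c := 18) (by simp) (by simp) (by simp) h'.zero
      (by rwa [j1]) hg hu (by rw [j1, j3]; exact hrep) hm hμg ha
    have f1 := h'.cmd (p := branch 9 12 7 14 15 16 18) (by simp [branch_wregs])
      (by simp [branch_warrs])
    rw [Cmd.run]
    have j2' : ((branch 9 12 7 14 15 16 18).run e s').reg 13 = t := by
      rw [Cmd.run_reg e (by simp [branch_wregs]), j2]
    obtain ⟨f2, ν, b, c1, c2, c3, c4, c5, c6⟩ := follow_spec hG hR f1.1 ht j2' b1 (hm.lt hG hu)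
      b3 b4 b2
    refine ⟨f1.trans f2, c6.imp_right fun ⟨G, U, d1, d2, d3⟩ hgood => ?_⟩
    rw [← b5 hgood]
    exact ⟨ν, b, G, U, d1, d2, d3⟩

/-- What the arrays `9` and `10` hold. -/
def KInv (e : Env) (adj : ℕ → ℕ → Prop) (k : ℕ) (D : Set ℕ) (R : ℕ → ℕ → ℕ) (p : ℕ) (m : ℕ → ℕ)
    (s : St) : Prop :=
  ∀ x < e.N, s.arr 10 0 x ≠ 0 → ∃ ν, Rep e.N (s.arr 9 x) ν ∧ IsMatch e.N adj k ν ∧ ν x = x ∧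
    (Progress e D s ∨ Chain e.N adj D R p m x ν)

theorem KInv.frame {s s' : St} (h : KInv e adj k D R p m s) (h9 : s'.arr 9 = s.arr 9)
    (h10 : s'.arr 10 = s.arr 10) (hP : Progress e D s → Progress e D s') :
    KInv e adj k D R p m s' := by
  intro x hx hne
  rw [h10] at hne
  obtain ⟨ν, h1, h2, h3, h4⟩ := h x hx hne
  exact ⟨ν, by rwa [h9], h2, h3, h4.imp_left hP⟩

/-- If some unobstructed walk from `g` ends in `t`, then the walk followed by the program ends there
too, by `Walk.end_unique`, and the result is recorded. The row of `r` is not touched, because `r ≠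
t`. -/
theorem moveAlong_step (hG : IsGraph e.N adj) (hR : IsFamily e.N adj k D R) {s : St} {r t g : ℕ}
    (h : PInv e adj k D R s) (hK : KInv e adj k D R p m s) (ht : t ∈ D) (hrt : adj r t)
    (h12 : s.reg 12 = r) (h13 : s.reg 13 = t) (h14 : s.reg 14 = g) (hr : r < e.N) (hg : g < e.N)
    (hm : IsMatch e.N adj k μ) (hrep : Rep e.N (s.arr 9 r) μ)
    (hC : Progress e D s ∨ Chain e.N adj D R p m r μ ∧
      ∀ g < e.N, μ g = g → ∀ u, u = g ∨ adj g u →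
        WalkOK (Good e.N adj D) (sw μ g u) (R t) (μ u)) :
    ∃ s', (Cmd.seq (.load 17 9 12 14) (.seq (.eq 17 17 14) (.cond 17 (.seq (copyRow 9 12 7 0)
      (.seq (follow 14) (.seq (.eq 17 20 13) (.cond 17 (.seq (copyRow 7 0 9 13)
      (.store 10 0 13 1)) .skip)))) .skip))).run e s = s' ∧ PStep e adj k D R s s' ∧
      KInv e adj k D R p m s' ∧ (∀ x, s.arr 10 0 x ≠ 0 → s'.arr 10 0 x ≠ 0) ∧
      s'.reg 12 = r ∧ s'.reg 13 = t ∧ Rep e.N (s'.arr 9 r) μ ∧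
      (Progress e D s' ∨ (μ g = g → ∀ ν G U, Walk (Good e.N adj D) μ (R t) g ν t G U →
        s'.arr 10 0 t ≠ 0)) := by
  have hN : 0 < e.N := by omega
  obtain ⟨htN, hRt, hRtt⟩ := hR t ht
  have hne : r ≠ t := fun h => hG.irrefl (h ▸ hrt)
  refine ⟨_, rfl, ?_⟩
  set s1 := (s.setReg 17 (μ g)).setReg 17 (if μ g = g then 1 else 0) with hs1
  have f1 : PStep e adj k D R s s1 := h.frame (by simp [hs1]) (by simp [hs1]) (by simp [hs1])
    rfl rfl rfl rfl rfl
  have hrun : (Cmd.seq (.load 17 9 12 14) (.seq (.eq 17 17 14) (.cond 17 (.seq (copyRow 9 12 7 0)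
      (.seq (follow 14) (.seq (.eq 17 20 13) (.cond 17 (.seq (copyRow 7 0 9 13)
      (.store 10 0 13 1)) .skip)))) .skip))).run e s =
      if μ g = g then (Cmd.seq (.eq 17 20 13) (.cond 17 (.seq (copyRow 7 0 9 13)
      (.store 10 0 13 1)) .skip)).run e ((follow 14).run e ((copyRow 9 12 7 0).run e s1))
      else s1 := by
    by_cases hμ : μ g = g <;> simp [Cmd.run, h12, h14, hr, hg, hrep g hg, hs1, hμ]
  rw [hrun]
  by_cases hμ : μ g = g
  swap
  · rw [if_neg hμ]
    exact ⟨f1, hK.frame rfl rfl f1.2, fun _ => id, by simp [hs1, h12], by simp [hs1, h13], hrep,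
      Or.inr fun h => absurd h hμ⟩
  rw [if_pos hμ]
  have hc1 := copyRow_arr e (A := 9) (i := 12) (B := 7) (j := 0) (by simp) (by simp) (by simp) s1
    (by simpa [hs1, h12]) (by simp [hs1, h.zero, hN])
  have f2 := f1.1.cmd (p := copyRow 9 12 7 0) (by simp [copyRow, Cmd.wregs])
    (by simp [copyRow, Cmd.warrs])
  have r2 : ∀ r, r ∉ [3, 4, 17] → ((copyRow 9 12 7 0).run e s1).reg r = s.reg r := by
    intro r hr
    simp at hr
    rw [Cmd.run_reg e (by simp [copyRow, Cmd.wregs, hr]), hs1]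
    simp [hr]
  have a2 : ∀ A, A ≠ 7 → ((copyRow 9 12 7 0).run e s1).arr A = s.arr A := by
    intro A hA
    rw [Cmd.run_arr e (by simp [copyRow, Cmd.warrs, hA])]
    rfl
  set s2 := (copyRow 9 12 7 0).run e s1 with hs2
  have hrep2 : Rep e.N (s2.arr 7 0) μ := by
    intro x hx
    rw [hc1, if_pos ⟨rfl, by simp [hs1, h.zero], hx⟩]
    simpa [hs1, h12] using hrep x hx
  obtain ⟨f3, ν, b, c1, c2, c3, c4, c5, c6⟩ := follow_spec hG hR f2.1 ht
    (by rw [r2 13 (by simp), h13]) (by rw [r2 14 (by simp), h14]) hg hm hμ hrep2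
  have r3 : ∀ r, r = 0 ∨ r = 1 ∨ r = 12 ∨ r = 13 → ((follow 14).run e s2).reg r = s.reg r := by
    intro r hr
    rw [Cmd.run_reg e (follow_wregs 14 (by omega) (by omega)), r2 r (by simp; omega)]
  have a3 : ∀ A, A ∉ [2, 3, 4, 7] → ((follow 14).run e s2).arr A = s.arr A := by
    intro A hA
    rw [Cmd.run_arr e (follow_warrs 14 hA), a2 A (by simp at hA; tauto)]
  set s3 := (follow 14).run e s2 with hs3
  have f4 : PStep e adj k D R s3 (s3.setReg 17 (if b = t then 1 else 0)) :=
    f3.1.setReg (by simp)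
  have f5 := f1.trans (f2.trans (f3.trans f4))
  by_cases hbt : b = t
  swap
  · have : (Cmd.seq (.eq 17 20 13) (.cond 17 (.seq (copyRow 7 0 9 13)
      (.store 10 0 13 1)) .skip)).run e s3 = s3.setReg 17 (if b = t then 1 else 0) := by
      simp [Cmd.run, c5, r3, h13, hbt]
    rw [this]
    refine ⟨f5, hK.frame (a3 9 (by simp)) (a3 10 (by simp)) f5.2, fun x hx => ?_, ?_, ?_, ?_, ?_⟩
    · rw [St.arr_setReg, a3 10 (by simp)]
      exact hx
    · simp [r3, h12]
    · simp [r3, h13]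
    · rw [St.arr_setReg, a3 9 (by simp)]
      exact hrep
    · refine c6.imp f4.2 fun ⟨G, U, d1, d2, d3⟩ _ ν' G' U' hw' => ?_
      exact absurd (d1.end_unique hw' d3 hRtt) hbt
  set s4 := s3.setReg 17 (if b = t then 1 else 0) with hs4
  have hc5 := copyRow_arr e (A := 7) (i := 0) (B := 9) (j := 13) (by simp) (by simp) (by simp) s4
    (by simp [hs4, r3, h.zero, hN]) (by simpa [hs4, r3, h13])
  have r5 : ∀ r, r = 0 ∨ r = 1 ∨ r = 12 ∨ r = 13 →
      ((copyRow 7 0 9 13).run e s4).reg r = s.reg r := by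
    intro r hr
    rw [Cmd.run_reg e (by simp [copyRow, Cmd.wregs]; omega), hs4, ← r3 r hr]
    rw [St.reg_setReg, if_neg (by omega)]
  have : (Cmd.seq (.eq 17 20 13) (.cond 17 (.seq (copyRow 7 0 9 13)
      (.store 10 0 13 1)) .skip)).run e s3 = ((copyRow 7 0 9 13).run e s4).setArr 10 0 t 1 := by
    have e1 : (Cmd.eq 17 20 13).run e s3 = s4 := by simp [Cmd.run, hs4, c5, r3, h13]
    rw [Cmd.run, e1]
    simp [Cmd.run, r5, h13, h.zero, h.one, hN, htN]
    simp [hs4, hbt]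
  rw [this]
  have f6 : PStep e adj k D R s (((copyRow 7 0 9 13).run e s4).setArr 10 0 t 1) := by
    rw [← this]
    exact f1.trans (f2.trans (f3.trans (f3.1.cmd (by simp [copyRow, Cmd.wregs])
      (by simp [copyRow, Cmd.warrs]))))
  have f7 : Progress e D s3 → Progress e D (((copyRow 7 0 9 13).run e s4).setArr 10 0 t 1) := by
    rw [← this]
    exact (f3.1.cmd (by simp [copyRow, Cmd.wregs]) (by simp [copyRow, Cmd.warrs])).2
  have a5 : ∀ x, (((copyRow 7 0 9 13).run e s4).setArr 10 0 t 1).arr 10 0 x =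
      if x = t then 1 else s.arr 10 0 x := by
    intro x
    rw [St.arr_setArr, Cmd.run_arr e (by simp [copyRow, Cmd.warrs]), hs4, St.arr_setReg,
      a3 10 (by simp)]
    simp
  have a6 : ∀ x, x ≠ t → (((copyRow 7 0 9 13).run e s4).setArr 10 0 t 1).arr 9 x = s.arr 9 x := by
    intro x hx
    funext y
    rw [St.arr_setArr, if_neg (by simp), hc5, if_neg, hs4, St.arr_setReg, a3 9 (by simp)]
    simp [hs4, r3, h13, hx]
  have a7 : Rep e.N ((((copyRow 7 0 9 13).run e s4).setArr 10 0 t 1).arr 9 t) ν := by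
    intro y hy
    rw [St.arr_setArr, if_neg (by simp), hc5, if_pos ⟨rfl, by simp [hs4, r3, h13], hy⟩, hs4]
    simp [r3, h.zero, c2 y hy]
  refine ⟨f6, ?_, ?_, by simp [r5, h12], by simp [r5, h13], by rwa [a6 r hne], ?_⟩
  · intro x hx hx'
    by_cases hxt : x = t
    · subst hxt
      refine ⟨ν, a7, c3, hbt ▸ c4, ?_⟩
      rcases hC with hC | ⟨hC, hall⟩
      · exact Or.inl (f6.2 hC)
      rcases c6 with c6 | ⟨G, U, d1, d2, d3⟩
      · exact Or.inl (f7 c6)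
      · rw [hbt] at d1
        exact Or.inr (.step hC ht hrt hall hg hμ d1 d2)
    · rw [a5, if_neg hxt] at hx'
      rw [a6 x hxt]
      obtain ⟨ν', e1, e2, e3, e4⟩ := hK x hx hx'
      exact ⟨ν', e1, e2, e3, e4.imp_left f6.2⟩
  · intro x hx
    rw [a5]
    split_ifs
    exacts [one_ne_zero, hx]
  · refine Or.inr fun _ _ _ _ _ => ?_
    rw [a5, if_pos rfl]
    exact one_ne_zero

end CapDom

/-! ### Closing the set of vertices to which an exposed vertex can be moved. -/

namespace CapDom

variable {e : Env} {k : ℕ} {adj : ℕ → ℕ → Prop} {D : Set ℕ} {R : ℕ → ℕ → ℕ} {m μ : ℕ → ℕ} {p : ℕ}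

/-- The right start `g` is unknown and all are tried; `exists_walk_to`, applied to `μ` and `R t`,
shows that one of them leads to `t`. -/
theorem moveAlong_spec (hG : IsGraph e.N adj) (hR : IsFamily e.N adj k D R) {s : St} {r t : ℕ}
    (h : PInv e adj k D R s) (hK : KInv e adj k D R p m s) (ht : t ∈ D) (hrt : adj r t)
    (h12 : s.reg 12 = r) (h13 : s.reg 13 = t) (hr : r < e.N)
    (hm : IsMatch e.N adj k μ) (hrep : Rep e.N (s.arr 9 r) μ)
    (hC : Progress e D s ∨ Chain e.N adj D R p m r μ ∧ Good e.N adj D μ ∧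
      ∀ g < e.N, μ g = g → ∀ u, u = g ∨ adj g u →
        WalkOK (Good e.N adj D) (sw μ g u) (R t) (μ u)) :
    PStep e adj k D R s (moveAlong.run e s) ∧ KInv e adj k D R p m (moveAlong.run e s) ∧
      (∀ x, s.arr 10 0 x ≠ 0 → (moveAlong.run e s).arr 10 0 x ≠ 0) ∧
      (Progress e D (moveAlong.run e s) ∨ (moveAlong.run e s).arr 10 0 t ≠ 0) := by
  have key := iter_induction (n := e.N) (s := s) (f := fun j s' =>
    (Cmd.seq (.load 17 9 12 14) (.seq (.eq 17 17 14) (.cond 17 (.seq (copyRow 9 12 7 0)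
      (.seq (follow 14) (.seq (.eq 17 20 13) (.cond 17 (.seq (copyRow 7 0 9 13)
      (.store 10 0 13 1)) .skip)))) .skip))).run e (s'.setReg 14 j))
    (fun j s' => PStep e adj k D R s s' ∧ KInv e adj k D R p m s' ∧
      (∀ x, s.arr 10 0 x ≠ 0 → s'.arr 10 0 x ≠ 0) ∧ s'.reg 12 = r ∧ s'.reg 13 = t ∧
      Rep e.N (s'.arr 9 r) μ ∧
      (Progress e D s' ∨ ∀ g < j, μ g = g → ∀ ν G U, Walk (Good e.N adj D) μ (R t) g ν t G U →
        s'.arr 10 0 t ≠ 0))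
    ⟨.refl h, hK, fun _ => id, h12, h13, hrep, Or.inr (by simp)⟩ ?_
  · obtain ⟨k1, k2, k3, -, -, -, k4⟩ := key
    refine ⟨k1, k2, k3, ?_⟩
    rcases k4 with k4 | k4
    · exact Or.inl k4
    rcases hC with hC | ⟨-, -, hC⟩
    · exact Or.inl (k1.2 hC)
    obtain ⟨htN, hRt, hRtt⟩ := hR t ht
    obtain ⟨g, ν, G, U, hg, hgg, hw, -⟩ := exists_walk_to hG hm hRt (Φ := Good e.N adj D)
      (fun g hg hgg => by
        have := hC g hg hgg g (Or.inl rfl)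
        rwa [sw_self hgg, hgg] at this) htN hRtt
    exact Or.inr (k4 g hg hgg ν G U hw)
  rintro j s1 hj ⟨k1, k2, k3, k4, k5, k6, k7⟩
  have f1 := k1.1.setReg (r := 14) (x := j) (by simp)
  obtain ⟨s', hs', f2, a2, a3, a4, a5, a6, a7⟩ := moveAlong_step hG hR (g := j) f1.1
    (k2.frame rfl rfl f1.2) ht hrt (by simpa using k4) (by simpa using k5) (by simp) hr hj hm k6
    (hC.imp (fun h => f1.2 (k1.2 h)) fun h => ⟨h.1, h.2.2⟩)
  rw [hs']
  refine ⟨k1.trans (f1.trans f2), a2, fun x hx => a3 x (k3 x hx), a4, a5, a6, ?_⟩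
  rcases k7 with k7 | k7
  · exact Or.inl (f2.2 (f1.2 k7))
  refine a7.imp_right fun a7 g hg hgg ν G U hw => ?_
  rcases Nat.lt_succ_iff_lt_or_eq.1 hg with hg | rfl
  · exact a3 t (k7 g hg hgg ν G U hw)
  · exact a7 hgg ν G U hw

/-- What the memory holds while an exposed vertex is moved; the matchings that have been found at
`s` are not lost. -/
structure KStep (e : Env) (adj : ℕ → ℕ → Prop) (k : ℕ) (D : Set ℕ) (R : ℕ → ℕ → ℕ) (p : ℕ)
    (m : ℕ → ℕ) (s s' : St) : Prop where
  pstep : PStep e adj k D R s s'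
  kinv : KInv e adj k D R p m s'
  mono : ∀ x, s.arr 10 0 x ≠ 0 → s'.arr 10 0 x ≠ 0

theorem KStep.trans {s s' s'' : St} (h : KStep e adj k D R p m s s')
    (h' : KStep e adj k D R p m s' s'') : KStep e adj k D R p m s s'' :=
  ⟨h.pstep.trans h'.pstep, h'.kinv, fun x hx => h'.mono x (h.mono x hx)⟩

theorem KStep.setReg {s : St} {r x : ℕ} (hr : r ∉ [0, 1, 2]) (h : PInv e adj k D R s)
    (hK : KInv e adj k D R p m s) : KStep e adj k D R p m s (s.setReg r x) :=
  ⟨h.setReg hr, hK.frame rfl rfl (h.setReg hr).2, fun _ => id⟩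

/-- Membership in `D` is tested in array `11`, the copy made at the beginning of the phase, since
array `2` may have grown meanwhile. If the edge needs no treatment, only the test register changes.
-/
theorem moveEdge_spec (hG : IsGraph e.N adj) (hR : IsFamily e.N adj k D R)
    (hm : IsMatch e.N adj k m) (hp : m p = p) (hpN : p < e.N) {s : St} {r t : ℕ}
    (hgood : Progress e D s ∨ Good e.N adj D m)
    (h : PInv e adj k D R s) (hK : KInv e adj k D R p m s)
    (h12 : s.reg 12 = r) (h13 : s.reg 13 = t) (hr : r < e.N) (ht : t < e.N) :
    KStep e adj k D R p m s (moveEdge.run e s) ∧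
      (Progress e D (moveEdge.run e s) ∨ (s.arr 10 0 r ≠ 0 → t ∈ D → adj r t →
        (moveEdge.run e s).arr 10 0 t ≠ 0)) := by
  have hN : 0 < e.N := by omega
  have hD := h.frozen t ht
  have ha := h.graph r hr t ht
  have hst : ∀ (s : St) v w, (s.setReg 17 v).setReg 17 w = s.setReg 17 w := by
    intro s v w
    simp only [St.setReg, St.mk.injEq, and_true]
    funext r
    split_ifs <;> rfl
  have hS : ∀ v, KStep e adj k D R p m s (s.setReg 17 v) := fun v =>
    .setReg (by simp) h hK
  by_cases h1 : s.arr 10 0 r ≠ 0 ∧ t ∈ D ∧ adj r t ∧ s.arr 10 0 t = 0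
  swap
  · have : ∃ v, moveEdge.run e s = s.setReg 17 v := by
      by_cases c1 : s.arr 10 0 r = 0
      · exact ⟨0, by simp [moveEdge, when, Cmd.run, h12, h.zero, hN, hr, c1]⟩
      by_cases c2 : s.arr 11 0 t = 0
      · exact ⟨0, by simp [moveEdge, when, Cmd.run, h12, h13, h.zero, hN, hr, ht, c1, c2, hst]⟩
      by_cases c3 : s.arr 1 r t = 0
      · exact ⟨0, by simp [moveEdge, when, Cmd.run, h12, h13, h.zero, hN, hr, ht, c1, c2, c3, hst]⟩
      have c4 : s.arr 10 0 t ≠ 0 := fun c4 => h1 ⟨c1, hD.1 c2, ha.1 c3, c4⟩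
      exact ⟨s.arr 10 0 t, by
        simp [moveEdge, when, Cmd.run, h12, h13, h.zero, hN, hr, ht, c1, c2, c3, c4, hst]⟩
    obtain ⟨v, hv⟩ := this
    rw [hv]
    refine ⟨hS v, Or.inr fun c1 c2 c3 c4 => h1 ⟨c1, c2, c3, c4⟩⟩
  obtain ⟨c1, c2, c3, c4⟩ := h1
  have d2 := hD.2 c2
  have d3 := ha.2 c3
  have hrun : moveEdge.run e s = moveAlong.run e (tryWalks.run e (s.setReg 17 0)) := by
    simp [moveEdge, when, Cmd.run, h12, h13, h.zero, hN, hr, ht, c1, d2, d3, c4, hst]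
  rw [hrun]
  obtain ⟨μ, e1, e2, e3, e4⟩ := hK r hr c1
  have f1 := hS 0
  obtain ⟨f2, hP⟩ := tryWalks_spec hG hR f1.pstep.1 c2 (by simp [h13]) (by simp [h12, hr]) e2
    (by simpa [h12] using e1)
  have fr : ∀ r, r = 12 ∨ r = 13 → (tryWalks.run e (s.setReg 17 0)).reg r = s.reg r := by
    intro r hr
    rw [Cmd.run_reg e]
    · rw [St.reg_setReg, if_neg (by omega)]
    · rw [tryWalks, eachEdge_wregs, List.mem_append, List.mem_append, List.mem_cons, Cmd.wregs,
        List.mem_append, branch_wregs]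
      have := follow_wregs 16 (r := r) (by omega) (by omega)
      simp [this]
      omega
  have fa : ∀ A, A = 9 ∨ A = 10 → (tryWalks.run e (s.setReg 17 0)).arr A = s.arr A := by
    intro A hA
    rw [Cmd.run_arr e]
    · rfl
    · rw [tryWalks, eachEdge_warrs, Cmd.warrs, List.mem_append, List.mem_append, branch_warrs]
      have := follow_warrs 16 (A := A) (by simp; omega)
      simp [this]
      omega
  set s2 := tryWalks.run e (s.setReg 17 0) with hs2
  have f2' : KStep e adj k D R p m s s2 := ⟨f1.pstep.trans f2,
    hK.frame (fa 9 (by simp)) (fa 10 (by simp)) (f1.pstep.trans f2).2, fun x hx => by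
      rw [fa 10 (by simp)]
      exact hx⟩
  obtain ⟨k1, k2, k3, k4⟩ := moveAlong_spec hG hR f2'.pstep.1 f2'.kinv c2 c3
    (by rw [fr 12 (by simp), h12]) (by rw [fr 13 (by simp), h13]) hr e2
    (by rw [fa 9 (by simp)]; exact e1) (by
      rcases e4 with e4 | e4
      · exact Or.inl (f2'.pstep.2 e4)
      rcases hgood with hgood | hgood
      · exact Or.inl (f2'.pstep.2 hgood)
      have hg := (e4.inv hG hR hm hp hpN hgood).good
      exact hP.imp_right fun hP => ⟨e4, hg, hP hg⟩)
  exact ⟨f2'.trans ⟨k1, k2, k3⟩, k4.imp_right fun h _ _ _ => h⟩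

theorem moveEdge_wregs {r : ℕ} (hr : r = 11 ∨ r = 12 ∨ r = 13) :
    r ∉ moveEdge.wregs := by
  have h1 := follow_wregs 16 (r := r) (by omega) (by omega)
  have h2 := follow_wregs 14 (r := r) (by omega) (by omega)
  rcases hr with rfl | rfl | rfl <;>
    simp [moveEdge, when, tryWalks, moveAlong, Cmd.wregs, eachEdge_wregs, branch_wregs, copyRow, h1,
      h2]

/-- A round over all edges. -/
theorem moveRound_spec (hG : IsGraph e.N adj) (hR : IsFamily e.N adj k D R)
    (hm : IsMatch e.N adj k m) (hp : m p = p) (hpN : p < e.N) {s : St}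
    (hgood : Progress e D s ∨ Good e.N adj D m)
    (h : PInv e adj k D R s) (hK : KInv e adj k D R p m s) :
    KStep e adj k D R p m s ((Cmd.rep 12 (.rep 13 moveEdge)).run e s) ∧
      (Progress e D ((Cmd.rep 12 (.rep 13 moveEdge)).run e s) ∨
        ∀ r < e.N, ∀ t < e.N, s.arr 10 0 r ≠ 0 → t ∈ D → adj r t →
          ((Cmd.rep 12 (.rep 13 moveEdge)).run e s).arr 10 0 t ≠ 0) := by
  refine iter_induction (fun j s' => KStep e adj k D R p m s s' ∧ (Progress e D s' ∨
    ∀ r < j, ∀ t < e.N, s.arr 10 0 r ≠ 0 → t ∈ D → adj r t → s'.arr 10 0 t ≠ 0))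
    ⟨⟨.refl h, hK, fun _ => id⟩, Or.inr (by simp)⟩ ?_
  rintro r s1 hr ⟨k1, k2⟩
  have f1 : KStep e adj k D R p m s1 (s1.setReg 12 r) := .setReg (by simp) k1.pstep.1 k1.kinv
  have key := iter_induction (n := e.N) (s := s1.setReg 12 r)
    (f := fun t s' => moveEdge.run e (s'.setReg 13 t))
    (fun j s' => s'.reg 12 = r ∧ KStep e adj k D R p m (s1.setReg 12 r) s' ∧ (Progress e D s' ∨
      ∀ t < j, s.arr 10 0 r ≠ 0 → t ∈ D → adj r t → s'.arr 10 0 t ≠ 0))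
    ⟨by simp, ⟨.refl f1.pstep.1, f1.kinv, fun _ => id⟩, Or.inr (by simp)⟩ ?_
  · obtain ⟨-, a2, a3⟩ := key
    refine ⟨k1.trans (f1.trans a2), ?_⟩
    rcases k2 with k2 | k2
    · exact Or.inl (a2.pstep.2 (f1.pstep.2 k2))
    refine a3.imp_right fun a3 r' hr' t ht b1 b2 b3 => ?_
    rcases Nat.lt_succ_iff_lt_or_eq.1 hr' with hr' | rfl
    · exact a2.mono _ (k2 r' hr' t ht b1 b2 b3)
    · exact a3 t ht b1 b2 b3
  rintro t s2 ht ⟨a1, a2, a3⟩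
  have f2 : KStep e adj k D R p m s2 (s2.setReg 13 t) := .setReg (by simp) a2.pstep.1 a2.kinv
  have f3 := k1.trans (f1.trans (a2.trans f2))
  obtain ⟨b1, b2⟩ := moveEdge_spec hG hR hm hp hpN (hgood.imp_left f3.pstep.2) f2.pstep.1 f2.kinv
    (r := r) (t := t) (by simpa using a1) (by simp) hr ht
  refine ⟨?_, a2.trans (f2.trans b1), ?_⟩
  · rw [Cmd.run_reg e (moveEdge_wregs (by simp))]
    simpa using a1
  rcases a3 with a3 | a3
  · exact Or.inl (b1.pstep.2 (f2.pstep.2 a3))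
  refine b2.imp_right fun b2 t' ht' c1 c2 c3 => ?_
  rcases Nat.lt_succ_iff_lt_or_eq.1 ht' with ht' | rfl
  · exact b1.mono _ (a3 t' ht' c1 c2 c3)
  · exact b2 (f3.mono _ c1) c2 c3

/-- A closure computation: each round over all edges reaches a new vertex or shows that the set
reached is closed. There are at most `N` vertices and `p` is reached at the start, so `N` rounds
suffice. -/
theorem moveRounds_spec (hG : IsGraph e.N adj) (hR : IsFamily e.N adj k D R)
    (hm : IsMatch e.N adj k m) (hp : m p = p) (hpN : p < e.N) {s : St}
    (hgood : Progress e D s ∨ Good e.N adj D m)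
    (h : PInv e adj k D R s) (hK : KInv e adj k D R p m s) (hs : s.arr 10 0 p ≠ 0) :
    PStep e adj k D R s ((Cmd.rep 11 (.rep 12 (.rep 13 moveEdge))).run e s) ∧
      (Progress e D ((Cmd.rep 11 (.rep 12 (.rep 13 moveEdge))).run e s) ∨
        Movable e.N adj D R m p) := by
  classical
  set T : St → Finset ℕ := fun s => (Finset.range e.N).filter fun t => s.arr 10 0 t ≠ 0 with hT
  have key := iter_induction (n := e.N) (s := s)
    (f := fun t s' => (Cmd.rep 12 (.rep 13 moveEdge)).run e (s'.setReg 11 t))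
    (fun j s' => KStep e adj k D R p m s s' ∧ (Progress e D s' ∨
      (∀ t, Reach adj D p t → t < e.N ∧ s'.arr 10 0 t ≠ 0) ∨ j + 1 ≤ (T s').card))
    ⟨⟨.refl h, hK, fun _ => id⟩, Or.inr (Or.inr (Finset.card_pos.2 ⟨p, by simp [hT, hpN, hs]⟩))⟩ ?_
  · obtain ⟨k1, k2⟩ := key
    set s' := (Cmd.rep 11 (.rep 12 (.rep 13 moveEdge))).run e s with hs'
    refine ⟨k1.pstep, ?_⟩
    rcases k2 with k2 | k2 | k2
    · exact Or.inl k2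
    · rcases hgood with hgood | hgood
      · exact Or.inl (k1.pstep.2 hgood)
      by_cases hP : Progress e D s'
      · exact Or.inl hP
      refine Or.inr ⟨hgood, fun t ht => ?_⟩
      obtain ⟨ht1, ht2⟩ := k2 t ht
      obtain ⟨ν, -, -, -, hν⟩ := k1.kinv t ht1 ht2
      exact ⟨ν, hν.resolve_left hP⟩
    · have := Finset.card_filter_le (Finset.range e.N) fun t =>
        ((Cmd.rep 11 (.rep 12 (.rep 13 moveEdge))).run e s).arr 10 0 t ≠ 0
      rw [Finset.card_range] at this
      exact absurd (k2.trans this) (by omega)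
  rintro j s1 hj ⟨k1, k2⟩
  have f1 : KStep e adj k D R p m s1 (s1.setReg 11 j) := .setReg (by simp) k1.pstep.1 k1.kinv
  obtain ⟨b1, b2⟩ := moveRound_spec hG hR hm hp hpN
    (hgood.imp_left fun h => f1.pstep.2 (k1.pstep.2 h)) f1.pstep.1 f1.kinv
  set s2 := (Cmd.rep 12 (.rep 13 moveEdge)).run e (s1.setReg 11 j) with hs2
  refine ⟨k1.trans (f1.trans b1), ?_⟩
  rcases b2 with b2 | b2
  · exact Or.inl b2
  rcases k2 with k2 | k2 | k2
  · exact Or.inl (b1.pstep.2 (f1.pstep.2 k2))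
  · exact Or.inr (Or.inl fun t ht => ⟨(k2 t ht).1, b1.mono _ (k2 t ht).2⟩)
  have hsub : T s1 ⊆ T s2 := by
    intro t ht
    simp only [hT, Finset.mem_filter] at ht ⊢
    exact ⟨ht.1, b1.mono _ ht.2⟩
  by_cases hlt : (T s1).card < (T s2).card
  · exact Or.inr (Or.inr (by omega))
  -- A round without new vertices shows that the set is closed under edges inside `D`; it contains
  -- `p`, hence everything reachable from `p`.
  have heq := Finset.eq_of_subset_of_card_le hsub (not_lt.1 hlt)
  refine Or.inr (Or.inl fun t ht => ?_)
  have : t ∈ T s1 := by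
    induction ht with
    | refl =>
      simp only [hT, Finset.mem_filter, Finset.mem_range]
      exact ⟨hpN, k1.mono p hs⟩
    | @tail r t _ hrt ih =>
      rw [heq]
      simp only [hT, Finset.mem_filter, Finset.mem_range] at ih ⊢
      have htN := hG.lt (hG.symm hrt.1)
      exact ⟨htN, b2 r ih.1 t htN ih.2 hrt.2.2 hrt.1⟩
  rw [heq] at this
  simpa [hT] using this

theorem fillRow_arr (e : Env) {A i j r : ℕ} (hj : j ≠ i) (s : St) (hj' : s.reg j < e.N)
    (A' i' j' : ℕ) : ((Cmd.rep i (.store A j i r)).run e s).arr A' i' j' =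
      if A' = A ∧ i' = s.reg j ∧ j' < e.N then (if r = i then j' else s.reg r)
      else s.arr A' i' j' := by
  refine (iter_induction (f := fun k s' => (Cmd.store A j i r).run e (s'.setReg i k)) (n := e.N)
    (s := s) (fun k s' => (∀ r, r ≠ i → s'.reg r = s.reg r) ∧ ∀ A' i' j', s'.arr A' i' j' =
      if A' = A ∧ i' = s.reg j ∧ j' < k then (if r = i then j' else s.reg r)
      else s.arr A' i' j') ⟨fun _ _ => rfl, by simp⟩ ?_).2 A' i' j'
  rintro k s' hk ⟨h1, h2⟩
  have h3 : (Cmd.store A j i r).run e (s'.setReg i k) = (s'.setReg i k).setArr A (s.reg j) k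
      (if r = i then k else s.reg r) := by
    by_cases hr : r = i <;> simp [Cmd.run, hj, hk, h1, hj', hr]
  rw [h3]
  refine ⟨fun r hr => by simp [hr, h1], fun A' i' j' => ?_⟩
  rw [St.arr_setArr, St.arr_setReg, h2]
  by_cases ha : A' = A ∧ i' = s.reg j
  · obtain ⟨rfl, rfl⟩ := ha
    by_cases h6 : j' = k
    · simp [h6]
    · have : j' < k + 1 ↔ j' < k := by omega
      simp [h6, this]
  · have h6 : ∀ p : Prop, ¬ (A' = A ∧ i' = s.reg j ∧ p) := fun p h => ha ⟨h.1, h.2.1⟩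
    simp only [h6, if_false]

theorem move_spec (hG : IsGraph e.N adj) (hR : IsFamily e.N adj k D R)
    (hm : IsMatch e.N adj k m) (hp : m p = p) (hpN : p < e.N) {s : St}
    (h : PInv e adj k D R s) (h10 : s.reg 10 = p) (hrep : Rep e.N (s.arr 6 0) m) :
    PStep e adj k D R s (move.run e s) ∧
      (Progress e D (move.run e s) ∨ Movable e.N adj D R m p) := by
  have hN : 0 < e.N := by omega
  obtain ⟨f1, g1⟩ := visit_spec hG (A := 6) (by simp) h hrep hm
  have e1 : ((visit 6).run e s).reg 10 = p := by
    rw [Cmd.run_reg e (by simp [visit, visitEdge, augment, addRow, copyRow, exchange, Cmd.wregs]),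
      h10]
  have c1 : Rep e.N (((visit 6).run e s).arr 6 0) m := by
    rw [Cmd.run_arr e (by simp [visit, visitEdge, augment, addRow, copyRow, exchange, Cmd.warrs])]
    exact hrep
  have hz := f1.1.zero
  set s1 := (visit 6).run e s with hs1
  have f2 := f1.1.cmd (p := .rep 11 (.store 10 0 11 0)) (by simp [Cmd.wregs]) (by simp [Cmd.warrs])
  have d2 := fillRow_arr e (A := 10) (i := 11) (j := 0) (r := 0) (by simp) s1 (by rwa [hz])
  have c2 : ∀ A, A ≠ 10 → ((Cmd.rep 11 (.store 10 0 11 0)).run e s1).arr A = s1.arr A :=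
    fun A hA => Cmd.run_arr e (by simp [Cmd.warrs, hA]) s1
  have e2 : ∀ r, r ≠ 11 → ((Cmd.rep 11 (.store 10 0 11 0)).run e s1).reg r = s1.reg r :=
    fun r hr => Cmd.run_reg e (by simp [Cmd.wregs, hr]) s1
  set s2 := (Cmd.rep 11 (.store 10 0 11 0)).run e s1 with hs2
  have d3 := copyRow_arr e (A := 6) (i := 0) (B := 9) (j := 10) (by simp) (by simp) (by simp) s2
    (by rwa [e2 0 (by simp), hz]) (by rwa [e2 10 (by simp), e1])
  have e3 : ∀ r, r ∉ [3, 4, 11] → ((copyRow 6 0 9 10).run e s2).reg r = s1.reg r := by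
    intro r hr
    simp at hr
    rw [Cmd.run_reg e (by simp [copyRow, Cmd.wregs, hr]), e2 r hr.2.2]
  set s3 := (copyRow 6 0 9 10).run e s2 with hs3
  have hrun : move.run e s = (Cmd.rep 11 (.rep 12 (.rep 13 moveEdge))).run e
      (s3.setArr 10 0 p 1) := by
    have : (Cmd.store 10 0 10 1).run e s3 = s3.setArr 10 0 p 1 := by
      simp [Cmd.run, e3, hz, hN, e1, hpN, f1.1.one]
    rw [move, Cmd.run, ← hs1, Cmd.run, ← hs2, Cmd.run, ← hs3, Cmd.run, this]
  have f4 : PStep e adj k D R s2 (s3.setArr 10 0 p 1) := by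
    have := f2.1.cmd (p := .seq (copyRow 6 0 9 10) (.store 10 0 10 1))
      (by simp [copyRow, Cmd.wregs]) (by simp [copyRow, Cmd.warrs])
    rw [Cmd.run, ← hs3] at this
    simpa [Cmd.run, e3, hz, hN, e1, hpN, f1.1.one] using this
  have f5 := f2.trans f4
  rw [hrun]
  have hK : KInv e adj k D R p m (s3.setArr 10 0 p 1) := by
    intro x hx hne
    have hxp : x = p := by
      by_contra hxp
      refine hne ?_
      rw [St.arr_setArr, if_neg (by simp [hxp]), d3, if_neg (by simp), d2,
        if_pos ⟨rfl, hz.symm, hx⟩]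
      simp [hz]
    subst hxp
    refine ⟨m, fun y hy => ?_, hm, hp, Or.inr .base⟩
    rw [St.arr_setArr, if_neg (by simp), d3, if_pos ⟨rfl, by rw [e2 10 (by simp), e1], hy⟩,
      e2 0 (by simp), hz, c2 6 (by simp)]
    exact c1 y hy
  have key := moveRounds_spec hG hR hm hp hpN (g1.imp_left f5.2) f5.1 hK (by simp)
  exact ⟨f1.trans (f5.trans key.1), key.2⟩

end CapDom

namespace CapDom

variable {e : Env} {k : ℕ} {adj : ℕ → ℕ → Prop} {D : Set ℕ} {R : ℕ → ℕ → ℕ} {m μ : ℕ → ℕ} {p : ℕ}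

/-! ### The search for a larger matching -/

/-- Record what can be learnt from the matching in row `0` of array `5`, and from moving the
vertices that it exposes. -/
def explore : Cmd :=
  .seq (visit 5) (eachEdge 5 0 30 31 32 (.seq (branch 5 0 6 30 31 33 34) (.seq (.mov 10 33) move)))

theorem visit_wregs (A : ℕ) {r : ℕ} (hr : r < 2 ∨ 9 < r) : r ∉ (visit A).wregs := by
  simp [visit, visitEdge, augment, addRow, copyRow, exchange, Cmd.wregs]
  omega

theorem visit_warrs (A : ℕ) {B : ℕ} (hB : B ∉ [2, 3, 4]) : B ∉ (visit A).warrs := by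
  simp at hB
  simp [visit, visitEdge, augment, addRow, copyRow, exchange, Cmd.warrs, hB]

theorem move_wregs {r : ℕ} (hr : 27 ≤ r ∨ r < 2) : r ∉ move.wregs := by
  have h1 := follow_wregs 16 (r := r) (by omega) (by omega)
  have h2 := follow_wregs 14 (r := r) (by omega) (by omega)
  have h3 := visit_wregs 6 (r := r) (by omega)
  simp [move, moveEdge, when, tryWalks, moveAlong, Cmd.wregs, eachEdge_wregs, branch_wregs,
    copyRow, h1, h2, h3]
  omega

theorem move_warrs {A : ℕ} (hA : A ∉ [2, 3, 4, 7, 9, 10]) : A ∉ move.warrs := by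
  simp at hA
  have h1 := follow_warrs 16 (A := A) (by simp [hA])
  have h2 := follow_warrs 14 (A := A) (by simp [hA])
  have h3 := visit_warrs 6 (B := A) (by simp [hA])
  simp [move, moveEdge, when, tryWalks, moveAlong, Cmd.warrs, eachEdge_warrs, branch_warrs,
    copyRow, h1, h2, h3, hA]

theorem explore_wregs {r : ℕ} (hr : 35 ≤ r ∨ r < 2) : r ∉ explore.wregs := by
  have h1 := visit_wregs 5 (r := r) (by omega)
  have h2 := move_wregs (r := r) (by omega)
  simp [explore, Cmd.wregs, eachEdge_wregs, branch_wregs, h1, h2]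
  omega

theorem explore_warrs {A : ℕ} (hA : A ∉ [2, 3, 4, 6, 7, 9, 10]) : A ∉ explore.warrs := by
  simp at hA
  have h1 := visit_warrs 5 (B := A) (by simp [hA])
  have h2 := move_warrs (A := A) (by simp [hA])
  simp [explore, Cmd.warrs, eachEdge_warrs, branch_warrs, h1, h2, hA]

/-- `Heavy` asks for `Movable` after every single exchange, so `move` is run on each exchanged
matching with the vertex that becomes exposed. -/
theorem explore_spec (hG : IsGraph e.N adj) (hR : IsFamily e.N adj k D R) {s : St}
    (h : PInv e adj k D R s) (hr : Rep e.N (s.arr 5 0) μ) (hm : IsMatch e.N adj k μ) :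
    PStep e adj k D R s (explore.run e s) ∧
      (Progress e D (explore.run e s) ∨ Heavy e.N adj D R μ) := by
  obtain ⟨f1, g1⟩ := visit_spec hG (A := 5) (by simp) h hr hm
  have c1 : Rep e.N (((visit 5).run e s).arr 5 0) μ := by
    rw [Cmd.run_arr e (visit_warrs 5 (by simp))]
    exact hr
  have hN : e.N = 0 ∨ 0 < e.N := by omega
  set s1 := (visit 5).run e s with hs1
  rw [explore, Cmd.run, ← hs1]
  have hb : ∀ r, r = 0 ∨ r = 30 → r ∉
      (Cmd.seq (branch 5 0 6 30 31 33 34) (.seq (.mov 10 33) move)).wregs := by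
    rintro r hr'
    have := move_wregs (r := r) (by omega)
    rcases hr' with rfl | rfl <;> simp [Cmd.wregs, branch_wregs, this]
  rcases hN with hN | hN
  · have : ∀ p : Cmd, ∀ s, (eachEdge 5 0 30 31 32 p).run e s = s := fun p s => by
      simp [eachEdge, Cmd.run, hN, iter]
    rw [this]
    exact ⟨f1, g1.imp_right fun g1 => ⟨g1, fun v hv => by omega⟩⟩
  have key := eachEdge_spec (A := 5) (i := 0) (g := 30) (u := 31) (c := 32)
    (p := .seq (branch 5 0 6 30 31 33 34) (.seq (.mov 10 33) move)) (μ := μ)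
    (Φ := fun g u => Good e.N adj D μ → Movable e.N adj D R (sw μ g u) (μ u))
    (fun s' => s'.reg 0 = 0 ∧ Rep e.N (s'.arr 5 0) μ)
    (by simp) (by simp) (by simp) (by simp) (by simp) (hb 30 (by simp))
    (fun s' r x hr' h => by
      simp at hr'
      refine ⟨?_, h.2⟩
      rcases hr' with rfl | rfl | rfl <;> simp [h.1])
    (fun s' h => by rw [h.1]; exact ⟨hN, h.2⟩) ?_ ⟨f1.1.zero, c1⟩ f1.1
  · refine ⟨f1.trans key.2.1, ?_⟩
    rcases g1 with g1 | g1
    · exact Or.inl (key.2.1.2 g1)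
    refine key.2.2.imp_right fun h1 => ⟨g1, fun g hg hμg u hu => h1 g hg u ?_ hμg hu g1⟩
    rcases hu with rfl | hu
    exacts [hg, hG.lt (hG.symm hu)]
  rintro s' ⟨j1, j2⟩ h' hg hu hμg ha
  refine ⟨⟨?_, ?_⟩, ?_⟩
  · rw [Cmd.run_reg e (hb 0 (by simp)), j1]
  · rw [Cmd.run_arr e (by
      have := move_warrs (A := 5) (by simp)
      simp [Cmd.warrs, branch_warrs, this])]
    exact j2
  · obtain ⟨b1, μ', b2, b3, b4, b5⟩ := branch_spec (D := D) hG (A := 5) (i := 0) (B := 6)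
      (g := 30) (u := 31) (w := 33) (c := 34) (by simp) (by simp) (by simp) h'.zero
      (by rwa [j1]) hg hu (by rw [j1]; exact j2) hm hμg ha
    have f1 := h'.cmd (p := branch 5 0 6 30 31 33 34) (by simp [branch_wregs])
      (by simp [branch_warrs])
    rw [Cmd.run, Cmd.run]
    have f2 : PStep e adj k D R _ ((Cmd.mov 10 33).run e _) := f1.1.setReg (by simp)
    obtain ⟨f3, f4⟩ := move_spec hG hR b3 b4 (hm.lt hG hu) f2.1
      (by simpa [Cmd.run] using b1) b2
    exact ⟨f1.trans (f2.trans f3), f4.imp_right fun h hgood => by rwa [← b5 hgood]⟩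

/-- Explore all matchings on the walks between the matching in row `0` of array `8` and the known
matchings. -/
def phase : Cmd :=
  .seq (copyRow 2 0 11 0) (.seq (copyRow 8 0 5 0) (.seq (visit 5) (.rep 50 (when 52 11 0 50
    (.rep 51 (.seq (.load 52 8 0 51) (.seq (.eq 52 52 51) (.cond 52 (.seq (copyRow 8 0 5 0)
      (.seq (.mov 40 51) (.seq (.mov 41 50) (walk 40 5 explore)))) .skip))))))))

/-- What the memory holds between two phases. -/
structure MInv (e : Env) (adj : ℕ → ℕ → Prop) (k : ℕ) (s : St) : Prop where
  zero : s.reg 0 = 0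
  one : s.reg 1 = 1
  graph : ∀ i < e.N, ∀ j < e.N, s.arr 1 i j ≠ 0 ↔ adj i j
  row : ∀ d < e.N, s.arr 2 0 d ≠ 0 → ∃ m, IsMatch e.N adj k m ∧ m d = d ∧ Rep e.N (s.arr 3 d) m
  best : s.reg 2 ≠ 0 → ∃ k' m, k' + 2 = k ∧ IsMatch e.N adj k' m ∧ Rep e.N (s.arr 4 0) m

theorem PInv.minv {s : St} (h : PInv e adj k D R s) : MInv e adj k s :=
  ⟨h.zero, h.one, h.graph, h.row, h.best⟩

theorem walk_explore_wregs {r : ℕ} (hr : 47 ≤ r ∨ r < 2) : r ∉ (walk 40 5 explore).wregs := by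
  have := explore_wregs (r := r) (by omega)
  simp [walk_wregs, this]
  omega

theorem walk_explore_warrs {A : ℕ} (hA : A ∉ [2, 3, 4, 5, 6, 7, 9, 10]) :
    A ∉ (walk 40 5 explore).warrs := by
  simp at hA
  have := explore_warrs (A := A) (by simp [hA])
  simp [walk_warrs, this, hA]

theorem phase_warrs {A : ℕ} (hA : A ∉ [2, 3, 4, 5, 6, 7, 9, 10, 11]) : A ∉ phase.warrs := by
  simp at hA
  have h1 := visit_warrs 5 (B := A) (by simp [hA])
  have h2 := walk_explore_warrs (A := A) (by simp [hA])
  simp [phase, when, copyRow, Cmd.warrs, h1, h2, hA]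

theorem phaseStep_spec (hG : IsGraph e.N adj) (hR : IsFamily e.N adj k D R)
    (hm : IsMatch e.N adj k m) {x g : ℕ} (hx : x ∈ D) (hg : g < e.N) {s : St}
    (h : PInv e adj k D R s) (h50 : s.reg 50 = x) (h51 : s.reg 51 = g)
    (hr : Rep e.N (s.arr 8 0) m) :
    ∃ s', (Cmd.seq (.load 52 8 0 51) (.seq (.eq 52 52 51) (.cond 52 (.seq (copyRow 8 0 5 0)
      (.seq (.mov 40 51) (.seq (.mov 41 50) (walk 40 5 explore)))) .skip))).run e s = s' ∧
      PStep e adj k D R s s' ∧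
      (Progress e D s' ∨ (m g = g → WalkOK (Heavy e.N adj D R) m (R x) g)) := by
  have hN : 0 < e.N := by omega
  refine ⟨_, rfl, ?_⟩
  set s1 := (s.setReg 52 (m g)).setReg 52 (if m g = g then 1 else 0) with hs1
  have f1 : PStep e adj k D R s s1 := h.frame (by simp [hs1]) (by simp [hs1]) (by simp [hs1])
    rfl rfl rfl rfl rfl
  have hrun : (Cmd.seq (.load 52 8 0 51) (.seq (.eq 52 52 51) (.cond 52 (.seq (copyRow 8 0 5 0)
      (.seq (.mov 40 51) (.seq (.mov 41 50) (walk 40 5 explore)))) .skip))).run e s =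
      if m g = g then (walk 40 5 explore).run e ((Cmd.seq (copyRow 8 0 5 0)
      (.seq (.mov 40 51) (.mov 41 50))).run e s1) else s1 := by
    by_cases hμ : m g = g <;> simp [Cmd.run, h51, h.zero, hN, hg, hr g hg, hs1, hμ]
  rw [hrun]
  split_ifs with hμ
  swap
  · exact ⟨f1, Or.inr fun h => absurd h hμ⟩
  have hc := copyRow_arr e (A := 8) (i := 0) (B := 5) (j := 0) (by simp) (by simp) (by simp) s1
    (by simp [hs1, h.zero, hN]) (by simp [hs1, h.zero, hN])
  have hreg : ∀ r, r ∉ [3, 4, 52] → ((copyRow 8 0 5 0).run e s1).reg r = s.reg r := by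
    intro r hr'
    simp at hr'
    rw [Cmd.run_reg e (by simp [copyRow, Cmd.wregs, hr']), hs1]
    simp [hr']
  have f2 := f1.1.cmd (p := Cmd.seq (copyRow 8 0 5 0) (.seq (.mov 40 51) (.mov 41 50)))
    (by simp [Cmd.wregs, copyRow]) (by simp [Cmd.warrs, copyRow])
  obtain ⟨f3, μ, b, -, -, -, -, -, c⟩ := walk_spec hG hR (ρ := 40) (A := 5) (V := explore)
    (Φ := Heavy e.N adj D R) (fun _ h => h.1) (by simp) (by simp)
    (fun r hr => by
      by_contra hlt
      exact explore_wregs (by omega) hr)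
    (explore_warrs (by simp)) (fun s μ h hr hm => explore_spec hG hR h hr hm) f2.1 hx
    (by simp [Cmd.run, hreg, h50]) (by simp [Cmd.run, hreg, h51]) hg hm hμ
    (by
      intro y hy
      simp only [Cmd.run, St.arr_setReg, hc]
      simp [hs1, h.zero, hy, hr y hy])
  refine ⟨f1.trans (f2.trans f3), c.imp_right fun ⟨G, U, d1, d2, d3⟩ _ => ⟨μ, b, G, U, d1, d2, d3⟩⟩

/-- A phase makes progress, or the matching is maximum. -/
theorem phase_spec (hG : IsGraph e.N adj) (hm : IsMatch e.N adj k m) {s : St}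
    (h : MInv e adj k s) (hr : Rep e.N (s.arr 8 0) m) :
    MInv e adj k (phase.run e s) ∧
      (∀ d < e.N, s.arr 2 0 d ≠ 0 → (phase.run e s).arr 2 0 d ≠ 0) ∧
      ((phase.run e s).reg 2 ≠ 0 ∨
        (∃ d < e.N, s.arr 2 0 d = 0 ∧ (phase.run e s).arr 2 0 d ≠ 0) ∨
        ∀ k' m', IsMatch e.N adj k' m' → k ≤ k') := by
  rcases Nat.eq_zero_or_pos e.N with hN | hN
  · have hk : k = 0 := by rw [← hm.card]; simp [exposed, hN]
    have h2 : (phase.run e s).reg 2 = s.reg 2 := by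
      simp [phase, copyRow, visit, Cmd.run, hN, iter]
    have h0 : (phase.run e s).reg 0 = s.reg 0 := by
      simp [phase, copyRow, visit, Cmd.run, hN, iter]
    have h1 : (phase.run e s).reg 1 = s.reg 1 := by
      simp [phase, copyRow, visit, Cmd.run, hN, iter]
    have h4 : (phase.run e s).arr 4 = s.arr 4 := by
      simp [phase, copyRow, visit, Cmd.run, hN, iter]
    exact ⟨⟨h0.trans h.zero, h1.trans h.one, by simp [hN], by simp [hN], by
      rw [h2, h4]; exact h.best⟩, by simp [hN], by simp [hk]⟩
  -- During a phase `D` and the matchings `R` are those recorded at its beginning. New finds only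
  -- count as progress, so the quantities in the criterion do not change while it is being checked.
  set D : Set ℕ := {d | d < e.N ∧ s.arr 2 0 d ≠ 0} with hD
  choose! R hR1 hR2 hR3 using h.row
  have hR : IsFamily e.N adj k D R := fun d hd => ⟨hd.1, hR1 d hd.1 hd.2, hR2 d hd.1 hd.2⟩
  have hc1 := copyRow_arr e (A := 2) (i := 0) (B := 11) (j := 0) (by simp) (by simp) (by simp) s
    (by rwa [h.zero]) (by rwa [h.zero])
  have r1 : ∀ r, r ∉ [3, 4] → ((copyRow 2 0 11 0).run e s).reg r = s.reg r := fun r hr =>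
    Cmd.run_reg e (by simp at hr; simp [copyRow, Cmd.wregs, hr]) s
  have a1 : ∀ A, A ≠ 11 → ((copyRow 2 0 11 0).run e s).arr A = s.arr A := fun A hA =>
    Cmd.run_arr e (by simp [copyRow, Cmd.warrs, hA]) s
  set s1 := (copyRow 2 0 11 0).run e s with hs1
  have p1 : PInv e adj k D R s1 := by
    refine ⟨by rw [r1 0 (by simp), h.zero], by rw [r1 1 (by simp), h.one], ?_, ?_, ?_, ?_, ?_⟩
    · rw [a1 1 (by simp)]; exact h.graph
    · rw [a1 2 (by simp), a1 3 (by simp)]; exact h.row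
    · rw [a1 2 (by simp), a1 3 (by simp)]
      exact fun d hd => ⟨hd.2, hR3 d hd.1 hd.2⟩
    · intro d hd
      rw [hc1, if_pos ⟨rfl, h.zero.symm, hd⟩, h.zero]
      simp [hD, hd]
    · rw [r1 2 (by simp), a1 4 (by simp)]; exact h.best
  have hc2 := copyRow_arr e (A := 8) (i := 0) (B := 5) (j := 0) (by simp) (by simp) (by simp) s1
    (by rwa [p1.zero]) (by rwa [p1.zero])
  have f2 := p1.cmd (p := copyRow 8 0 5 0) (by simp [copyRow, Cmd.wregs])
    (by simp [copyRow, Cmd.warrs])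
  have a2 : ((copyRow 8 0 5 0).run e s1).arr 8 = s.arr 8 := by
    rw [Cmd.run_arr e (by simp [copyRow, Cmd.warrs]), a1 8 (by simp)]
  set s2 := (copyRow 8 0 5 0).run e s1 with hs2
  obtain ⟨f3, g3⟩ := visit_spec hG (A := 5) (m := m) (by simp) f2.1 (fun x hx => by
    rw [hc2, if_pos ⟨rfl, p1.zero.symm, hx⟩, p1.zero, a1 8 (by simp), hr x hx]) hm
  have a3 : Rep e.N (((visit 5).run e s2).arr 8 0) m := by
    rw [Cmd.run_arr e (visit_warrs 5 (by simp)), a2]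
    exact hr
  set s3 := (visit 5).run e s2 with hs3
  obtain ⟨-, f4, g4⟩ := for_spec (i := 50) (p := when 52 11 0 50
    (.rep 51 (.seq (.load 52 8 0 51) (.seq (.eq 52 52 51) (.cond 52 (.seq (copyRow 8 0 5 0)
      (.seq (.mov 40 51) (.seq (.mov 41 50) (walk 40 5 explore)))) .skip)))))
    (Φ := fun x => x ∈ D → ∀ g < e.N, m g = g → WalkOK (Heavy e.N adj D R) m (R x) g)
    (fun s' => Rep e.N (s'.arr 8 0) m) (by simp) (fun _ _ h => h) (fun x s' hx hr' h50 h' => by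
      refine ⟨?_, ?_⟩
      · rw [Cmd.run_arr e (by
          have := walk_explore_warrs (A := 8) (by simp)
          simp [when, copyRow, Cmd.warrs, this])]
        exact hr'
      have hfr := h'.frozen x hx
      have fS : PStep e adj k D R s' (s'.setReg 52 (s'.arr 11 0 x)) := h'.setReg (by simp)
      by_cases hxD : x ∈ D
      swap
      · have : s'.arr 11 0 x = 0 := by
          by_contra h0
          exact hxD (hfr.1 h0)
        rw [this] at fS
        have hrun : ∀ p, (when 52 11 0 50 p).run e s' = s'.setReg 52 0 := by
          intro p
          simp [when, Cmd.run, h'.zero, hN, h50, hx, this]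
        rw [hrun]
        exact ⟨fS, Or.inr fun h => absurd h hxD⟩
      · have hne := hfr.2 hxD
        have hrun : ∀ p, (when 52 11 0 50 p).run e s' = p.run e (s'.setReg 52 (s'.arr 11 0 x)) := by
          intro p
          simp [when, Cmd.run, h'.zero, hN, h50, hx, hne]
        rw [hrun]
        obtain ⟨-, f5, g5⟩ := for_spec (i := 51) (p := .seq (.load 52 8 0 51)
          (.seq (.eq 52 52 51) (.cond 52 (.seq (copyRow 8 0 5 0)
          (.seq (.mov 40 51) (.seq (.mov 41 50) (walk 40 5 explore)))) .skip)))
          (Φ := fun g => m g = g → WalkOK (Heavy e.N adj D R) m (R x) g)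
          (s := s'.setReg 52 (s'.arr 11 0 x))
          (fun s' => Rep e.N (s'.arr 8 0) m ∧ s'.reg 50 = x) (by simp)
          (fun _ _ h => ⟨h.1, by simpa using h.2⟩) (fun g s'' hg hJ h51 h'' => by
            obtain ⟨s₄, e1, e2⟩ := phaseStep_spec hG hR hm hxD hg h'' hJ.2 h51 hJ.1
            rw [← e1] at e2
            refine ⟨⟨?_, ?_⟩, e2⟩
            · rw [Cmd.run_arr e (by
                have := walk_explore_warrs (A := 8) (by simp)
                simp [copyRow, Cmd.warrs, this])]
              exact hJ.1
            · rw [Cmd.run_reg e (by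
                have := walk_explore_wregs (r := 50) (by simp)
                simp [copyRow, Cmd.wregs, this])]
              exact hJ.2)
          ⟨hr', by simpa using h50⟩ fS.1
        exact ⟨fS.trans f5, g5.imp_right fun h _ => h⟩) a3 f3.1
  have hrun : phase.run e s = (Cmd.rep 50 (when 52 11 0 50
    (.rep 51 (.seq (.load 52 8 0 51) (.seq (.eq 52 52 51) (.cond 52 (.seq (copyRow 8 0 5 0)
      (.seq (.mov 40 51) (.seq (.mov 41 50) (walk 40 5 explore)))) .skip)))))).run e s3 := by
    rw [phase, Cmd.run, ← hs1, Cmd.run, ← hs2, Cmd.run, ← hs3]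
  rw [hrun]
  refine ⟨f4.1.minv, fun d hd hne => (f4.1.known d ⟨hd, hne⟩).1, ?_⟩
  have hprog : ∀ {s'}, Progress e D s' → s'.reg 2 ≠ 0 ∨
      ∃ d < e.N, s.arr 2 0 d = 0 ∧ s'.arr 2 0 d ≠ 0 := by
    rintro s' (h | ⟨d, h1, h2, h3⟩)
    · exact Or.inl h
    · refine Or.inr ⟨d, h1, ?_, h3⟩
      by_contra h4
      exact h2 ⟨h1, h4⟩
  rw [← or_assoc]
  rcases g4 with g4 | g4
  · exact Or.inl (hprog g4)
  rcases g3 with g3 | g3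
  · exact Or.inl (hprog (f4.2 g3))
  refine Or.inr fun k' m' hm' => ?_
  -- Without progress, all requirements of the criterion have been verified.
  have : Stuck e.N adj k D R m := ⟨hR, hm, g3, fun x hx g hg hgg => g4 x hx.1 hx g hg hgg⟩
  exact this.le_card hG hm'

/-! ### The matching program -/

/-- Enlarge the matching in row `0` of array `8`, if possible. -/
def improve : Cmd :=
  .seq (.rep 53 (.store 2 0 53 0)) (.seq (.set 2 0) (.seq (.rep 53 (.cond 2 .skip phase))
    (.seq (.cond 2 .skip phase) (.cond 2 (copyRow 4 0 8 0) .skip))))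

/-- Find a maximum matching. -/
def maxMatching : Cmd := .seq (.rep 54 (.store 8 0 54 54)) (.rep 55 improve)

/-- The number of recorded vertices is the potential: a phase that finds neither a larger matching
nor a proof of maximality increases it. -/
theorem phase_repeat (hG : IsGraph e.N adj) (hm : IsMatch e.N adj k m) {s : St} {j : ℕ}
    (h : MInv e adj k s) (hr : Rep e.N (s.arr 8 0) m)
    (hj : s.reg 2 ≠ 0 ∨ (∀ k' m', IsMatch e.N adj k' m' → k ≤ k') ∨
      j ≤ ((Finset.range e.N).filter fun d => s.arr 2 0 d ≠ 0).card) :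
    MInv e adj k ((Cmd.cond 2 .skip phase).run e s) ∧
      Rep e.N (((Cmd.cond 2 .skip phase).run e s).arr 8 0) m ∧
      (((Cmd.cond 2 .skip phase).run e s).reg 2 ≠ 0 ∨
        (∀ k' m', IsMatch e.N adj k' m' → k ≤ k') ∨
        j + 1 ≤ ((Finset.range e.N).filter fun d =>
          ((Cmd.cond 2 .skip phase).run e s).arr 2 0 d ≠ 0).card) := by
  by_cases h2 : s.reg 2 = 0
  swap
  · have : (Cmd.cond 2 .skip phase).run e s = s := by simp [Cmd.run, h2]
    rw [this]
    exact ⟨h, hr, Or.inl h2⟩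
  have : (Cmd.cond 2 .skip phase).run e s = phase.run e s := by simp [Cmd.run, h2]
  rw [this]
  obtain ⟨a1, a2, a3⟩ := phase_spec hG hm h hr
  refine ⟨a1, ?_, ?_⟩
  · rw [Cmd.run_arr e (phase_warrs (by simp))]
    exact hr
  rcases a3 with a3 | ⟨d, h3, h4, h5⟩ | a3
  · exact Or.inl a3
  · rcases hj with hj | hj | hj
    · exact absurd h2 hj
    · exact Or.inr (Or.inl hj)
    refine Or.inr (Or.inr (lt_of_le_of_lt hj (Finset.card_lt_card ?_)))
    rw [Finset.ssubset_iff_of_subset]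
    · exact ⟨d, by simp [h3, h5], by simp [h4]⟩
    · intro x hx
      simp only [Finset.mem_filter, Finset.mem_range] at hx ⊢
      exact ⟨hx.1, a2 x hx.1 hx.2⟩
  · exact Or.inr (Or.inl a3)

/-- What the matching program needs to know about the memory. -/
structure GInv (e : Env) (adj : ℕ → ℕ → Prop) (s : St) : Prop where
  zero : s.reg 0 = 0
  one : s.reg 1 = 1
  graph : ∀ i < e.N, ∀ j < e.N, s.arr 1 i j ≠ 0 ↔ adj i j

/-- `N + 1` phases are run, one more than there are vertices to record. -/
theorem improve_spec (hG : IsGraph e.N adj) (hm : IsMatch e.N adj k m) {s : St}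
    (hN : 0 < e.N) (h : GInv e adj s) (hr : Rep e.N (s.arr 8 0) m) :
    GInv e adj (improve.run e s) ∧ ∃ k' m', Rep e.N ((improve.run e s).arr 8 0) m' ∧
      IsMatch e.N adj k' m' ∧
      (k' + 2 = k ∨ k' = k ∧ ∀ k' m', IsMatch e.N adj k' m' → k ≤ k') := by
  have hf := fillRow_arr e (A := 2) (i := 53) (j := 0) (r := 0) (by simp) s (by rwa [h.zero])
  have r1 : ∀ r, r ≠ 53 → ((Cmd.rep 53 (.store 2 0 53 0)).run e s).reg r = s.reg r := fun r hr =>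
    Cmd.run_reg e (by simp [Cmd.wregs, hr]) s
  have a1 : ∀ A, A ≠ 2 → ((Cmd.rep 53 (.store 2 0 53 0)).run e s).arr A = s.arr A := fun A hA =>
    Cmd.run_arr e (by simp [Cmd.warrs, hA]) s
  set s1 := (Cmd.rep 53 (.store 2 0 53 0)).run e s with hs1
  have m1 : MInv e adj k (s1.setReg 2 0) := by
    refine ⟨by simp [r1, h.zero], by simp [r1, h.one], ?_, ?_, by simp⟩
    · rw [St.arr_setReg, a1 1 (by simp)]
      exact h.graph
    · intro d hd hne
      rw [St.arr_setReg, hf, if_pos ⟨rfl, h.zero.symm, hd⟩] at hne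
      simp [h.zero] at hne
  have key := iter_induction (n := e.N) (s := s1.setReg 2 0)
    (f := fun j s' => (Cmd.cond 2 .skip phase).run e (s'.setReg 53 j))
    (fun j s' => MInv e adj k s' ∧ Rep e.N (s'.arr 8 0) m ∧ (s'.reg 2 ≠ 0 ∨
      (∀ k' m', IsMatch e.N adj k' m' → k ≤ k') ∨
      j ≤ ((Finset.range e.N).filter fun d => s'.arr 2 0 d ≠ 0).card))
    ⟨m1, by rw [St.arr_setReg, a1 8 (by simp)]; exact hr, Or.inr (Or.inr (Nat.zero_le _))⟩ ?_
  swap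
  · rintro j s' hj ⟨b1, b2, b3⟩
    exact phase_repeat hG hm (s := s'.setReg 53 j) ⟨by simpa using b1.zero, by simpa using b1.one,
      b1.graph, b1.row, by simpa using b1.best⟩ b2 b3
  obtain ⟨b1, b2, b3⟩ := key
  obtain ⟨c1, c2, c3⟩ := phase_repeat hG hm b1 b2 b3
  have hrun : improve.run e s = (Cmd.cond 2 (copyRow 4 0 8 0) .skip).run e
      ((Cmd.cond 2 .skip phase).run e (iter (fun j s' => (Cmd.cond 2 .skip phase).run e
        (s'.setReg 53 j)) e.N (s1.setReg 2 0))) := rfl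
  rw [hrun]
  set s2 := (Cmd.cond 2 .skip phase).run e (iter (fun j s' => (Cmd.cond 2 .skip phase).run e
        (s'.setReg 53 j)) e.N (s1.setReg 2 0)) with hs2
  by_cases h2 : s2.reg 2 = 0
  · have : (Cmd.cond 2 (copyRow 4 0 8 0) .skip).run e s2 = s2 := by simp [Cmd.run, h2]
    rw [this]
    refine ⟨⟨c1.zero, c1.one, c1.graph⟩, k, m, c2, hm, Or.inr ⟨rfl, ?_⟩⟩
    rcases c3 with c3 | c3 | c3
    · exact absurd h2 c3
    · exact c3
    -- The remaining case would mean `N + 1` recorded vertices among `N`.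
    · have := c3.trans (Finset.card_filter_le _ _)
      rw [Finset.card_range] at this
      omega
  · have : (Cmd.cond 2 (copyRow 4 0 8 0) .skip).run e s2 = (copyRow 4 0 8 0).run e s2 := by
      simp [Cmd.run, h2]
    rw [this]
    obtain ⟨k', m', d1, d2, d3⟩ := c1.best h2
    have hc := copyRow_arr e (A := 4) (i := 0) (B := 8) (j := 0) (by simp) (by simp) (by simp) s2
      (by rwa [c1.zero]) (by rwa [c1.zero])
    refine ⟨⟨?_, ?_, ?_⟩, k', m', ?_, d2, Or.inl d1⟩
    · rw [Cmd.run_reg e (by simp [copyRow, Cmd.wregs]), c1.zero]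
    · rw [Cmd.run_reg e (by simp [copyRow, Cmd.wregs]), c1.one]
    · rw [Cmd.run_arr e (by simp [copyRow, Cmd.warrs])]
      exact c1.graph
    · intro x hx
      rw [hc, if_pos ⟨rfl, c1.zero.symm, hx⟩, c1.zero]
      exact d3 x hx

/-- The search starts with the empty matching, which is the identity and exposes all `N` vertices.
Each improvement exposes two fewer, so `N` rounds are more than enough. -/
theorem maxMatching_spec (hG : IsGraph e.N adj) {s : St} (hN : 0 < e.N) (h : GInv e adj s) :
    GInv e adj (maxMatching.run e s) ∧ ∃ k m, Rep e.N ((maxMatching.run e s).arr 8 0) m ∧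
      IsMatch e.N adj k m ∧ ∀ k' m', IsMatch e.N adj k' m' → k ≤ k' := by
  have hf := fillRow_arr e (A := 8) (i := 54) (j := 0) (r := 54) (by simp) s (by rwa [h.zero])
  have r1 : ∀ r, r ≠ 54 → ((Cmd.rep 54 (.store 8 0 54 54)).run e s).reg r = s.reg r := fun r hr =>
    Cmd.run_reg e (by simp [Cmd.wregs, hr]) s
  have a1 : ∀ A, A ≠ 8 → ((Cmd.rep 54 (.store 8 0 54 54)).run e s).arr A = s.arr A := fun A hA =>
    Cmd.run_arr e (by simp [Cmd.warrs, hA]) s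
  set s1 := (Cmd.rep 54 (.store 8 0 54 54)).run e s with hs1
  have g1 : GInv e adj s1 := ⟨by rw [r1 0 (by simp), h.zero], by rw [r1 1 (by simp), h.one], by
    rw [a1 1 (by simp)]; exact h.graph⟩
  have key := iter_induction (n := e.N) (s := s1) (f := fun j s' => improve.run e (s'.setReg 55 j))
    (fun j s' => GInv e adj s' ∧ ∃ k m, Rep e.N (s'.arr 8 0) m ∧ IsMatch e.N adj k m ∧
      ((∀ k' m', IsMatch e.N adj k' m' → k ≤ k') ∨ k + 2 * j ≤ e.N))
    ⟨g1, e.N, id, fun x hx => by rw [hf, if_pos ⟨rfl, h.zero.symm, hx⟩]; simp,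
      ⟨fun _ => rfl, fun h => absurd rfl h, by simp [exposed]⟩, Or.inr (by simp)⟩ ?_
  · obtain ⟨b1, k, m, b2, b3, b4⟩ := key
    exact ⟨b1, k, m, b2, b3, b4.resolve_right (by omega)⟩
  rintro j s' hj ⟨b1, k, m, b2, b3, b4⟩
  obtain ⟨c1, k', m', c2, c3, c4⟩ := improve_spec hG b3 (s := s'.setReg 55 j) hN
    ⟨by simpa using b1.zero, by simpa using b1.one, b1.graph⟩ b2
  refine ⟨c1, k', m', c2, c3, ?_⟩
  rcases c4 with c4 | ⟨rfl, c4⟩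
  · rcases b4 with b4 | b4
    · have := b4 k' m' c3
      omega
    · exact Or.inr (by omega)
  · exact Or.inl c4

end CapDom

/-! ### Reduction of capacitated domination to matching, and the ratio 5/3. -/

namespace CapDom

/-! ### Capacitated domination and matchings

For a set `U` of vertices of `G`, let a vertex `v` of `U` have `min (c v) n` copies, and any other
vertex one copy. Two copies are joined if their owners are adjacent, are not both in `U`, and are
not both outside `U` with capacity `0`. Copy `j` of `v` has the number `v * n + j`. -/

/-- Adjacency on the numbers of the vertices. -/
def gadj {n : ℕ} (G : SimpleGraph (Fin n)) (u v : ℕ) : Prop :=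
  ∃ (hu : u < n) (hv : v < n), G.Adj ⟨u, hu⟩ ⟨v, hv⟩

/-- The capacity of the vertex with a given number. -/
def gcap {n : ℕ} (c : Fin n → ℕ) (v : ℕ) : ℕ := if h : v < n then c ⟨v, h⟩ else 0

/-- The number `i` is that of a copy. -/
def IsCopy {n : ℕ} (c : Fin n → ℕ) (U : Set ℕ) (i : ℕ) : Prop :=
  (i / n ∈ U → i % n < gcap c (i / n)) ∧ (i / n ∉ U → i % n = 0)

/-- The adjacency relation of copies. -/
def copyAdj {n : ℕ} (G : SimpleGraph (Fin n)) (c : Fin n → ℕ) (U : Set ℕ) (i j : ℕ) : Prop :=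
  IsCopy c U i ∧ IsCopy c U j ∧ gadj G (i / n) (j / n) ∧ ¬ (i / n ∈ U ∧ j / n ∈ U) ∧
    (i / n ∉ U → j / n ∉ U → gcap c (i / n) ≠ 0 ∨ gcap c (j / n) ≠ 0)

/-- If a copy of `v` is matched to a copy of `w`, then `v` is dominated by `w`. -/
def DomBy {n : ℕ} (c : Fin n → ℕ) (U : Set ℕ) (v w : ℕ) : Prop :=
  v ∉ U ∧ (w ∈ U ∨ gcap c w ≠ 0 ∧ (gcap c v = 0 ∨ w < v))

/-- The vertex `v` is dominated according to the matching `m`. -/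
def Dominated {n : ℕ} (c : Fin n → ℕ) (U : Set ℕ) (m : ℕ → ℕ) (v : ℕ) : Prop :=
  m (v * n) ≠ v * n ∧ DomBy c U v (m (v * n) / n)

variable {n : ℕ} {G : SimpleGraph (Fin n)} {c : Fin n → ℕ} {U : Set ℕ} {m : ℕ → ℕ} {k : ℕ}

theorem gadj.symm {u v : ℕ} (h : gadj G u v) : gadj G v u := by
  obtain ⟨hu, hv, h⟩ := h
  exact ⟨hv, hu, h.symm⟩

theorem gadj.ne {u v : ℕ} (h : gadj G u v) : u ≠ v := by
  rintro rfl
  obtain ⟨hu, hv, h⟩ := h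
  exact G.loopless.irrefl _ h

theorem copyAdj.symm {i j : ℕ} (h : copyAdj G c U i j) : copyAdj G c U j i :=
  ⟨h.2.1, h.1, h.2.2.1.symm, fun h' => h.2.2.2.1 ⟨h'.2, h'.1⟩, fun a b => (h.2.2.2.2 b a).symm⟩

theorem isGraph_copyAdj : IsGraph (n * n) (copyAdj G c U) where
  symm := copyAdj.symm
  irrefl h := h.2.2.1.ne rfl
  lt h := by
    obtain ⟨-, -, ⟨hu, -, -⟩, -⟩ := h
    exact (Nat.div_lt_iff_lt_mul (Nat.pos_of_ne_zero fun h => by simp [h] at hu)).1 hu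

/-- Of two joined copies, exactly one belongs to a vertex that is dominated by the other. -/
theorem copyAdj.domBy {i j : ℕ} (h : copyAdj G c U i j) :
    ¬ DomBy c U (i / n) (j / n) ↔ DomBy c U (j / n) (i / n) := by
  obtain ⟨-, -, h1, h2, h3⟩ := h
  have hne := h1.ne
  unfold DomBy
  by_cases hi : i / n ∈ U
  · have hj : j / n ∉ U := fun hj => h2 ⟨hi, hj⟩
    simp [hi, hj]
  · by_cases hj : j / n ∈ U
    · simp [hi, hj]
    · simp only [hi, hj, not_false_eq_true, true_and, false_or]
      have := h3 hi hj
      omega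

theorem copyAdj.eq_mul {i j : ℕ} (h : copyAdj G c U i j) (hi : i / n ∉ U) : i / n * n = i := by
  have := h.1.2 hi
  have h1 := Nat.div_add_mod i n
  rw [this, mul_comm] at h1
  exact h1

-- Every matched edge has exactly one end whose owner is dominated through it. Such an owner is
-- outside `U`, so this end is its only copy, and matched edges correspond to dominated vertices.
open Classical in
theorem card_dominated (hm : IsMatch (n * n) (copyAdj G c U) k m) :
    k + 2 * ((Finset.range n).filter (Dominated c U m)).card = n * n := by
  have hG : IsGraph (n * n) (copyAdj G c U) := isGraph_copyAdj
  set A := ((Finset.range n).filter (Dominated c U m)).image (· * n) with hA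
  have hAc : A.card = ((Finset.range n).filter (Dominated c U m)).card := by
    refine Finset.card_image_of_injOn fun u hu v hv h => ?_
    simp only [Finset.coe_filter, Finset.mem_range, Set.mem_ofPred_eq] at hu
    exact Nat.eq_of_mul_eq_mul_right (by omega) h
  have hmem : ∀ i, i ∈ A ↔ m i ≠ i ∧ DomBy c U (i / n) (m i / n) := by
    intro i
    simp only [hA, Finset.mem_image, Finset.mem_filter, Finset.mem_range, Dominated]
    constructor
    · rintro ⟨v, ⟨hv, h1, h2⟩, rfl⟩
      have : v * n / n = v := Nat.mul_div_cancel _ (by omega)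
      rw [this]
      exact ⟨h1, h2⟩
    · rintro ⟨h1, h2⟩
      have ha := hm.adj h1
      obtain ⟨h3, -, -⟩ := ha.2.2.1
      refine ⟨i / n, ⟨h3, ?_⟩, ha.eq_mul h2.1⟩
      rw [ha.eq_mul h2.1]
      exact ⟨h1, h2⟩
  have hlt : ∀ i, m i ≠ i → i < n * n := fun i hi => hG.lt (hm.adj hi)
  have hunion : Finset.range (n * n) = exposed (n * n) m ∪ (A ∪ A.image m) := by
    ext i
    simp only [Finset.mem_range, Finset.mem_union, mem_exposed, Finset.mem_image]
    constructor
    · intro hi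
      by_cases h1 : m i = i
      · exact Or.inl ⟨hi, h1⟩
      by_cases h2 : DomBy c U (i / n) (m i / n)
      · exact Or.inr (Or.inl ((hmem i).2 ⟨h1, h2⟩))
      · refine Or.inr (Or.inr ⟨m i, (hmem _).2 ?_, hm.inv i⟩)
        rw [hm.inv]
        exact ⟨Ne.symm h1, ((hm.adj h1).domBy).1 h2⟩
    · rintro (h | h | ⟨a, h, rfl⟩)
      · exact h.1
      · exact hlt i ((hmem i).1 h).1
      · exact hm.lt hG (hlt a ((hmem a).1 h).1)
  have hd2 : Disjoint A (A.image m) := by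
    rw [Finset.disjoint_left]
    intro i hi hi'
    obtain ⟨a, ha, rfl⟩ := Finset.mem_image.1 hi'
    have h1 := (hmem _).1 hi
    have h2 := (hmem _).1 ha
    rw [hm.inv] at h1
    exact ((hm.adj h2.1).domBy).2 h1.2 h2.2
  have hd1 : Disjoint (exposed (n * n) m) (A ∪ A.image m) := by
    rw [Finset.disjoint_left]
    intro i hi hi'
    rw [mem_exposed] at hi
    rcases Finset.mem_union.1 hi' with h | h
    · exact ((hmem i).1 h).1 hi.2
    · obtain ⟨a, ha, rfl⟩ := Finset.mem_image.1 h
      have := hi.2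
      rw [hm.inv] at this
      exact ((hmem a).1 ha).1 this.symm
  have := congrArg Finset.card hunion
  rw [Finset.card_range, Finset.card_union_of_disjoint hd1, Finset.card_union_of_disjoint hd2,
    Finset.card_image_of_injOn (fun a _ b _ h => hm.inj h), hm.card, hAc] at this
  omega

/-- Each dominated vertex is assigned to the owner of its partner. Distinct vertices use distinct
copies of the same owner, and the indices of its copies are below its capacity: outside `U` there is
only the index `0`, and an owner that dominates has nonzero capacity. -/
theorem isCapDomSet_of_isMatch (hm : IsMatch (n * n) (copyAdj G c U) k m) (S : Finset (Fin n))
    (hS : ∀ v : Fin n, v ∈ S ↔ ¬ Dominated c U m v) : IsCapDomSet G c S := by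
  classical
  have hn : ∀ v : Fin n, (v : ℕ) * n / n = v := fun v => Nat.mul_div_cancel _ v.pos
  have hf : ∀ v : Fin n, ∃ w : Fin n, Dominated c U m v → (w : ℕ) = m (v * n) / n := by
    intro v
    by_cases h : Dominated c U m v
    · obtain ⟨-, h1, -⟩ := (hm.adj h.1).2.2.1
      exact ⟨⟨_, h1⟩, fun _ => rfl⟩
    · exact ⟨v, fun h' => absurd h' h⟩
  choose f hf using hf
  have hval : ∀ v, v ∉ S → Dominated c U m v := fun v hv => not_not.1 (fun h => hv ((hS v).2 h))
  refine ⟨f, fun v hv => ?_, fun w hw => ?_⟩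
  · have hd := hval v hv
    have ha := hm.adj hd.1
    have hfv := hf v hd
    refine ⟨?_, ?_⟩
    · rw [hS]
      intro hd'
      -- If the dominating vertex were dominated too, it would be outside `U` and have a single
      -- copy. The same edge would then be oriented both ways.
      have h1 : m (v * n) = f v * n := by
        rw [hfv, ha.symm.eq_mul (by rw [← hfv]; exact hd'.2.1)]
      have h2 := hd'.2
      have h3 := hd.2
      rw [← h1, hm.inv, hn, hfv] at h2
      have := ha.domBy.2
      rw [hn] at this
      exact this h2 h3
    · obtain ⟨h1, h2, h3⟩ := ha.2.2.1
      have e1 : (⟨v * n / n, h1⟩ : Fin n) = v := Fin.ext (hn v)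
      have e2 : (⟨m (v * n) / n, h2⟩ : Fin n) = f v := Fin.ext hfv.symm
      rwa [e1, e2] at h3
  · have hset : {v | v ∉ S ∧ f v = w} = ((Finset.univ.filter fun v => v ∉ S ∧ f v = w :
        Finset (Fin n)) : Set (Fin n)) := by
      ext v
      simp
    rw [hset, Set.encard_coe_eq_coe_finsetCard]
    have hcw : gcap c w = c w := by simp [gcap]
    have key : ∀ v, v ∉ S ∧ f v = w → m (v * n) / n = w ∧ m (v * n) % n < c w := by
      rintro v ⟨hv, rfl⟩
      have hd := hval v hv
      have ha := hm.adj hd.1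
      have hfv := hf v hd
      refine ⟨hfv.symm, ?_⟩
      obtain ⟨h1, h2⟩ := ha.2.1
      rw [← hfv, hcw] at h1
      rw [← hfv] at h2
      by_cases hU : (f v : ℕ) ∈ U
      · exact h1 hU
      · rw [h2 hU, ← hcw]
        have := hd.2.2
        rw [← hfv] at this
        exact Nat.pos_of_ne_zero (this.resolve_left hU).1
    have := Finset.card_le_card_of_injOn (s := Finset.univ.filter fun v => v ∉ S ∧ f v = w)
      (t := Finset.range (c w)) (fun v : Fin n => m (v * n) % n)
      (fun v hv => by simpa using (key v (by simpa using hv)).2)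
      (fun u hu v hv h => by
        have h1 := key u (by simpa using hu)
        have h2 := key v (by simpa using hv)
        have h3 : m (u * n) = m (v * n) := by
          rw [← Nat.div_add_mod (m (u * n)) n, ← Nat.div_add_mod (m (v * n)) n, h1.1, h2.1]
          exact congrArg _ h
        have h4 := congrArg (· / n) (hm.inj h3)
        simp only [hn] at h4
        exact Fin.ext h4)
    rw [Finset.card_range] at this
    exact_mod_cast this

end CapDom

namespace CapDom

/-! ### The approximation guarantee -/

/-- An injective assignment of partners defines a matching. -/
theorem exists_isMatch {N : ℕ} {adj : ℕ → ℕ → Prop} (hG : IsGraph N adj) (A : Finset ℕ) (h : ℕ → ℕ)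
    (hadj : ∀ a ∈ A, adj a (h a)) (hinj : Set.InjOn h A) (hdisj : ∀ a ∈ A, h a ∉ A) :
    ∃ k m, IsMatch N adj k m ∧ k + 2 * A.card = N := by
  classical
  have hex : ∀ x, ∃ a, x ∈ A.image h → a ∈ A ∧ h a = x := by
    intro x
    by_cases hx : x ∈ A.image h
    · obtain ⟨a, ha, rfl⟩ := Finset.mem_image.1 hx
      exact ⟨a, fun _ => ⟨ha, rfl⟩⟩
    · exact ⟨0, fun h => absurd h hx⟩
  choose g hg using hex
  set m : ℕ → ℕ := fun x => if x ∈ A then h x else if x ∈ A.image h then g x else x with hm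
  have mA : ∀ a ∈ A, m a = h a := fun a ha => by simp only [hm, if_pos ha]
  have mh : ∀ a ∈ A, m (h a) = a := by
    intro a ha
    have hi : h a ∈ A.image h := Finset.mem_image_of_mem h ha
    simp only [hm, if_neg (hdisj a ha), if_pos hi]
    exact hinj (hg _ hi).1 ha (hg _ hi).2
  have mo : ∀ x, x ∉ A → x ∉ A.image h → m x = x := fun x h1 h2 => by
    simp only [hm, if_neg h1, if_neg h2]
  have hne : ∀ a ∈ A, h a ≠ a := fun a ha h' => by
    have := hadj a ha
    rw [h'] at this
    exact hG.irrefl this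
  refine ⟨(exposed N m).card, m, ⟨fun v => ?_, fun {v} hv => ?_, rfl⟩, ?_⟩
  · by_cases h1 : v ∈ A
    · rw [mA v h1, mh v h1]
    by_cases h2 : v ∈ A.image h
    · obtain ⟨a, ha, rfl⟩ := Finset.mem_image.1 h2
      rw [mh a ha, mA a ha]
    · rw [mo v h1 h2, mo v h1 h2]
  · by_cases h1 : v ∈ A
    · rw [mA v h1]
      exact hadj v h1
    by_cases h2 : v ∈ A.image h
    · obtain ⟨a, ha, rfl⟩ := Finset.mem_image.1 h2
      rw [mh a ha]
      exact hG.symm (hadj a ha)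
    · exact absurd (mo v h1 h2) hv
  · have hE : exposed N m = Finset.range N \ (A ∪ A.image h) := by
      ext x
      simp only [mem_exposed, Finset.mem_sdiff, Finset.mem_range, Finset.mem_union]
      refine and_congr_right fun _ => ⟨?_, fun hx => ?_⟩
      · rintro h1 (h2 | h2)
        · exact hne x h2 (by rw [← mA x h2, h1])
        · obtain ⟨a, ha, rfl⟩ := Finset.mem_image.1 h2
          rw [mh a ha] at h1
          exact hne a ha h1.symm
      · rw [not_or] at hx
        exact mo x hx.1 hx.2
    have hsub : A ∪ A.image h ⊆ Finset.range N := by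
      intro x hx
      rw [Finset.mem_range]
      rcases Finset.mem_union.1 hx with hx | hx
      · exact hG.lt (hadj x hx)
      · obtain ⟨a, ha, rfl⟩ := Finset.mem_image.1 hx
        exact hG.lt (hG.symm (hadj a ha))
    have hd : Disjoint A (A.image h) := by
      rw [Finset.disjoint_left]
      intro x hx hx'
      obtain ⟨a, ha, rfl⟩ := Finset.mem_image.1 hx'
      exact hdisj a ha hx
    have h1 := Finset.card_sdiff_add_card_eq_card hsub
    rw [← hE, Finset.card_union_of_disjoint hd, Finset.card_image_of_injOn hinj,
      Finset.card_range] at h1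
    omega

/-- The elements with the largest values. -/
theorem exists_top {α : Type*} [DecidableEq α] (S : Finset α) (d : α → ℕ) (j : ℕ)
    (hj : j ≤ S.card) : ∃ U ⊆ S, U.card = j ∧ ∀ u ∈ U, ∀ w ∈ S \ U, d w ≤ d u := by
  induction j with
  | zero => exact ⟨∅, by simp⟩
  | succ j ih =>
    obtain ⟨U, h1, h2, h3⟩ := ih (by omega)
    have hne : (S \ U).Nonempty := by
      rw [← Finset.card_pos, Finset.card_sdiff_of_subset h1]
      omega
    obtain ⟨x, hx, hmax⟩ := Finset.exists_max_image (S \ U) d hne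
    rw [Finset.mem_sdiff] at hx
    refine ⟨insert x U, Finset.insert_subset hx.1 h1, by
      rw [Finset.card_insert_of_notMem hx.2, h2], fun u hu w hw => ?_⟩
    simp only [Finset.mem_sdiff, Finset.mem_insert, not_or] at hw
    have hw' : w ∈ S \ U := Finset.mem_sdiff.2 ⟨hw.1, hw.2.2⟩
    rcases Finset.mem_insert.1 hu with rfl | hu
    exacts [hmax w hw', h3 u hu w hw']

/-- If the `⌈n / 6⌉` largest of numbers with sum `n - s` are removed, then the others exceed `1` by
no more than `2 s / 3` in total. -/
theorem exists_few_excess {α : Type*} [DecidableEq α] (S : Finset α) (d : α → ℕ) (n : ℕ)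
    (hn : S.card + ∑ w ∈ S, d w = n) :
    ∃ U ⊆ S, U.card ≤ (n + 5) / 6 ∧ 3 * ∑ w ∈ S \ U, (d w - 1) ≤ 2 * S.card := by
  obtain ⟨U, h1, h2, h3⟩ := exists_top S d (min ((n + 5) / 6) S.card) (min_le_right _ _)
  refine ⟨U, h1, by omega, ?_⟩
  rcases (S \ U).eq_empty_or_nonempty with hE | hne
  · simp [hE]
  obtain ⟨x, hx, hmax⟩ := Finset.exists_max_image (S \ U) d hne
  set t := d x with ht
  have hcard := Finset.card_sdiff_of_subset h1
  have hpos := hne.card_pos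
  set M := (n + 5) / 6 with hM
  have hU : U.card = M := by omega
  set X := ∑ w ∈ S \ U, d w with hX
  set L := ∑ w ∈ S \ U, (d w - 1) with hL
  have hsum : X + ∑ w ∈ U, d w = ∑ w ∈ S, d w := Finset.sum_sdiff h1
  have hbig : M * t ≤ ∑ w ∈ U, d w := by
    rw [← hU, ← smul_eq_mul]
    exact Finset.card_nsmul_le_sum _ _ _ fun u hu => h3 u hu x hx
  have hXle : X ≤ (S.card - M) * t := by
    rw [← hU, ← hcard, ← smul_eq_mul]
    exact Finset.sum_le_card_nsmul _ _ _ hmax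
  have hLX : t * L ≤ (t - 1) * X := by
    rw [hL, hX, Finset.mul_sum, Finset.mul_sum]
    refine Finset.sum_le_sum fun w hw => ?_
    have hw' := hmax w hw
    rcases Nat.eq_zero_or_pos (d w) with h0 | h0
    · simp [h0]
    obtain ⟨y, hy⟩ := Nat.exists_eq_add_of_le' h0
    obtain ⟨z, hz⟩ := Nat.exists_eq_add_of_le' (h0.trans_le hw')
    have hz' : t = z + 1 := hz
    rw [hy, hz']
    simp only [Nat.add_sub_cancel]
    nlinarith
  have hM6 : n ≤ 6 * M := by omega
  have hSM : M < S.card := by omega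
  obtain ⟨r, hr⟩ := Nat.exists_eq_add_of_lt hSM
  have hr' : S.card - M = r + 1 := by omega
  rw [hr'] at hXle
  -- For `t ≥ 6` the removed numbers alone would add up to at least `6M ≥ n`, although the total is
  -- `n - |S| < n`.
  by_cases ht6 : 6 ≤ t
  · have := Nat.mul_le_mul_left M ht6
    omega
  -- With `s = |S|` there are two bounds for `X`, namely `(6 - t) M - s` and `t (s - M)`. Weighted
  -- with `t` and `6 - t`, they give `6 X ≤ t (5 - t) s`, and hence `6 L ≤ (t - 1)(5 - t) s ≤ 4 s`
  -- when `t > 0`. The extreme value is `t = 3`, which explains the constant `2/3`.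
  · have : t = 0 ∨ t = 1 ∨ t = 2 ∨ t = 3 ∨ t = 4 ∨ t = 5 := by omega
    rcases this with h | h | h | h | h | h
    · have : L = 0 := Finset.sum_eq_zero fun w hw => by have := hmax w hw; omega
      omega
    all_goals
      rw [h] at hbig hXle hLX
      simp only [Nat.reduceSub] at hLX
      omega

variable {n : ℕ} {G : SimpleGraph (Fin n)} {c : Fin n → ℕ}

/-- For some small set `U`, some matching of the copies is as good as claimed. -/
theorem exists_good_matching (G : SimpleGraph (Fin n)) (c : Fin n → ℕ) :
    ∃ U : Finset (Fin n), U.card ≤ (n + 5) / 6 ∧ ∃ k m,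
      IsMatch (n * n) (copyAdj G c {v | ∃ u ∈ U, (u : ℕ) = v}) k m ∧ ∃ a, k + 2 * a = n * n ∧
        3 * n ≤ 5 * capDomNumber G c + 3 * a := by
  classical
  obtain ⟨S, ⟨f, hf1, hf2⟩, hS⟩ := Nat.sInf_mem (s := {k | ∃ S : Finset (Fin n),
    IsCapDomSet G c S ∧ S.card = k}) ⟨_, Finset.univ, isCapDomSet_univ G c, rfl⟩
  change S.card = capDomNumber G c at hS
  rw [← hS]
  set F : Fin n → Finset (Fin n) := fun w => Finset.univ.filter fun v => v ∉ S ∧ f v = w with hF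
  have hFc : ∀ w ∈ S, (F w).card ≤ c w := by
    intro w hw
    have := hf2 w hw
    have hset : {v | v ∉ S ∧ f v = w} = ((F w : Finset (Fin n)) : Set (Fin n)) := by
      ext v
      simp [hF]
    rw [hset, Set.encard_coe_eq_coe_finsetCard] at this
    exact_mod_cast this
  have hsum : S.card + ∑ w ∈ S, (F w).card = n := by
    have h1 : (Finset.univ \ S).card = ∑ w ∈ S, (F w).card := by
      rw [Finset.card_eq_sum_card_fiberwise (f := f) (t := S)]
      · refine Finset.sum_congr rfl fun w _ => congrArg _ ?_
        ext v
        simp [hF]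
      · intro v hv
        simp only [Finset.coe_sdiff, Finset.coe_univ, Set.mem_sdiff, Set.mem_univ, true_and,
          Finset.mem_coe] at hv
        exact (hf1 v hv).1
    have h2 := Finset.card_sdiff_add_card_eq_card (Finset.subset_univ S)
    rw [Finset.card_univ, Fintype.card_fin] at h2
    omega
  obtain ⟨U, hUS, hUc, hex⟩ := exists_few_excess S (fun w => (F w).card) n hsum
  -- The rank of `v` among the vertices dominated by `f v` is the index of the copy of `f v` to
  -- which `v` is matched; it is below the capacity.
  set rk : Fin n → ℕ := fun v => ((F (f v)).filter fun v' => v' < v).card with hrk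
  -- A vertex outside `U` has one copy and can serve only the first element of its fibre.
  set A : Finset (Fin n) := Finset.univ.filter fun v => v ∉ S ∧ (f v ∈ U ∨ rk v = 0) with hA
  have hself : ∀ v, v ∉ S → v ∈ F (f v) := fun v hv => by simp [hF, hv]
  have hrkF : ∀ v, v ∉ S → rk v < (F (f v)).card := fun v hv =>
    Finset.card_lt_card (Finset.filter_ssubset.2 ⟨v, hself v hv, lt_irrefl v⟩)
  have hrkn : ∀ v, v ∉ S → rk v < n := fun v hv =>
    (hrkF v hv).trans_le ((Finset.card_le_univ _).trans_eq (Fintype.card_fin n))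
  have hrkinj : ∀ u v, u ∉ S → v ∉ S → f u = f v → rk u = rk v → u = v := by
    have : ∀ u v, u ∉ S → f u = f v → u < v → rk u < rk v := by
      intro u v hu huv hlt
      refine Finset.card_lt_card ?_
      rw [Finset.ssubset_iff_of_subset]
      · exact ⟨u, by simp [← huv, hself u hu, hlt], by simp⟩
      · intro x hx
        simp only [Finset.mem_filter, huv] at hx ⊢
        exact ⟨hx.1, hx.2.trans hlt⟩
    intro u v hu hv huv h
    rcases lt_trichotomy u v with h1 | h1 | h1
    · exact absurd h (this u v hu huv h1).ne
    · exact h1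
    · exact absurd h (this v u hv huv.symm h1).ne'
  refine ⟨U, hUc, ?_⟩
  set V : Set ℕ := {v | ∃ u ∈ U, (u : ℕ) = v} with hV
  have hVm : ∀ v : Fin n, (v : ℕ) ∈ V ↔ v ∈ U := by
    intro v
    constructor
    · rintro ⟨u, hu, h⟩
      rwa [← Fin.ext h]
    · exact fun h => ⟨v, h, rfl⟩
  have hcap : ∀ v : Fin n, gcap c v = c v := fun v => by simp [gcap]
  have hn : ∀ v : Fin n, (v : ℕ) * n / n = v := fun v => Nat.mul_div_cancel _ v.pos
  have hdm : ∀ (w : Fin n) r, r < n → (w * n + r) / n = w ∧ (w * n + r) % n = r := by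
    intro w r hr
    have hpos := w.pos
    refine ⟨?_, ?_⟩
    · rw [mul_comm, Nat.mul_add_div hpos, Nat.div_eq_of_lt hr, add_zero]
    · rw [mul_comm, Nat.mul_add_mod, Nat.mod_eq_of_lt hr]
  set g : ℕ → ℕ := fun i => if h : i / n < n then f ⟨i / n, h⟩ * n + rk ⟨i / n, h⟩ else 0 with hg
  have hgv : ∀ v : Fin n, g (v * n) = f v * n + rk v := by
    intro v
    have : (v : ℕ) * n / n < n := by rw [hn]; exact v.2
    simp only [hg, dif_pos this]
    have e : (⟨v * n / n, this⟩ : Fin n) = v := Fin.ext (hn v)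
    rw [e]
  have key := exists_isMatch (isGraph_copyAdj (G := G) (c := c) (U := V))
    (A.image fun v : Fin n => (v : ℕ) * n) g ?_ ?_ ?_
  · obtain ⟨k, m, h1, h2⟩ := key
    refine ⟨k, m, h1, _, h2, ?_⟩
    rw [Finset.card_image_of_injOn (fun u _ v _ h => Fin.ext (by
      have := congrArg (· / n) h
      simpa [hn] using this))]
    -- A fibre over `U` lies in `A` entirely, and every other nonempty fibre contributes its least
    -- element. With `exists_few_excess` this gives `n - |A| ≤ |S| + 2|S|/3`.
    have hAc : ∑ w ∈ S, (F w).card ≤ A.card + ∑ w ∈ S \ U, ((F w).card - 1) := by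
      have h3 : A.card = ∑ w ∈ S, (A.filter fun v => f v = w).card :=
        Finset.card_eq_sum_card_fiberwise fun v hv => (hf1 v (by
          have : v ∈ A := hv
          simp only [hA, Finset.mem_filter] at this
          exact this.2.1)).1
      rw [h3, ← Finset.sum_sdiff hUS, ← Finset.sum_sdiff (f := fun w =>
        (A.filter fun v => f v = w).card) hUS, add_right_comm, ← Finset.sum_add_distrib]
      refine add_le_add (Finset.sum_le_sum fun w hw => ?_) (Finset.sum_le_sum fun w hw => ?_)
      · rcases Nat.eq_zero_or_pos (F w).card with h0 | h0
        · omega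
        obtain ⟨v, hv⟩ := Finset.card_pos.1 h0
        obtain ⟨v, hv, hmin⟩ := Finset.exists_min_image (F w) id ⟨v, hv⟩
        have hv' := hv
        simp only [hF, Finset.mem_filter, Finset.mem_univ, true_and] at hv'
        have : v ∈ A.filter fun v => f v = w := by
          simp only [hA, Finset.mem_filter, Finset.mem_univ, true_and]
          refine ⟨⟨hv'.1, Or.inr ?_⟩, hv'.2⟩
          rw [hrk, Finset.card_eq_zero, Finset.filter_eq_empty_iff]
          intro x hx
          rw [hv'.2] at hx
          exact not_lt.2 (hmin x hx)
        have := Finset.card_pos.2 ⟨v, this⟩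
        omega
      · refine Finset.card_le_card fun v hv => ?_
        simp only [hF, hA, Finset.mem_filter, Finset.mem_univ, true_and] at hv ⊢
        exact ⟨⟨hv.1, Or.inl (hv.2 ▸ hw)⟩, hv.2⟩
    omega
  · intro a ha
    obtain ⟨v, hv, rfl⟩ := Finset.mem_image.1 ha
    simp only [hA, Finset.mem_filter, Finset.mem_univ, true_and] at hv
    obtain ⟨e1, e2⟩ := hdm (f v) (rk v) (hrkn v hv.1)
    obtain ⟨hfS, hvf⟩ := hf1 v hv.1
    have hvU : v ∉ U := fun h => hv.1 (hUS h)
    have hc : rk v < c (f v) := (hrkF v hv.1).trans_le (hFc _ hfS)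
    rw [hgv]
    refine ⟨⟨?_, ?_⟩, ⟨?_, ?_⟩, ?_, ?_, ?_⟩
    · rw [hn, hVm]
      exact fun h => absurd h hvU
    · intro _
      exact Nat.mul_mod_left _ _
    · rw [e1, e2, hcap]
      exact fun _ => hc
    · rw [e1, e2, hVm]
      exact fun h => hv.2.resolve_left h
    · rw [e1, hn]
      exact ⟨v.2, (f v).2, hvf⟩
    · rw [hn, hVm]
      exact fun h => hvU h.1
    · rw [e1, hcap]
      exact fun _ _ => Or.inr (by omega)
  · intro a ha b hb hab
    obtain ⟨u, hu, rfl⟩ := Finset.mem_image.1 ha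
    obtain ⟨v, hv, rfl⟩ := Finset.mem_image.1 hb
    simp only [hA, Finset.mem_filter, Finset.mem_univ, true_and] at hu hv
    rw [hgv, hgv] at hab
    have h1 := hdm (f u) (rk u) (hrkn u hu.1)
    have h2 := hdm (f v) (rk v) (hrkn v hv.1)
    rw [hab, h2.1, h2.2] at h1
    rw [hrkinj u v hu.1 hv.1 (Fin.ext h1.1.symm) h1.2.symm]
  · intro a ha hg'
    obtain ⟨v, hv, rfl⟩ := Finset.mem_image.1 ha
    obtain ⟨w, hw, hwv⟩ := Finset.mem_image.1 hg'
    simp only [hA, Finset.mem_filter, Finset.mem_univ, true_and] at hv hw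
    rw [hgv] at hwv
    have h1 := (hdm (f v) (rk v) (hrkn v hv.1)).1
    rw [← hwv, hn] at h1
    exact hw.1 (Fin.ext h1 ▸ (hf1 v hv.1).1)

end CapDom

/-! ### Commands that compute tables and the graph of copies. -/

namespace CapDom

variable {e : Env}

/-! ### Computing tables -/

theorem maxMatching_wregs {r : ℕ} (hr : 56 ≤ r) : r ∉ maxMatching.wregs := by
  have h1 := visit_wregs 5 (r := r) (by omega)
  have h2 := walk_explore_wregs (r := r) (by omega)
  simp [maxMatching, improve, phase, when, copyRow, Cmd.wregs, h1, h2]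
  omega

theorem maxMatching_warrs {A : ℕ} (hA : A = 0 ∨ 12 ≤ A) : A ∉ maxMatching.warrs := by
  have := phase_warrs (A := A) (by simp; omega)
  simp [maxMatching, improve, copyRow, Cmd.warrs, this]
  omega

/-- The command for one cell writes no arrays, so what it reads outside array `A` is as it was at
the start; its own work registers may hold anything from earlier rounds. -/
theorem tabulate_row (e : Env) {A z i r : ℕ} {p : Cmd} (F : ℕ → ℕ) (s : St) (hp : p.warrs = [])
    (hz : z ∉ i :: p.wregs) (hi : i ∉ p.wregs) (hz' : s.reg z < e.N)
    (hrun : ∀ s' a, a < e.N → (∀ x, x ∉ i :: p.wregs → s'.reg x = s.reg x) →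
      (∀ B, B ≠ A → s'.arr B = s.arr B) → s'.reg i = a → (p.run e s').reg r = F a) :
    ∀ a < e.N, ((Cmd.rep i (.seq p (.store A z i r))).run e s).arr A (s.reg z) a = F a := by
  refine (iter_induction (n := e.N) (s := s) (f := fun j s' =>
    (Cmd.seq p (.store A z i r)).run e (s'.setReg i j)) (fun j s' =>
      ((∀ x, x ∉ i :: p.wregs → s'.reg x = s.reg x) ∧ (∀ B, B ≠ A → s'.arr B = s.arr B)) ∧
        ∀ a < j, s'.arr A (s.reg z) a = F a)
    ⟨⟨fun _ _ => rfl, fun _ _ => rfl⟩, by simp⟩ ?_).2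
  rintro j s' hj ⟨⟨h1, h2⟩, h3⟩
  have h4 : ∀ x, x ∉ i :: p.wregs → (p.run e (s'.setReg i j)).reg x = s.reg x := by
    intro x hx
    rw [List.mem_cons, not_or] at hx
    rw [Cmd.run_reg e hx.2, St.reg_setReg, if_neg hx.1, h1 x (by simp [hx])]
  have h5 : ∀ B, (p.run e (s'.setReg i j)).arr B = s'.arr B := fun B => by
    rw [Cmd.run_arr e (by simp [hp])]
    rfl
  have h6 : (p.run e (s'.setReg i j)).reg i = j := by
    rw [Cmd.run_reg e hi]
    simp
  have h7 := hrun (s'.setReg i j) j hj (fun x hx => by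
    rw [List.mem_cons, not_or] at hx
    rw [St.reg_setReg, if_neg hx.1, h1 x (by simp [hx])]) h2 (by simp)
  have h8 : (Cmd.seq p (.store A z i r)).run e (s'.setReg i j) =
      (p.run e (s'.setReg i j)).setArr A (s.reg z) j (F j) := by
    simp [Cmd.run, h4 z hz, h6, hj, hz', h7]
  rw [h8]
  refine ⟨⟨h4, fun B hB => ?_⟩, fun a ha => ?_⟩
  · funext x y
    rw [St.arr_setArr, if_neg (by simp [hB]), h5, h2 B hB]
  · rw [St.arr_setArr, h5]
    by_cases haj : a = j
    · simp [haj]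
    · rw [if_neg (by simp [haj]), h3 a (by omega)]

theorem tabulate (e : Env) {A i j r : ℕ} {p : Cmd} (F : ℕ → ℕ → ℕ) (s : St) (hp : p.warrs = [])
    (hij : i ≠ j) (hi : i ∉ p.wregs) (hj : j ∉ p.wregs)
    (hrun : ∀ s' a b, a < e.N → b < e.N → (∀ x, x ∉ i :: j :: p.wregs → s'.reg x = s.reg x) →
      (∀ B, B ≠ A → s'.arr B = s.arr B) → s'.reg i = a → s'.reg j = b →
      (p.run e s').reg r = F a b) :
    ∀ a < e.N, ∀ b < e.N,
      ((Cmd.rep i (.rep j (.seq p (.store A i j r)))).run e s).arr A a b = F a b := by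
  refine (iter_induction (n := e.N) (s := s) (f := fun a s' =>
    (Cmd.rep j (.seq p (.store A i j r))).run e (s'.setReg i a)) (fun a₀ s' =>
      ((∀ x, x ∉ i :: j :: p.wregs → s'.reg x = s.reg x) ∧ (∀ B, B ≠ A → s'.arr B = s.arr B)) ∧
        ∀ a < a₀, ∀ b < e.N, s'.arr A a b = F a b)
    ⟨⟨fun _ _ => rfl, fun _ _ => rfl⟩, by simp⟩ ?_).2
  rintro a s' ha ⟨⟨h1, h2⟩, h3⟩
  have f1 : ∀ x, x ∉ i :: j :: p.wregs →
      ((Cmd.rep j (.seq p (.store A i j r))).run e (s'.setReg i a)).reg x = s.reg x := by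
    intro x hx
    have hx' := hx
    simp only [List.mem_cons, not_or] at hx'
    rw [Cmd.run_reg e (by simp [Cmd.wregs, hx']), St.reg_setReg, if_neg hx'.1, h1 x hx]
  have f2 : ∀ B, B ≠ A →
      ((Cmd.rep j (.seq p (.store A i j r))).run e (s'.setReg i a)).arr B = s.arr B := by
    intro B hB
    rw [Cmd.run_arr e (by simp [Cmd.warrs, hp, hB]), St.arr_setReg, h2 B hB]
  have key := tabulate_row e (A := A) (z := i) (i := j) (r := r) (p := p) (F a) (s'.setReg i a) hp
    (by simp [hij, hi]) hj (by simpa using ha) ?_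
  · refine ⟨⟨f1, f2⟩, fun x hx b hb => ?_⟩
    by_cases hxa : x = a
    · subst hxa
      simpa using key b hb
    · rw [← h3 x (by omega) b hb]
      refine (iter_induction (n := e.N) (s := s'.setReg i a) (f := fun b s' =>
        (Cmd.seq p (.store A i j r)).run e (s'.setReg j b)) (fun _ s'' =>
          s''.reg i = a ∧ ∀ b, s''.arr A x b = s'.arr A x b) ⟨by simp, fun _ => rfl⟩ ?_).2 b
      rintro b s'' hb ⟨h4, h5⟩
      have h6 : (p.run e (s''.setReg j b)).reg i = a := by
        rw [Cmd.run_reg e hi, St.reg_setReg, if_neg hij, h4]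
      have h7 : (p.run e (s''.setReg j b)).arr = s''.arr := by
        funext B
        rw [Cmd.run_arr e (by simp [hp])]
        rfl
      simp only [Cmd.run]
      split_ifs
      · refine ⟨h6, fun b => ?_⟩
        rw [St.arr_setArr, if_neg (by rw [h6]; tauto), h7, h5]
      · exact ⟨h6, fun b => by rw [h7, h5]⟩
  · intro s'' b hb g1 g2 g3
    refine hrun s'' a b ha hb (fun x hx => ?_) (fun B hB => ?_) ?_ g3
    · simp only [List.mem_cons, not_or] at hx
      rw [g1 x (by simp [hx]), St.reg_setReg, if_neg hx.1, h1 x (by simp [hx])]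
    · rw [g2 B hB, St.arr_setReg, h2 B hB]
    · rw [g1 i (by simp [hij, hi])]
      simp

/-- Count the nonzero cells in row `0` of array `A`. -/
def countRow (A i c r : ℕ) : Cmd := .seq (.mov r 0) (.rep i (.seq (.load c A 0 i) (.cond c (.inc r) .skip)))

theorem countRow_run (e : Env) {A i c r : ℕ} (s : St) (h0 : s.reg 0 = 0) (hd : [0, i, c, r].Nodup) :
    ((countRow A i c r).run e s).reg r =
      ((Finset.range e.N).filter fun v => s.arr A 0 v ≠ 0).card := by
  simp only [List.nodup_cons, List.mem_cons, not_or, List.not_mem_nil, not_false_eq_true,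
    and_true] at hd
  obtain ⟨⟨d1, d2, d3⟩, ⟨d4, d5⟩, d6, -⟩ := hd
  refine (iter_induction (n := e.N) (s := s.setReg r 0) (f := fun j s' =>
    (Cmd.seq (.load c A 0 i) (.cond c (.inc r) .skip)).run e (s'.setReg i j)) (fun j s' =>
      s'.reg 0 = 0 ∧ s'.arr = s.arr ∧
      s'.reg r = ((Finset.range j).filter fun v => s.arr A 0 v ≠ 0).card)
    ⟨by simp [d3, h0], rfl, by simp⟩ ?_ : _ ∧ _ ∧ _).2.2 |> fun h => by
      simpa [countRow, Cmd.run, h0] using h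
  rintro j s' hj ⟨h1, h2, h3⟩
  have hle := Finset.card_filter_le (Finset.range j) fun v => s.arr A 0 v ≠ 0
  rw [Finset.card_range] at hle
  have hN : 0 < e.N := by omega
  rw [Finset.range_add_one, Finset.filter_insert]
  by_cases hv : s.arr A 0 j = 0
  · simp [Cmd.run, d1, d2, h1, hN, hj, h2, hv, Ne.symm d5, Ne.symm d6, h3]
  · have hlt : s'.reg r < e.N := by omega
    simp [Cmd.run, d1, d2, d3, h1, hN, hj, h2, hv, Ne.symm d5, Ne.symm d6, hlt]
    exact h3

end CapDom

namespace CapDom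

variable {e : Env} {n : ℕ}

/-! ### Setting up

Register `60` holds `n`, register `88` the bound for the sizes of the sets `U`, register `84` the size of
the smallest set found, which is in row `0` of array `0`, and register `70` tells whether to continue.
Arrays `21` and `22` hold the owners and the indices of copies, array `23` the adjacency matrix of the
graph, and array `25` the first copies of vertices. -/

/-- Fill in the entries of the tables for a copy. -/
def tableStore : Cmd :=
  .seq (.adj 63 71) (.seq (.store 23 61 62 63) (.seq (.store 21 0 71 61) (.seq (.store 22 0 71 62)
    (.cond 62 .skip (.store 25 0 61 71)))))

/-- Find the owner and the index of the next copy. -/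
def tableNext : Cmd :=
  .seq (.inc 62) (.seq (.eq 65 62 60) (.cond 65 (.seq (.set 62 0) (.inc 61)) .skip))

/-- One step of the computation of the tables. -/
def tableStep : Cmd := .seq tableStore tableNext

/-- One step of the division of `n + 5` by `6`. -/
def boundStep : Cmd :=
  .seq (.sub 73 60 71) (.cond 73 (.seq (.cond 66 .skip (.inc 88)) (.seq (.inc 66) (.seq (.set 67 6)
    (.seq (.eq 65 66 67) (.cond 65 (.set 66 0) .skip))))) .skip)

/-- Set up the tables. -/
def setUp : Cmd :=
  .seq (.set 1 1) (.seq (.mov 84 60) (.seq (.set 70 1) (.seq (.rep 71 (.store 0 0 71 1))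
    (.seq (.rep 71 tableStep) (.rep 71 boundStep)))))

/-- The tables are set up. -/
structure Tables (e : Env) (n : ℕ) (s : St) : Prop where
  zero : s.reg 0 = 0
  one : s.reg 1 = 1
  nreg : s.reg 60 = n
  bound : s.reg 88 = (n + 5) / 6
  own : ∀ i < e.N, s.arr 21 0 i = i / n
  idx : ∀ i < e.N, s.arr 22 0 i = i % n
  adj : ∀ u < n, ∀ v < n, s.arr 23 u v = e.adj (u * n + v)
  start : ∀ v < n, s.arr 25 0 v = v * n

theorem Tables.frame {s s' : St} (h : Tables e n s)
    (hr : ∀ r, r = 0 ∨ r = 1 ∨ r = 60 ∨ r = 88 → s'.reg r = s.reg r)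
    (ha : ∀ A, A = 21 ∨ A = 22 ∨ A = 23 ∨ A = 25 → s'.arr A = s.arr A) : Tables e n s' := by
  constructor
  · rw [hr 0 (by simp), h.zero]
  · rw [hr 1 (by simp), h.one]
  · rw [hr 60 (by simp), h.nreg]
  · rw [hr 88 (by simp), h.bound]
  · rw [ha 21 (by simp)]; exact h.own
  · rw [ha 22 (by simp)]; exact h.idx
  · rw [ha 23 (by simp)]; exact h.adj
  · rw [ha 25 (by simp)]; exact h.start

theorem succ_div_mod (hn : 0 < n) (i : ℕ) :
    (i % n + 1 = n → (i + 1) / n = i / n + 1 ∧ (i + 1) % n = 0) ∧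
    (i % n + 1 ≠ n → (i + 1) / n = i / n ∧ (i + 1) % n = i % n + 1) := by
  have h1 := Nat.mod_add_div i n
  have h2 := Nat.mod_lt i hn
  refine ⟨fun h => (Nat.div_mod_unique hn).2 ⟨?_, hn⟩,
    fun h => (Nat.div_mod_unique hn).2 ⟨?_, by omega⟩⟩
  · rw [mul_add]
    omega
  · omega

/-- The language has no division. Quotient and remainder of the running index by `n` are maintained
in two counters, the second of which is reset when it reaches `n`. -/
theorem tables_run (hN : e.N = n * n) (hn : 0 < n) {s : St} (h0 : s.reg 0 = 0) (h60 : s.reg 60 = n)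
    (h61 : s.reg 61 = 0) (h62 : s.reg 62 = 0) :
    (∀ i < e.N, ((Cmd.rep 71 tableStep).run e s).arr 21 0 i = i / n) ∧
    (∀ i < e.N, ((Cmd.rep 71 tableStep).run e s).arr 22 0 i = i % n) ∧
    (∀ u < n, ∀ v < n, ((Cmd.rep 71 tableStep).run e s).arr 23 u v = e.adj (u * n + v)) ∧
    ∀ v < n, ((Cmd.rep 71 tableStep).run e s).arr 25 0 v = v * n := by
  have key := iter_induction (n := e.N) (s := s) (f := fun j s' => tableStep.run e (s'.setReg 71 j))
    (fun j s' => (s'.reg 0 = 0 ∧ s'.reg 60 = n ∧ s'.reg 61 = j / n ∧ s'.reg 62 = j % n) ∧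
      (∀ i < j, s'.arr 21 0 i = i / n ∧ s'.arr 22 0 i = i % n ∧
        s'.arr 23 (i / n) (i % n) = e.adj i ∧ (i % n = 0 → s'.arr 25 0 (i / n) = i)))
    ⟨⟨h0, h60, by simp [h61], by simp [h62]⟩, by simp⟩ ?_
  · obtain ⟨-, h⟩ := key
    refine ⟨fun i hi => (h i hi).1, fun i hi => (h i hi).2.1, fun u hu v hv => ?_, fun v hv => ?_⟩
    · have h1 : u * n + v < e.N := hN ▸ index_lt hu hv
      have h2 := (h _ h1).2.2.1
      have h3 : (u * n + v) / n = u := by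
        rw [mul_comm, Nat.mul_add_div hn, Nat.div_eq_of_lt hv, add_zero]
      have h4 : (u * n + v) % n = v := by rw [mul_comm, Nat.mul_add_mod, Nat.mod_eq_of_lt hv]
      rwa [h3, h4] at h2
    · have h1 : v * n < e.N := hN ▸ Nat.mul_lt_mul_of_pos_right hv hn
      have h2 := (h _ h1).2.2.2 (Nat.mul_mod_left _ _)
      rwa [Nat.mul_div_cancel _ hn] at h2
  rintro j s' hj ⟨⟨g0, g60, g61, g62⟩, h⟩
  have hj1 : j / n < n := (Nat.div_lt_iff_lt_mul hn).2 (hN ▸ hj)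
  have hj2 := Nat.mod_lt j hn
  have hnN : n ≤ e.N := hN ▸ Nat.le_mul_self n
  have b1 : j / n < e.N := by omega
  have b2 : j % n < e.N := by omega
  have b0 : 0 < e.N := by omega
  have hsucc := succ_div_mod hn j
  set s1 := tableStore.run e (s'.setReg 71 j) with hs1
  have r1 : ∀ r, r ≠ 63 → r ≠ 71 → s1.reg r = s'.reg r := by
    intro r h1 h2
    rw [hs1, Cmd.run_reg e (by simp [tableStore, Cmd.wregs, h1])]
    simp [h2]
  have a1 : ∀ A i' j', s1.arr A i' j' = if A = 25 ∧ i' = 0 ∧ j' = j / n ∧ j % n = 0 then j else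
      if A = 22 ∧ i' = 0 ∧ j' = j then j % n else if A = 21 ∧ i' = 0 ∧ j' = j then j / n else
      if A = 23 ∧ i' = j / n ∧ j' = j % n then e.adj j else s'.arr A i' j' := by
    intro A i' j'
    by_cases hm : j % n = 0 <;>
      simp [hs1, tableStore, Cmd.run, g0, g61, g62, hj, b0, b1, b2, hm]
  have hrun : tableStep.run e (s'.setReg 71 j) = tableNext.run e s1 := rfl
  have hrun' : (tableStep.run e (s'.setReg 71 j)).arr = s1.arr := by
    funext A
    rw [hrun, Cmd.run_arr e (by simp [tableNext, Cmd.warrs])]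
  refine ⟨?_, ?_⟩
  · rw [hrun]
    by_cases hc : j % n + 1 = n
    · obtain ⟨e1, e2⟩ := hsucc.1 hc
      rw [e1, e2]
      simp [tableNext, Cmd.run, r1, g0, g60, g61, g62, b2, b1, hc]
    · obtain ⟨e1, e2⟩ := hsucc.2 hc
      rw [e1, e2]
      simp [tableNext, Cmd.run, r1, g0, g60, g61, g62, b2, hc]
  · intro i hi
    rw [hrun']
    by_cases hij : i = j
    · subst hij
      simp +contextual [a1]
    · obtain ⟨c1, c2, c3, c4⟩ := h i (by omega)
      have hne : ¬ (i / n = j / n ∧ i % n = j % n) := by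
        rintro ⟨h1, h2⟩
        exact hij (by rw [← Nat.div_add_mod i n, ← Nat.div_add_mod j n, h1, h2])
      refine ⟨by simp [a1, hij, c1], by simp [a1, hij, c2], by simp [a1, hne, c3], fun h0 => ?_⟩
      rw [a1, if_neg, if_neg (by simp), if_neg (by simp), if_neg (by simp)]
      · exact c4 h0
      · rintro ⟨-, -, h1, h2⟩
        exact hne ⟨h1, by rw [h0, h2]⟩

/-- A counter modulo `6` runs along, and the bound is incremented at each multiple of `6` below `n`;
there are `⌈n/6⌉` of these. -/
theorem bound_run (hN : n ≤ e.N) {s : St} (h60 : s.reg 60 = n) (h88 : s.reg 88 = 0)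
    (h66 : s.reg 66 = 0) : ((Cmd.rep 71 boundStep).run e s).reg 88 = (n + 5) / 6 := by
  have key := iter_induction (n := e.N) (s := s) (f := fun j s' => boundStep.run e (s'.setReg 71 j))
    (fun j s' => s'.reg 60 = n ∧ s'.reg 88 = (min j n + 5) / 6 ∧ s'.reg 66 = min j n % 6)
    ⟨h60, by simp [h88], by simp [h66]⟩ ?_
  · have := key.2.1
    rwa [min_eq_right hN] at this
  rintro j s' hj ⟨g60, g88, g66⟩
  by_cases hjn : j < n
  swap
  · have h1 : n - j = 0 := by omega
    have h2 : min (j + 1) n = min j n := by omega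
    rw [h2]
    simp [boundStep, Cmd.run, g60, h1, g88, g66]
  have h1 : n - j ≠ 0 := by omega
  have h2 : min j n = j := by omega
  have h3 : min (j + 1) n = j + 1 := by omega
  rw [h2] at g88 g66
  rw [h3]
  have h4 : j % 6 < e.N := by omega
  by_cases h5 : j % 6 = 0
  · have h6 : (j + 5) / 6 < e.N := by omega
    have h7 : (j + 1 + 5) / 6 = (j + 5) / 6 + 1 := by omega
    have h8 : (j + 1) % 6 = 1 := by omega
    rw [h7, h8]
    rw [h5] at g66 h4
    simp [boundStep, Cmd.run, g60, h1, g88, g66, h4, h6]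
  · have h7 : (j + 1 + 5) / 6 = (j + 5) / 6 := by omega
    rw [h7]
    by_cases h9 : j % 6 = 5
    · have h8 : (j + 1) % 6 = 0 := by omega
      rw [h8]
      rw [h9] at g66 h4
      simp [boundStep, Cmd.run, g60, h1, g88, g66, h4]
    · have h8 : (j + 1) % 6 = j % 6 + 1 := by omega
      rw [h8]
      simp [boundStep, Cmd.run, g60, h1, g88, g66, h4, h5, h9]

theorem setUp_spec (hN : e.N = n * n) (hn : 0 < n) {s : St}
    (hs : ∀ r, s.reg r = if r = 60 then n else 0) :
    Tables e n (setUp.run e s) ∧ (setUp.run e s).reg 84 = n ∧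
      (setUp.run e s).reg 70 = 1 ∧ (∀ v < n, (setUp.run e s).arr 0 0 v = 1) ∧
      (setUp.run e s).arr 20 = s.arr 20 := by
  have hnN : n ≤ e.N := hN ▸ Nat.le_mul_self n
  have b0 : 0 < e.N := by omega
  set s1 := ((s.setReg 1 1).setReg 84 n).setReg 70 1 with hs1
  have r1 : ∀ r, s1.reg r = if r = 70 then 1 else if r = 84 then n else if r = 1 then 1 else
      if r = 60 then n else 0 := by
    intro r
    simp [hs1, hs]
  have hf := fillRow_arr e (A := 0) (i := 71) (j := 0) (r := 1) (by simp) s1 (by simpa [r1] using b0)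
  have r2 : ∀ r, r ≠ 71 → ((Cmd.rep 71 (.store 0 0 71 1)).run e s1).reg r = s1.reg r := fun r hr =>
    Cmd.run_reg e (by simp [Cmd.wregs, hr]) s1
  set s2 := (Cmd.rep 71 (.store 0 0 71 1)).run e s1 with hs2
  obtain ⟨t1, t2, t3, t4⟩ := tables_run hN hn (s := s2) (by simp [r2, r1]) (by simp [r2, r1])
    (by simp [r2, r1]) (by simp [r2, r1])
  have r3 : ∀ r, r ∉ [61, 62, 63, 65, 71] → ((Cmd.rep 71 tableStep).run e s2).reg r = s1.reg r := by
    intro r hr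
    simp at hr
    rw [Cmd.run_reg e (by simp [tableStep, tableStore, tableNext, Cmd.wregs, hr]), r2 r (by simp [hr])]
  have a3 : ∀ A, A ∉ [21, 22, 23, 25] → ((Cmd.rep 71 tableStep).run e s2).arr A = s2.arr A :=
    fun A hA => Cmd.run_arr e (by simp at hA; simp [tableStep, tableStore, tableNext, Cmd.warrs, hA]) s2
  set s3 := (Cmd.rep 71 tableStep).run e s2 with hs3
  have t5 := bound_run (e := e) (s := s3) hnN (by simp [r3, r1]) (by simp [r3, r1])
    (by simp [r3, r1])
  have r4 : ∀ r, r ∉ [65, 66, 67, 71, 73, 88] →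
      ((Cmd.rep 71 boundStep).run e s3).reg r = s3.reg r := fun r hr =>
    Cmd.run_reg e (by simp at hr; simp [boundStep, Cmd.wregs, hr]) s3
  have a4 : ((Cmd.rep 71 boundStep).run e s3).arr = s3.arr := by
    funext A
    exact Cmd.run_arr e (by simp [boundStep, Cmd.warrs]) s3
  have hrun : setUp.run e s = (Cmd.rep 71 boundStep).run e s3 := by
    have : (Cmd.seq (.set 1 1) (.seq (.mov 84 60) (.set 70 1))).run e s = s1 := by
      simp [Cmd.run, hs1, hs]
    rw [hs3, hs2, ← this]
    rfl
  rw [hrun]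
  refine ⟨⟨?_, ?_, ?_, t5, ?_, ?_, ?_, ?_⟩, ?_, ?_, ?_, ?_⟩
  · simp [r4, r3, r1]
  · simp [r4, r3, r1]
  · simp [r4, r3, r1]
  · rw [a4]; exact t1
  · rw [a4]; exact t2
  · rw [a4]; exact t3
  · rw [a4]; exact t4
  · simp [r4, r3, r1]
  · simp [r4, r3, r1]
  · intro v hv
    rw [a4, a3 0 (by simp), hf, if_pos ⟨rfl, by simp [r1], by omega⟩]
    simp [r1]
  · rw [a4, a3 20 (by simp), hs2, Cmd.run_arr e (by simp [Cmd.warrs])]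
    rfl

end CapDom

namespace CapDom

variable {e : Env} {n : ℕ} {G : SimpleGraph (Fin n)} {c : Fin n → ℕ}

/-! ### The set of vertices that belongs to a set `U`

The set `U` is in row `0` of array `20`. -/

/-- The set of the numbers below `N` at which `f` is nonzero. -/
def support (N : ℕ) (f : ℕ → ℕ) : Finset ℕ := (Finset.range N).filter fun v => f v ≠ 0

@[simp] theorem mem_support {N : ℕ} {f : ℕ → ℕ} {v : ℕ} : v ∈ support N f ↔ v < N ∧ f v ≠ 0 := by
  simp [support]

/-- Load the data of a copy. -/
def loadCopy (i o x u a : ℕ) : Cmd :=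
  .seq (.load o 21 0 i) (.seq (.load x 22 0 i) (.seq (.load u 20 0 o)
    (.cond u (.ltCap a x o) (.eq a x 0))))

/-- Decide whether two copies are adjacent, given their data. -/
def pickAdj : Cmd :=
  .cond 76 (.cond 80 (.cond 81 (.cond 75 (.cond 79 (.mov 82 0) (.mov 82 1)) (.cond 79 (.mov 82 1)
    (.seq (.ltCap 82 0 73) (.cond 82 .skip (.ltCap 82 0 77))))) (.mov 82 0)) (.mov 82 0)) (.mov 82 0)

/-- Decide whether the copies in registers `71` and `72` are adjacent. -/
def decideAdj : Cmd :=
  .seq (loadCopy 71 73 74 75 76) (.seq (loadCopy 72 77 78 79 80) (.seq (.load 81 23 73 77) pickAdj))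

/-- Compute the adjacency matrix of the copies. -/
def buildCopies : Cmd := .rep 71 (.rep 72 (.seq decideAdj (.store 1 71 72 82)))

/-- Decide whether a vertex outside `U` is not dominated. -/
def pickFree : Cmd :=
  .seq (.load 79 21 0 75) (.seq (.load 78 20 0 79) (.cond 78 (.mov 77 0) (.seq (.ltCap 80 0 79)
    (.cond 80 (.seq (.ltCap 80 0 71) (.cond 80 (.seq (.sub 81 71 79) (.cond 81 (.mov 77 0)
      (.mov 77 1))) (.mov 77 0))) (.mov 77 1)))))

/-- Decide whether the vertex in register `71` is not dominated. -/
def decideFree : Cmd :=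
  .seq (.sub 73 60 71) (.cond 73 (.seq (.load 74 25 0 71) (.seq (.load 75 8 0 74) (.seq (.eq 76 75 74)
    (.cond 76 (.mov 77 1) (.seq (.load 78 20 0 71) (.cond 78 (.mov 77 1) pickFree))))))
    (.mov 77 0))

/-- Compute the set of the vertices that are not dominated. -/
def freeVertices : Cmd := .rep 71 (.seq decideFree (.store 24 0 71 77))

/-- Find the set of vertices for `U`, and keep it if it is the smallest so far. -/
def evaluate : Cmd :=
  .seq buildCopies (.seq maxMatching (.seq freeVertices (.seq (countRow 24 71 73 83)
    (.seq (.sub 85 84 83) (.cond 85 (.seq (.mov 84 83) (copyRow 24 0 0 0)) .skip)))))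

theorem loadCopy_run {i o x u a : ℕ} {s : St} (hd : [0, i, o, x, u, a].Nodup) {U : Set ℕ} {j : ℕ}
    (hc : e.cap = gcap c) (h0 : s.reg 0 = 0) (hi : s.reg i = j) (hj : j < e.N) (hjn : j / n < e.N)
    (hU : s.arr 20 0 (j / n) ≠ 0 ↔ j / n ∈ U) (ho : s.arr 21 0 j = j / n)
    (hx : s.arr 22 0 j = j % n) : ∃ b, (b ≠ 0 ↔ IsCopy c U j) ∧
      (loadCopy i o x u a).run e s = (((s.setReg o (j / n)).setReg x (j % n)).setReg u
        (s.arr 20 0 (j / n))).setReg a b := by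
  simp only [List.nodup_cons, List.mem_cons, not_or, List.not_mem_nil, not_false_eq_true,
    and_true] at hd
  obtain ⟨⟨d1, d2, d3, d4, d5⟩, ⟨d6, d7, d8, d9⟩, ⟨d10, d11, d12⟩, ⟨d13, d14⟩, d15⟩ := hd
  have hN : 0 < e.N := by omega
  by_cases hu : s.arr 20 0 (j / n) = 0
  · have hu' : j / n ∉ U := fun h => hU.2 h hu
    refine ⟨if j % n = 0 then 1 else 0, by simp [IsCopy, hu'], ?_⟩
    simp [loadCopy, Cmd.run, hi, hj, h0, hN, ho, hx, d2, d3, d4, d6, d10, d13, hjn, hu]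
  · have hu' := hU.1 hu
    refine ⟨if j % n < gcap c (j / n) then 1 else 0, by simp [IsCopy, hu'], ?_⟩
    simp [loadCopy, Cmd.run, hi, hj, h0, hN, ho, hx, d2, d3, d6, d10, d11, d13,
      hjn, hu, hc]

theorem pickAdj_run {s : St} (h0 : s.reg 0 = 0) (h1 : s.reg 1 = 1) :
    (pickAdj.run e s).reg 82 = if s.reg 76 ≠ 0 then if s.reg 80 ≠ 0 then
      if s.reg 81 ≠ 0 then if s.reg 75 ≠ 0 then if s.reg 79 ≠ 0 then 0 else 1 else
        if s.reg 79 ≠ 0 then 1 else if 0 < e.cap (s.reg 73) then 1 else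
          if 0 < e.cap (s.reg 77) then 1 else 0
      else 0 else 0 else 0 := by
  by_cases c1 : s.reg 76 = 0
  · simp [pickAdj, Cmd.run, c1, h0]
  by_cases c2 : s.reg 80 = 0
  · simp [pickAdj, Cmd.run, c1, c2, h0]
  by_cases c3 : s.reg 81 = 0
  · simp [pickAdj, Cmd.run, c1, c2, c3, h0]
  by_cases c4 : s.reg 75 = 0 <;> by_cases c5 : s.reg 79 = 0
  · by_cases c6 : 0 < e.cap (s.reg 73)
    · simp [pickAdj, Cmd.run, c1, c2, c3, c4, c5, c6, h0]
    · simp [pickAdj, Cmd.run, c1, c2, c3, c4, c5, c6, h0]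
  · simp [pickAdj, Cmd.run, c1, c2, c3, c4, c5, h1]
  · simp [pickAdj, Cmd.run, c1, c2, c3, c4, c5, h1]
  · simp [pickAdj, Cmd.run, c1, c2, c3, c4, c5, h0]

theorem decideAdj_run {s : St} {U : Set ℕ} {i j : ℕ} (ht : Tables e n s) (hN : e.N = n * n)
    (hn : 0 < n) (hc : e.cap = gcap c)
    (hadj : ∀ u < n, ∀ v < n, e.adj (u * n + v) ≠ 0 ↔ gadj G u v)
    (hU : ∀ v < n, s.arr 20 0 v ≠ 0 ↔ v ∈ U) (hi : s.reg 71 = i) (hj : s.reg 72 = j)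
    (hiN : i < e.N) (hjN : j < e.N) :
    (copyAdj G c U i j → (decideAdj.run e s).reg 82 = 1) ∧
      (¬ copyAdj G c U i j → (decideAdj.run e s).reg 82 = 0) := by
  have hnN : n ≤ e.N := hN ▸ Nat.le_mul_self n
  have hi' : i / n < n := (Nat.div_lt_iff_lt_mul hn).2 (hN ▸ hiN)
  have hj' : j / n < n := (Nat.div_lt_iff_lt_mul hn).2 (hN ▸ hjN)
  obtain ⟨a, ha, e1⟩ := loadCopy_run (c := c) (i := 71) (o := 73) (x := 74) (u := 75) (a := 76)
    (by simp) hc ht.zero hi hiN (by omega) (hU _ hi') (ht.own i hiN) (ht.idx i hiN)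
  set s1 := (loadCopy 71 73 74 75 76).run e s with hs1
  obtain ⟨b, hb, e2⟩ := loadCopy_run (c := c) (i := 72) (o := 77) (x := 78) (u := 79) (a := 80)
    (s := s1) (U := U) (j := j) (by simp) hc (by simp [e1, ht.zero]) (by simp [e1, hj]) hjN
    (by omega) (by simpa [e1] using hU _ hj') (by simpa [e1] using ht.own j hjN)
    (by simpa [e1] using ht.idx j hjN)
  set s2 := (loadCopy 72 77 78 79 80).run e s1 with hs2
  have hg : e.adj (i / n * n + j / n) ≠ 0 ↔ gadj G (i / n) (j / n) := hadj _ hi' _ hj'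
  have hUi := hU _ hi'
  have hUj := hU _ hj'
  have b1 : i / n < e.N := by omega
  have b2 : j / n < e.N := by omega
  have hA : s.arr 23 (i / n) (j / n) = e.adj (i / n * n + j / n) := ht.adj _ hi' _ hj'
  -- The nested tests follow the definition of `copyAdj`: both numbers are copies, the owners are
  -- adjacent, not both are in `U`, and outside `U` one of them has positive capacity.
  have hrun : (decideAdj.run e s).reg 82 = if a ≠ 0 then if b ≠ 0 then
      if e.adj (i / n * n + j / n) ≠ 0 then if s.arr 20 0 (i / n) ≠ 0 then
        if s.arr 20 0 (j / n) ≠ 0 then 0 else 1 else if s.arr 20 0 (j / n) ≠ 0 then 1 else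
          if 0 < gcap c (i / n) then 1 else if 0 < gcap c (j / n) then 1 else 0
      else 0 else 0 else 0 := by
    have hd : decideAdj.run e s = pickAdj.run e ((Cmd.load 81 23 73 77).run e s2) := rfl
    rw [hd, pickAdj_run (by simp [Cmd.run, e2, e1, ht.zero]) (by simp [Cmd.run, e2, e1, ht.one])]
    simp [Cmd.run, e2, e1, b1, b2, hA, hc]
  rw [hrun]
  unfold copyAdj
  rw [← ha, ← hb, ← hg, ← hUi, ← hUj]
  constructor
  · rintro ⟨h1, h2, h3, h4, h5⟩
    rw [if_pos h1, if_pos h2, if_pos h3]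
    split_ifs with c1 c2 c2 c3 c4
    · exact absurd ⟨c1, c2⟩ h4
    · rfl
    · rfl
    · rfl
    · rfl
    · have := h5 c1 c2
      omega
  · intro h
    split_ifs with h1 h2 h3 h4 h5 h5 h6 h7 <;> try rfl
    · exact absurd ⟨h1, h2, h3, fun h => h5 h.2, fun h => absurd h4 h⟩ h
    · exact absurd ⟨h1, h2, h3, fun h => h4 h.1, fun _ h => absurd h5 h⟩ h
    · exact absurd ⟨h1, h2, h3, fun h => h4 h.1, fun _ _ => Or.inl (by omega)⟩ h
    · exact absurd ⟨h1, h2, h3, fun h => h4 h.1, fun _ _ => Or.inr (by omega)⟩ h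

theorem buildCopies_spec {s : St} {U : Set ℕ} (ht : Tables e n s) (hN : e.N = n * n)
    (hn : 0 < n) (hc : e.cap = gcap c)
    (hadj : ∀ u < n, ∀ v < n, e.adj (u * n + v) ≠ 0 ↔ gadj G u v)
    (hU : ∀ v < n, s.arr 20 0 v ≠ 0 ↔ v ∈ U) :
    ∀ i < e.N, ∀ j < e.N, (buildCopies.run e s).arr 1 i j ≠ 0 ↔ copyAdj G c U i j := by
  classical
  have hw : decideAdj.wregs ⊆ [73, 74, 75, 76, 77, 78, 79, 80, 81, 82] := by
    simp [decideAdj, pickAdj, loadCopy, Cmd.wregs]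
  have hw' : ∀ r, r ∉ [71, 72, 73, 74, 75, 76, 77, 78, 79, 80, 81, 82] →
      r ∉ 71 :: 72 :: decideAdj.wregs := by
    intro r hr
    simp only [List.mem_cons, not_or] at hr ⊢
    exact ⟨hr.1, hr.2.1, fun h => by have := hw h; simp at this; omega⟩
  have key := tabulate e (A := 1) (i := 71) (j := 72) (r := 82) (p := decideAdj)
    (fun i j => if copyAdj G c U i j then 1 else 0) s
    (by simp [decideAdj, pickAdj, loadCopy, Cmd.warrs]) (by simp) (fun h => by have := hw h; simp at this)
    (fun h => by have := hw h; simp at this) (fun s' a b ha hb h1 h2 h3 h4 => by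
      have := decideAdj_run (G := G) (s := s') (U := U) (i := a) (j := b)
        (ht.frame (fun r hr => h1 r (hw' r (by simp; omega))) fun A hA => h2 A (by omega)) hN hn hc
        hadj (by rw [h2 20 (by simp)]; exact hU) h3 h4 ha hb
      by_cases h : copyAdj G c U a b
      · rw [this.1 h, if_pos h]
      · rw [this.2 h, if_neg h])
  intro i hi j hj
  rw [buildCopies, key i hi j hj]
  simp

theorem decideFree_run {s : St} {U : Set ℕ} {m : ℕ → ℕ} {k v : ℕ} (ht : Tables e n s)
    (hN : e.N = n * n) (hn : 0 < n) (hc : e.cap = gcap c)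
    (hU : ∀ v < n, s.arr 20 0 v ≠ 0 ↔ v ∈ U) (hm : IsMatch (n * n) (copyAdj G c U) k m)
    (hr : Rep e.N (s.arr 8 0) m) (hv : s.reg 71 = v) (hvN : v < e.N) :
    (v < n ∧ ¬ Dominated c U m v → (decideFree.run e s).reg 77 = 1) ∧
      (¬ (v < n ∧ ¬ Dominated c U m v) → (decideFree.run e s).reg 77 = 0) := by
  have hnN : n ≤ e.N := hN ▸ Nat.le_mul_self n
  have b0 : 0 < e.N := by omega
  by_cases hvn : v < n
  swap
  · have h1 : n - v = 0 := by omega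
    have : (decideFree.run e s).reg 77 = 0 := by
      simp [decideFree, Cmd.run, hv, ht.nreg, h1, ht.zero]
    exact ⟨fun h => absurd h.1 hvn, fun _ => this⟩
  have h1 : n - v ≠ 0 := by omega
  have h2 : v * n < e.N := hN ▸ Nat.mul_lt_mul_of_pos_right hvn hn
  have h3 := hm.lt isGraph_copyAdj (hN ▸ h2)
  have h3' : m (v * n) < e.N := hN ▸ h3
  have h4 : m (v * n) / n < n := (Nat.div_lt_iff_lt_mul hn).2 h3
  have b4 : m (v * n) / n < e.N := by omega
  have hUv := hU v hvn
  have hUm := hU _ h4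
  have hrun : (decideFree.run e s).reg 77 = if m (v * n) = v * n then 1 else
      if s.arr 20 0 v ≠ 0 then 1 else if s.arr 20 0 (m (v * n) / n) ≠ 0 then 0 else
      if 0 < gcap c (m (v * n) / n) then if 0 < gcap c v then if v - m (v * n) / n ≠ 0 then 0 else 1
      else 0 else 1 := by
    by_cases c1 : m (v * n) = v * n
    · simp [decideFree, Cmd.run, hv, ht.nreg, h1, ht.zero, ht.one, b0, hvN, ht.start v hvn, h2,
        hr _ h2, c1]
    have e1 : decideFree.run e s = if s.arr 20 0 v ≠ 0 then ((((((s.setReg 73 (n - v)).setReg 74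
        (v * n)).setReg 75 (m (v * n))).setReg 76 0).setReg 78 (s.arr 20 0 v)).setReg 77 1) else
        pickFree.run e (((((s.setReg 73 (n - v)).setReg 74 (v * n)).setReg 75
          (m (v * n))).setReg 76 0).setReg 78 (s.arr 20 0 v)) := by
      by_cases c2 : s.arr 20 0 v = 0 <;>
        simp [decideFree, Cmd.run, hv, ht.nreg, h1, ht.zero, ht.one, b0, hvN, ht.start v hvn, h2,
          hr _ h2, c1, c2]
    rw [e1, if_neg c1]
    by_cases c2 : s.arr 20 0 v = 0
    swap
    · simp [c2]
    rw [if_neg (by simp [c2]), if_neg (by simp [c2])]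
    by_cases c3 : s.arr 20 0 (m (v * n) / n) = 0
    swap
    · simp [pickFree, Cmd.run, ht.zero, b0, h3', ht.own _ h3', b4, c3]
    by_cases c4 : 0 < gcap c (m (v * n) / n)
    swap
    · simp [pickFree, Cmd.run, ht.zero, ht.one, b0, h3', ht.own _ h3', b4, c3, c4, hc]
    by_cases c5 : 0 < gcap c v
    swap
    · simp [pickFree, Cmd.run, ht.zero, b0, h3', ht.own _ h3', b4, c3, c4, hc, hv, c5]
    by_cases c6 : v - m (v * n) / n = 0 <;>
      simp [pickFree, Cmd.run, ht.zero, ht.one, b0, h3', ht.own _ h3', b4, c3, c4, hc, hv, c5,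
        c6]
  rw [hrun]
  unfold Dominated DomBy
  rw [← hUv, ← hUm]
  constructor
  · rintro ⟨-, h⟩
    split_ifs with c1 c2 c3 c4 c5 c6 <;> try rfl
    · exact absurd ⟨c1, c2, Or.inl c3⟩ h
    · exact absurd ⟨c1, c2, Or.inr ⟨by omega, Or.inr (by omega)⟩⟩ h
    · exact absurd ⟨c1, c2, Or.inr ⟨by omega, Or.inl (by omega)⟩⟩ h
  · intro h
    rw [not_and, not_not] at h
    obtain ⟨d1, d2, d3⟩ := h hvn
    rw [if_neg d1, if_neg d2]
    split_ifs with c3 c4 c5 c6 <;> try rfl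
    · omega
    · omega

theorem freeVertices_spec {s : St} {U : Set ℕ} {m : ℕ → ℕ} {k : ℕ} (ht : Tables e n s)
    (hN : e.N = n * n) (hn : 0 < n) (hc : e.cap = gcap c)
    (hU : ∀ v < n, s.arr 20 0 v ≠ 0 ↔ v ∈ U) (hm : IsMatch (n * n) (copyAdj G c U) k m)
    (hr : Rep e.N (s.arr 8 0) m) : ∀ v < e.N,
      (freeVertices.run e s).arr 24 0 v ≠ 0 ↔ v < n ∧ ¬ Dominated c U m v := by
  classical
  have hw : decideFree.wregs ⊆ [73, 74, 75, 76, 77, 78, 79, 80, 81] := by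
    simp [decideFree, pickFree, Cmd.wregs]
  have hw' : ∀ r, r ∉ [71, 73, 74, 75, 76, 77, 78, 79, 80, 81] → r ∉ 71 :: decideFree.wregs := by
    intro r hr
    simp only [List.mem_cons, not_or] at hr ⊢
    exact ⟨hr.1, fun h => by have := hw h; simp at this; omega⟩
  have b0 : 0 < e.N := by rw [hN]; positivity
  have key := tabulate_row e (A := 24) (z := 0) (i := 71) (r := 77) (p := decideFree)
    (fun v => if v < n ∧ ¬ Dominated c U m v then 1 else 0) s
    (by simp [decideFree, pickFree, Cmd.warrs]) (hw' 0 (by simp)) (fun h => by have := hw h; simp at this)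
    (by rwa [ht.zero]) (fun s' v hv h1 h2 h3 => by
      have := decideFree_run (G := G) (s := s') (U := U) (m := m) (v := v)
        (ht.frame (fun r hr => h1 r (hw' r (by simp; omega))) fun A hA => h2 A (by omega)) hN hn hc
        (by rw [h2 20 (by simp)]; exact hU) hm (by rw [h2 8 (by simp)]; exact hr) h3 hv
      by_cases h : v < n ∧ ¬ Dominated c U m v
      · rw [this.1 h, if_pos h]
      · rw [this.2 h, if_neg h])
  intro v hv
  rw [ht.zero] at key
  rw [freeVertices, key v hv]
  simp

end CapDom

/-! ### Evaluation of a single set `U`. -/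

namespace CapDom

variable {e : Env} {n : ℕ} {G : SimpleGraph (Fin n)} {c : Fin n → ℕ}

/-- The set of vertices in row `0` of array `0`. -/
def kept (n : ℕ) (s : St) : Finset (Fin n) := Finset.univ.filter fun v : Fin n => s.arr 0 0 v ≠ 0

/-- Register `84` holds the size of the set that is kept, which is a capacitated dominating set. -/
def Keeps (G : SimpleGraph (Fin n)) (c : Fin n → ℕ) (s : St) : Prop :=
  s.reg 84 = (kept n s).card ∧ IsCapDomSet G c (kept n s)

/-- The environment presents `G` and `c`. -/
structure Presents (e : Env) (G : SimpleGraph (Fin n)) (c : Fin n → ℕ) : Prop where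
  size : e.N = n * n
  cap : e.cap = gcap c
  adj : ∀ u < n, ∀ v < n, e.adj (u * n + v) ≠ 0 ↔ gadj G u v

theorem card_filter_fin {N : ℕ} (hN : n ≤ N) (p : ℕ → Prop) [DecidablePred p] (f : ℕ → ℕ)
    (hf : ∀ v < N, f v ≠ 0 ↔ v < n ∧ p v) :
    (Finset.univ.filter fun v : Fin n => f v ≠ 0).card = ((Finset.range N).filter fun v => f v ≠ 0).card ∧
    (Finset.univ.filter fun v : Fin n => f v ≠ 0).card = ((Finset.range n).filter p).card := by
  have h1 : (Finset.univ.filter fun v : Fin n => f v ≠ 0).map Fin.valEmbedding =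
      (Finset.range N).filter fun v => f v ≠ 0 := by
    ext v
    simp only [Finset.mem_map, Finset.mem_filter, Finset.mem_univ, true_and, Fin.valEmbedding_apply,
      Finset.mem_range]
    constructor
    · rintro ⟨w, hw, rfl⟩
      exact ⟨by omega, hw⟩
    · rintro ⟨hv, h⟩
      exact ⟨⟨v, ((hf v hv).1 h).1⟩, h, rfl⟩
  have h2 : (Finset.range N).filter (fun v => f v ≠ 0) = (Finset.range n).filter p := by
    ext v
    simp only [Finset.mem_filter, Finset.mem_range]
    constructor
    · rintro ⟨hv, h⟩
      exact (hf v hv).1 h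
    · rintro ⟨hv, h⟩
      exact ⟨by omega, (hf v (by omega)).2 ⟨hv, h⟩⟩
  rw [← h2, ← h1, Finset.card_map]
  exact ⟨rfl, rfl⟩

theorem evaluate_warrs {A : ℕ} (hA : 12 ≤ A) (hA' : A ≠ 24) : A ∉ evaluate.warrs := by
  simp [evaluate, buildCopies, freeVertices, decideAdj, pickAdj, loadCopy, decideFree, pickFree,
    countRow, copyRow, Cmd.warrs, maxMatching_warrs (Or.inr hA), hA']
  omega

theorem copyRow_wregs (A i B j : ℕ) : (copyRow A i B j).wregs = [3, 4] := by
  simp [copyRow, Cmd.wregs]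

/-- The set found for `U` has `n` minus the number of edges of a maximum matching as its size, so it
competes with every matching of the copies for this `U`. It replaces the kept set only if it is
strictly smaller, hence the kept size never grows. -/
theorem evaluate_spec {s : St} {U : Set ℕ} (he : Presents e G c) (hn : 0 < n) (ht : Tables e n s)
    (hU : ∀ v < n, s.arr 20 0 v ≠ 0 ↔ v ∈ U) (hk : Keeps G c s) :
    Tables e n (evaluate.run e s) ∧ (evaluate.run e s).arr 20 = s.arr 20 ∧
      Keeps G c (evaluate.run e s) ∧ (evaluate.run e s).reg 84 ≤ s.reg 84 ∧
      ∀ k' m' a, IsMatch (n * n) (copyAdj G c U) k' m' → k' + 2 * a = n * n →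
        (evaluate.run e s).reg 84 + a ≤ n := by
  classical
  have hN := he.size
  have hnN : n ≤ e.N := hN ▸ Nat.le_mul_self n
  have b0 : 0 < e.N := by omega
  have f1 : ∀ r, r = 0 ∨ r = 1 ∨ 83 ≤ r → (buildCopies.run e s).reg r = s.reg r := fun r hr =>
    Cmd.run_reg e (by
      simp [buildCopies, decideAdj, pickAdj, loadCopy, Cmd.wregs]; omega) s
  have f2 : ∀ r, r = 60 ∨ 83 ≤ r → (buildCopies.run e s).reg r = s.reg r := fun r hr =>
    Cmd.run_reg e (by
      simp [buildCopies, decideAdj, pickAdj, loadCopy, Cmd.wregs]; omega) s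
  have f3 : ∀ A, A ≠ 1 → (buildCopies.run e s).arr A = s.arr A := fun A hA =>
    Cmd.run_arr e (by
      simp [buildCopies, decideAdj, pickAdj, loadCopy, Cmd.warrs, hA]) s
  have g1 := buildCopies_spec ht hN hn he.cap he.adj hU
  set s1 := buildCopies.run e s with hs1
  have hG : IsGraph e.N (copyAdj G c U) := hN ▸ isGraph_copyAdj
  obtain ⟨g2, k, m, hr, hm, hmin⟩ := maxMatching_spec hG (s := s1) b0
    ⟨by rw [f1 0 (by simp), ht.zero], by rw [f1 1 (by simp), ht.one], g1⟩
  have f4 : ∀ r, 56 ≤ r → (maxMatching.run e s1).reg r = s1.reg r := fun r hr =>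
    Cmd.run_reg e (maxMatching_wregs hr) s1
  have f5 : ∀ A, A = 0 ∨ 12 ≤ A → (maxMatching.run e s1).arr A = s1.arr A := fun A hA =>
    Cmd.run_arr e (maxMatching_warrs hA) s1
  set s2 := maxMatching.run e s1 with hs2
  have ht2 : Tables e n s2 := ht.frame (fun r hr => by
      rcases hr with rfl | rfl | rfl | rfl
      · rw [g2.zero, ht.zero]
      · rw [g2.one, ht.one]
      · rw [f4 _ (by simp), f2 _ (by simp)]
      · rw [f4 _ (by simp), f2 _ (by simp)])
    fun A hA => by rw [f5 A (by omega), f3 A (by omega)]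
  rw [hN] at hm
  have hU2 : ∀ v < n, s2.arr 20 0 v ≠ 0 ↔ v ∈ U := by
    rw [f5 20 (by simp), f3 20 (by simp)]
    exact hU
  have g3 := freeVertices_spec ht2 hN hn he.cap hU2 hm hr
  have f6 : ∀ r, r = 0 ∨ 82 ≤ r → (freeVertices.run e s2).reg r = s2.reg r := fun r hr =>
    Cmd.run_reg e (by simp [freeVertices, decideFree, pickFree, Cmd.wregs]; omega) s2
  have f7 : ∀ A, A ≠ 24 → (freeVertices.run e s2).arr A = s2.arr A := fun A hA =>
    Cmd.run_arr e (by simp [freeVertices, decideFree, pickFree, Cmd.warrs, hA]) s2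
  set s3 := freeVertices.run e s2 with hs3
  have z3 : s3.reg 0 = 0 := by rw [f6 0 (by simp), g2.zero]
  have g4 := countRow_run e (A := 24) (i := 71) (c := 73) (r := 83) s3 z3 (by simp)
  have f8 : ∀ r, r ∉ [71, 73, 83] → ((countRow 24 71 73 83).run e s3).reg r = s3.reg r := fun r hr =>
    Cmd.run_reg e (by simp at hr; simp [countRow, Cmd.wregs, hr]) s3
  have f9 : ((countRow 24 71 73 83).run e s3).arr = s3.arr := by
    funext A
    exact Cmd.run_arr e (by simp [countRow, Cmd.warrs]) s3
  obtain ⟨g5, g6⟩ := card_filter_fin hnN (fun v => ¬ Dominated c U m v) (s3.arr 24 0) g3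
  rw [← g5] at g4
  set s4 := (countRow 24 71 73 83).run e s3 with hs4
  have r84 : s4.reg 84 = s.reg 84 := by
    rw [f8 84 (by simp), f6 84 (by simp), f4 84 (by simp), f1 84 (by simp)]
  have a0 : s4.arr 0 = s.arr 0 := by
    rw [f9, f7 0 (by simp), f5 0 (by simp), f3 0 (by simp)]
  have hrun : evaluate.run e s = (Cmd.seq (.sub 85 84 83) (.cond 85
    (.seq (.mov 84 83) (copyRow 24 0 0 0)) .skip)).run e s4 := rfl
  set F := Finset.univ.filter fun v : Fin n => s3.arr 24 0 v ≠ 0 with hF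
  have hF' : ∀ v : Fin n, v ∈ F ↔ ¬ Dominated c U m v := by
    intro v
    rw [hF, Finset.mem_filter, g3 v (by omega)]
    simp
  have hcds := isCapDomSet_of_isMatch hm F hF'
  -- Compare `k' + 2a = n²` with `card_dominated`: as `k ≤ k'`, at least `a` vertices are dominated.
  have hcard : ∀ k' m' a, IsMatch (n * n) (copyAdj G c U) k' m' → k' + 2 * a = n * n →
      F.card + a ≤ n := by
    intro k' m' a hm' ha
    have h1 := hmin k' m' (hN ▸ hm')
    have h2 := card_dominated hm
    have h3 := Finset.card_filter_add_card_filter_not (s := Finset.range n) (Dominated c U m)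
    rw [Finset.card_range] at h3
    omega
  have hT : Tables e n (evaluate.run e s) := by
    have : evaluate.run e s = (Cmd.seq freeVertices (.seq (countRow 24 71 73 83)
      (.seq (.sub 85 84 83) (.cond 85 (.seq (.mov 84 83) (copyRow 24 0 0 0)) .skip)))).run e s2 := rfl
    rw [this]
    refine ht2.frame (fun r hr => Cmd.run_reg e ?_ s2) fun A hA => Cmd.run_arr e ?_ s2
    · simp [freeVertices, decideFree, pickFree, countRow, copyRow, Cmd.wregs]
      omega
    · simp [freeVertices, decideFree, pickFree, countRow, copyRow, Cmd.warrs]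
      omega
  refine ⟨hT, Cmd.run_arr e (evaluate_warrs (by simp) (by simp)) s, ?_⟩
  rw [hrun]
  by_cases hlt : F.card < s.reg 84
  · have h1 : s.reg 84 - F.card ≠ 0 := by omega
    have hrun' : (Cmd.seq (.sub 85 84 83) (.cond 85
        (.seq (.mov 84 83) (copyRow 24 0 0 0)) .skip)).run e s4 =
        (copyRow 24 0 0 0).run e ((s4.setReg 85 (s.reg 84 - F.card)).setReg 84 F.card) := by
      simp [Cmd.run, r84, g4, h1]
    rw [hrun']
    have z4 : s4.reg 0 = 0 := by rw [f8 0 (by simp), z3]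
    have h2 : ((copyRow 24 0 0 0).run e ((s4.setReg 85 (s.reg 84 - F.card)).setReg 84
        F.card)).reg 84 = F.card := by
      rw [Cmd.run_reg e (by simp [copyRow_wregs])]
      simp
    have h3 : kept n ((copyRow 24 0 0 0).run e ((s4.setReg 85 (s.reg 84 - F.card)).setReg 84
        F.card)) = F := by
      ext v
      rw [kept, Finset.mem_filter, hF, Finset.mem_filter, copyRow_arr e (by simp) (by simp) (by simp) _
        (by simpa [z4] using b0) (by simpa [z4] using b0),
        if_pos ⟨rfl, by simp [z4], by omega⟩]
      simp [z4, f9]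
    rw [Keeps, h2, h3]
    exact ⟨⟨rfl, hcds⟩, hlt.le, hcard⟩
  · have h1 : s.reg 84 - F.card = 0 := by omega
    have hrun' : (Cmd.seq (.sub 85 84 83) (.cond 85
        (.seq (.mov 84 83) (copyRow 24 0 0 0)) .skip)).run e s4 = s4.setReg 85 0 := by
      simp [Cmd.run, r84, g4, h1]
    rw [hrun']
    have h2 : (s4.setReg 85 0).reg 84 = s.reg 84 := by simp [r84]
    have h3 : kept n (s4.setReg 85 0) = kept n s := by
      simp [kept, a0]
    rw [Keeps, h2, h3]
    refine ⟨hk, le_rfl, fun k' m' a hm' ha => ?_⟩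
    have := hcard k' m' a hm' ha
    omega

end CapDom

/-! ### Enumeration of the small sets in the order of binary numbers. -/

namespace CapDom

variable {e : Env} {n : ℕ}

/-! ### Enumerating sets

Sets are enumerated in the order of the numbers with the same binary digits. -/

/-- The number whose binary digits are given by `W`. -/
def val (W : Finset ℕ) : ℕ := ∑ v ∈ W, 2 ^ v

theorem val_lt {W : Finset ℕ} {p : ℕ} (h : ∀ v ∈ W, v < p) : val W < 2 ^ p :=
  Nat.geomSum_lt le_rfl h

theorem val_injective : Function.Injective val := Finset.geomSum_injective le_rfl

theorem val_insert {W : Finset ℕ} {v : ℕ} (h : v ∉ W) : val (insert v W) = val W + 2 ^ v := by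
  rw [val, Finset.sum_insert h, add_comm]
  rfl

theorem val_erase {W : Finset ℕ} {v : ℕ} (h : v ∈ W) : val (W.erase v) + 2 ^ v = val W :=
  Finset.sum_erase_add _ _ h

theorem pow_dvd_val {W : Finset ℕ} {p : ℕ} (h : ∀ v ∈ W, p ≤ v) : 2 ^ p ∣ val W :=
  Finset.dvd_sum fun v hv => pow_dvd_pow 2 (h v hv)

/-- If the last `p` bits of `B` are zero, then a number strictly between `val B` and `val B + 2 ^ p`
has the bits of `B` and at least one more. So when `B` already has the maximal cardinality, all of
these may be skipped. -/
theorem card_lt_of_val_lt {B W : Finset ℕ} {p : ℕ} (hB : ∀ v ∈ B, p ≤ v) (h : val B < val W)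
    (h' : val W < val B + 2 ^ p) : B.card < W.card := by
  have h1 : val (W.filter (· < p)) + val (W.filter (¬ · < p)) = val W :=
    Finset.sum_filter_add_sum_filter_not W (· < p) _
  have h2 : val (W.filter (· < p)) < 2 ^ p := val_lt fun v hv => (Finset.mem_filter.1 hv).2
  obtain ⟨x, hx⟩ := pow_dvd_val hB
  obtain ⟨y, hy⟩ := pow_dvd_val (W := W.filter (¬ · < p)) (p := p) fun v hv =>
    not_lt.1 (Finset.mem_filter.1 hv).2
  have h3 : x = y := by
    rcases lt_trichotomy x y with hlt | heq | hlt
    · have : 2 ^ p * (x + 1) ≤ 2 ^ p * y := Nat.mul_le_mul_left _ hlt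
      rw [mul_add, mul_one] at this
      omega
    · exact heq
    · have : 2 ^ p * (y + 1) ≤ 2 ^ p * x := Nat.mul_le_mul_left _ hlt
      rw [mul_add, mul_one] at this
      omega
  -- The parts of both numbers above `p` are the same multiple of `2 ^ p`.
  have h4 : W.filter (¬ · < p) = B := val_injective (by rw [hx, hy, h3])
  have h5 : (W.filter (· < p)).card ≠ 0 := by
    rw [Finset.card_ne_zero, Finset.nonempty_iff_ne_empty]
    intro h0
    rw [h0, h4] at h1
    simp [val] at h1
    simp [val] at h
    omega
  have h6 := Finset.card_filter_add_card_filter_not (s := W) (· < p)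
  rw [h4] at h6
  omega

/-- Flip the bit of the vertex in register `71`, which is in register `74`; the carry is in register
`90`. -/
def flip : Cmd :=
  .seq (.mov 89 0) (.cond 74 (.seq (.store 20 0 71 0) (.mov 90 1)) (.seq (.store 20 0 71 1) (.mov 90 0)))

/-- Flip the bit of the vertex in register `71` if there is a carry, or if no bit has been flipped and
this bit may be the first one: register `89` tells whether no bit has been flipped, and register `87`
whether the set may become larger. -/
def carry : Cmd :=
  .seq (.sub 73 60 71) (.cond 73 (.seq (.load 74 20 0 71)
    (.cond 90 flip (.cond 89 (.cond 87 flip (.cond 74 flip .skip)) .skip))) .skip)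

/-- Go on to the next set. Register `70` tells whether there is one. -/
def advance : Cmd :=
  .seq (.seq (countRow 20 71 73 86) (.seq (.sub 87 88 86) (.seq (.set 89 1) (.set 90 0))))
    (.seq (.rep 71 carry) (.eq 70 90 89))

/-- The invariant for the run of the loop: `B` is the set at the beginning, and all bits up to `j` have
been processed. -/
structure Carry (e : Env) (n M : ℕ) (B : Finset ℕ) (j : ℕ) (s : St) : Prop where
  zero : s.reg 0 = 0
  one : s.reg 1 = 1
  nreg : s.reg 60 = n
  room : s.reg 87 = M - B.card
  carry_le : s.reg 90 ≤ 1
  first_le : s.reg 89 ≤ 1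
  lt : ∀ v ∈ support e.N (s.arr 20 0), v < n
  first : s.reg 89 = 1 → s.reg 90 = 0 ∧ support e.N (s.arr 20 0) = B ∧
    ∀ v < j, v < n → M - B.card = 0 ∧ v ∉ B
  next : s.reg 89 = 0 → (∃ p, (M - B.card ≠ 0 ∨ ∀ v ∈ B, p ≤ v) ∧ (M - B.card ≠ 0 → p = 0) ∧
    val (support e.N (s.arr 20 0)) + s.reg 90 * 2 ^ (min j n) = val B + 2 ^ p) ∧
    (support e.N (s.arr 20 0)).card + s.reg 90 ≤ M

theorem support_setArr_zero {N j : ℕ} {s : St} :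
    support N ((s.setArr 20 0 j 0).arr 20 0) = (support N (s.arr 20 0)).erase j := by
  ext v
  by_cases h : v = j <;> simp [h]

theorem support_setArr_one {N j : ℕ} {s : St} (hj : j < N) :
    support N ((s.setArr 20 0 j 1).arr 20 0) = insert j (support N (s.arr 20 0)) := by
  ext v
  by_cases h : v = j <;> simp [h, hj]

/-- One step of adding `2 ^ p` in binary: a pending `2 ^ j` is absorbed by a zero bit or turns a one
bit into a carry. The cardinality counts the carry as one element, so it does not exceed `M` after
the step. -/
theorem flip_spec {M : ℕ} {B : Finset ℕ} (hN : n ≤ e.N) {j : ℕ} (hjn : j < n) {s : St} (h0 : s.reg 0 = 0)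
    (h1 : s.reg 1 = 1) (h60 : s.reg 60 = n) (h87 : s.reg 87 = M - B.card)
    (h71 : s.reg 71 = j) (h74 : s.reg 74 = s.arr 20 0 j)
    (hlt : ∀ v ∈ support e.N (s.arr 20 0), v < n)
    (h : ∃ p, (M - B.card ≠ 0 ∨ ∀ v ∈ B, p ≤ v) ∧ (M - B.card ≠ 0 → p = 0) ∧
      val (support e.N (s.arr 20 0)) + 2 ^ j = val B + 2 ^ p)
    (hM : (support e.N (s.arr 20 0)).card + 1 ≤ M ∨
      (support e.N (s.arr 20 0)).card ≤ M ∧ s.arr 20 0 j ≠ 0) :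
    Carry e n M B (j + 1) (flip.run e s) := by
  obtain ⟨p, hp1, hp2, hp3⟩ := h
  have b0 : 0 < e.N := by omega
  have hj : j < e.N := by omega
  have hmin : min (j + 1) n = j + 1 := by omega
  by_cases hb : s.arr 20 0 j = 0
  · have hrun : flip.run e s = ((s.setReg 89 0).setArr 20 0 j 1).setReg 90 0 := by
      simp [flip, Cmd.run, h0, h1, h71, h74, hb, b0, hj]
    have hs : support e.N ((flip.run e s).arr 20 0) = insert j (support e.N (s.arr 20 0)) := by
      rw [hrun, St.arr_setReg, support_setArr_one hj]
      rfl
    have hnot : j ∉ support e.N (s.arr 20 0) := by simp [hb]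
    constructor
    · simp [hrun, h0]
    · simp [hrun, h1]
    · simp [hrun, h60]
    · simp [hrun, h87]
    · simp [hrun]
    · simp [hrun]
    · intro v hv
      rw [hs, Finset.mem_insert] at hv
      rcases hv with rfl | hv
      · exact hjn
      · exact hlt v hv
    · simp [hrun]
    · intro _
      rw [hs, val_insert hnot, Finset.card_insert_of_notMem hnot]
      refine ⟨⟨p, hp1, hp2, ?_⟩, ?_⟩
      · simp [hrun, hp3]
      · simp [hrun]
        tauto
  · have hrun : flip.run e s = ((s.setReg 89 0).setArr 20 0 j 0).setReg 90 1 := by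
      simp [flip, Cmd.run, h0, h1, h71, h74, hb, b0, hj]
    have hs : support e.N ((flip.run e s).arr 20 0) = (support e.N (s.arr 20 0)).erase j := by
      rw [hrun, St.arr_setReg, support_setArr_zero]
      rfl
    have hmem : j ∈ support e.N (s.arr 20 0) := by simp [hb, hj]
    have h2 := val_erase hmem
    have h3 := Finset.card_erase_add_one hmem
    constructor
    · simp [hrun, h0]
    · simp [hrun, h1]
    · simp [hrun, h60]
    · simp [hrun, h87]
    · simp [hrun]
    · simp [hrun]
    · intro v hv
      rw [hs] at hv
      exact hlt v (Finset.mem_of_mem_erase hv)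
    · simp [hrun]
    · intro _
      have h4 : (flip.run e s).reg 90 = 1 := by simp [hrun]
      rw [hs, h4, hmin]
      refine ⟨⟨p, hp1, hp2, ?_⟩, by omega⟩
      rw [pow_succ]
      omega

/-- If `B` has room, `1` is added. If not, `2 ^ p` is added, where `p` is the lowest bit of `B`; the
first flip occurs there, and it removes an element before a carry can add one. -/
theorem carry_spec {M : ℕ} {B : Finset ℕ} (hB : B.card ≤ M) (hN : n ≤ e.N) {j : ℕ} (hj : j < e.N) {s : St}
    (h : Carry e n M B j s) : Carry e n M B (j + 1) (carry.run e (s.setReg 71 j)) := by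
  have b0 : 0 < e.N := by omega
  by_cases hjn : j < n
  swap
  · have h1 : n - j = 0 := by omega
    have hrun : carry.run e (s.setReg 71 j) = (s.setReg 71 j).setReg 73 0 := by
      simp [carry, Cmd.run, h.nreg, h1]
    have h2 : min (j + 1) n = min j n := by omega
    rw [hrun]
    exact ⟨by simp [h.zero], by simp [h.one], by simp [h.nreg], by simp [h.room],
      by simp [h.carry_le], by simp [h.first_le], h.lt,
      fun hf => ⟨by simpa using (h.first (by simpa using hf)).1,
        (h.first (by simpa using hf)).2.1, fun v hv hvn =>
          (h.first (by simpa using hf)).2.2 v (by omega) hvn⟩,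
      fun hf => by simpa [h2] using h.next (by simpa using hf)⟩
  have h1 : n - j ≠ 0 := by omega
  have hmin : min j n = j := by omega
  have hmin' : min (j + 1) n = j + 1 := by omega
  set s1 := ((s.setReg 71 j).setReg 73 (n - j)).setReg 74 (s.arr 20 0 j) with hs1
  have hfl := flip_spec (e := e) (M := M) (B := B) hN hjn (s := s1) (by simp [hs1, h.zero])
    (by simp [hs1, h.one]) (by simp [hs1, h.nreg]) (by simp [hs1, h.room]) (by simp [hs1])
    (by simp [hs1]) h.lt
  have hrun : carry.run e (s.setReg 71 j) = (Cmd.cond 90 flip (.cond 89 (.cond 87 flip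
      (.cond 74 flip .skip)) .skip)).run e s1 := by
    simp [carry, Cmd.run, h.nreg, h1, h.zero, hj, b0, hs1]
  rw [hrun]
  have r90 : s1.reg 90 = s.reg 90 := by simp [hs1]
  have r89 : s1.reg 89 = s.reg 89 := by simp [hs1]
  have r87 : s1.reg 87 = s.reg 87 := by simp [hs1]
  have r74 : s1.reg 74 = s.arr 20 0 j := by simp [hs1]
  have hkeep : (s.reg 89 = 1 → M - B.card = 0 ∧ j ∉ B) → s.reg 90 = 0 → Carry e n M B (j + 1) s1 := by
    intro hk hc
    refine ⟨by simp [hs1, h.zero], by simp [hs1, h.one], by simp [hs1, h.nreg], by simp [hs1, h.room],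
      by simp [hs1, h.carry_le], by simp [hs1, h.first_le], h.lt, fun hf => ?_, fun hf => ?_⟩
    · rw [r89] at hf
      obtain ⟨g1, g2, g3⟩ := h.first hf
      refine ⟨by rw [r90, g1], g2, fun v hv hvn => ?_⟩
      rcases Nat.lt_succ_iff_lt_or_eq.1 hv with hv | rfl
      · exact g3 v hv hvn
      · exact hk hf
    · rw [r89] at hf
      have := h.next hf
      rw [hc, zero_mul] at this
      rw [r90, hc, zero_mul]
      exact this
  by_cases hc : s.reg 90 = 0
  swap
  · have hc1 : s.reg 90 = 1 := by have := h.carry_le; omega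
    have hf : s.reg 89 = 0 := by
      by_contra hf
      exact hc (h.first (by have := h.first_le; omega)).1
    obtain ⟨⟨p, g1, g2, g3⟩, g4⟩ := h.next hf
    have : (Cmd.cond 90 flip (.cond 89 (.cond 87 flip (.cond 74 flip .skip)) .skip)).run e s1 =
        flip.run e s1 := by
      simp [Cmd.run, r90, hc]
    rw [this]
    rw [hc1, one_mul, hmin] at g3
    exact hfl ⟨p, g1, g2, g3⟩ (Or.inl (by rw [hc1] at g4; exact g4))
  by_cases hf : s.reg 89 = 0
  · have : (Cmd.cond 90 flip (.cond 89 (.cond 87 flip (.cond 74 flip .skip)) .skip)).run e s1 = s1 := by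
      simp [Cmd.run, r90, hc, r89, hf]
    rw [this]
    exact hkeep (fun h => by omega) hc
  have hf1 : s.reg 89 = 1 := by have := h.first_le; omega
  obtain ⟨g1, g2, g3⟩ := h.first hf1
  by_cases hr : M - B.card = 0
  swap
  · have : (Cmd.cond 90 flip (.cond 89 (.cond 87 flip (.cond 74 flip .skip)) .skip)).run e s1 =
        flip.run e s1 := by
      simp [Cmd.run, r90, hc, r89, hf, r87, h.room, hr]
    rw [this]
    have hj0 : j = 0 := by
      by_contra hj0
      exact hr (g3 0 (by omega) (by omega)).1
    subst hj0
    refine hfl ⟨0, Or.inl hr, fun _ => rfl, ?_⟩ (Or.inl ?_)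
    · have : support e.N (s1.arr 20 0) = B := g2
      rw [this]
    · have : support e.N (s1.arr 20 0) = B := g2
      rw [this]
      omega
  have hjB : j ∈ B ↔ s.arr 20 0 j ≠ 0 := by
    rw [← g2, mem_support]
    simp [hj]
  by_cases hb : s.arr 20 0 j = 0
  · have : (Cmd.cond 90 flip (.cond 89 (.cond 87 flip (.cond 74 flip .skip)) .skip)).run e s1 = s1 := by
      simp [Cmd.run, r90, hc, r89, hf, r87, h.room, hr, r74, hb]
    rw [this]
    exact hkeep (fun _ => ⟨hr, by rw [hjB]; simp [hb]⟩) hc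
  · have : (Cmd.cond 90 flip (.cond 89 (.cond 87 flip (.cond 74 flip .skip)) .skip)).run e s1 =
        flip.run e s1 := by
      simp [Cmd.run, r90, hc, r89, hf, r87, h.room, hr, r74, hb]
    rw [this]
    have hsB : support e.N (s1.arr 20 0) = B := g2
    refine hfl ⟨j, Or.inr fun v hv => ?_, fun h => absurd hr h, by rw [hsB]⟩
      (Or.inr ⟨by rw [hsB]; exact hB, hb⟩)
    by_contra hvj
    exact (g3 v (by omega) (by omega)).2 hv

/-- The successor of `B` among sets of at most `M` elements is obtained by one addition. Stopping
has two causes, a carry out of the top bit, and the degenerate case that nothing could be added. -/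
theorem advance_spec {s : St} {M : ℕ} {B : Finset ℕ} (hn : 0 < n) (hN : n ≤ e.N) (h0 : s.reg 0 = 0)
    (h1 : s.reg 1 = 1) (h60 : s.reg 60 = n) (h88 : s.reg 88 = M)
    (hB : support e.N (s.arr 20 0) = B) (hlt : ∀ v ∈ B, v < n) (hM : B.card ≤ M) :
    let B' := support e.N ((advance.run e s).arr 20 0)
    (advance.run e s).reg 70 = 1 ∧ (∀ v ∈ B', v < n) ∧ B'.card ≤ M ∧ val B < val B' ∧
        (∀ W : Finset ℕ, W.card ≤ M → val B < val W → val B' ≤ val W) ∨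
      (advance.run e s).reg 70 = 0 ∧ ∀ W : Finset ℕ, (∀ v ∈ W, v < n) → W.card ≤ M →
        val W ≤ val B := by
  intro B'
  have b0 : 0 < e.N := by omega
  have g1 := countRow_run e (A := 20) (i := 71) (c := 73) (r := 86) s h0 (by simp)
  have g2 : ∀ r, r ∉ [71, 73, 86] → ((countRow 20 71 73 86).run e s).reg r = s.reg r := fun r hr =>
    Cmd.run_reg e (by simp at hr; simp [countRow, Cmd.wregs, hr]) s
  have g3 : ((countRow 20 71 73 86).run e s).arr = s.arr := by
    funext A
    exact Cmd.run_arr e (by simp [countRow, Cmd.warrs]) s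
  have g1' : ((countRow 20 71 73 86).run e s).reg 86 = B.card := by
    rw [g1, ← hB]
    rfl
  set s1 := (countRow 20 71 73 86).run e s with hs1
  set s2 := ((s1.setReg 87 (M - B.card)).setReg 89 1).setReg 90 0 with hs2
  have hrun : advance.run e s = (Cmd.eq 70 90 89).run e ((Cmd.rep 71 carry).run e s2) := by
    have : (Cmd.seq (countRow 20 71 73 86) (.seq (.sub 87 88 86) (.seq (.set 89 1) (.set 90 0)))).run e s
        = s2 := by
      have h2 : (Cmd.seq (.sub 87 88 86) (.seq (.set 89 1) (.set 90 0))).run e s1 = s2 := by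
        simp [Cmd.run, hs2, g1', g2, h88]
      rw [← h2]
      rfl
    rw [← this]
    rfl
  have hC : Carry e n M B e.N ((Cmd.rep 71 carry).run e s2) :=
    iter_induction (n := e.N) (s := s2) (f := fun j s' => carry.run e (s'.setReg 71 j))
      (fun j s' => Carry e n M B j s')
      ⟨by simp [hs2, g2, h0], by simp [hs2, g2, h1], by simp [hs2, g2, h60], by simp [hs2],
        by simp [hs2], by simp [hs2], by rw [hs2]; simpa [g3, hB] using hlt,
        fun _ => ⟨by simp [hs2], by rw [← hB]; simp [hs2, g3], by simp⟩,
        fun h => by simp [hs2] at h⟩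
      fun j s' hj h => carry_spec hM hN hj h
  set s3 := (Cmd.rep 71 carry).run e s2 with hs3
  have hB' : B' = support e.N (s3.arr 20 0) := by
    simp only [B', hrun]
    simp [Cmd.run]
  have h70 : (advance.run e s).reg 70 = if s3.reg 90 = s3.reg 89 then 1 else 0 := by
    rw [hrun]
    simp [Cmd.run]
  -- No admissible set is skipped: either `p = 0`, or `B` is full and everything in between is too
  -- large.
  have hskip : ∀ p, (M - B.card ≠ 0 ∨ ∀ v ∈ B, p ≤ v) → (M - B.card ≠ 0 → p = 0) →
      ∀ W : Finset ℕ, W.card ≤ M → val B < val W → val B + 2 ^ p ≤ val W := by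
    intro p hp1 hp2 W hW hBW
    by_cases hr : M - B.card = 0
    · by_contra hlt'
      have := card_lt_of_val_lt (hp1.resolve_left (not_not.2 hr)) hBW (not_le.1 hlt')
      omega
    · rw [hp2 hr, pow_zero]
      exact hBW
  have hmin : min e.N n = n := by omega
  have c90 := hC.carry_le
  have c89 := hC.first_le
  by_cases hf : s3.reg 89 = 0
  · obtain ⟨⟨p, p1, p2, p3⟩, p4⟩ := hC.next hf
    rw [← hB', hmin] at p3
    rw [← hB'] at p4
    have hpos : 0 < 2 ^ p := by positivity
    by_cases hc : s3.reg 90 = 0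
    · left
      rw [hc] at p3 p4
      refine ⟨by rw [h70, hc, hf, if_pos rfl], fun v hv => hC.lt v (hB' ▸ hv), p4, by omega, ?_⟩
      intro W hW hBW
      have := hskip p p1 p2 W hW hBW
      omega
    · right
      -- The sum needs bit `n`, so no admissible subset of the `n` vertices follows `B`.
      have hc1 : s3.reg 90 = 1 := by omega
      rw [hc1] at p3
      refine ⟨by rw [h70, hc1, hf, if_neg (by simp)], fun W hW hWM => ?_⟩
      by_contra hBW
      have := hskip p p1 p2 W hWM (not_le.1 hBW)
      have := val_lt hW
      omega
  · right
    have hf1 : s3.reg 89 = 1 := by omega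
    obtain ⟨p1, p2, p3⟩ := hC.first hf1
    refine ⟨by rw [h70, p1, hf1, if_neg (by simp)], fun W hW hWM => ?_⟩
    -- No bit has been flipped: there is no room, and `B` is empty, so that `M = 0` and the empty
    -- set is the only candidate.
    have q1 := (p3 0 (by omega) hn).1
    have q2 : B = ∅ := Finset.eq_empty_of_forall_notMem fun v hv =>
      (p3 v (by have := hlt v hv; omega) (hlt v hv)).2 hv
    rw [q2, Finset.card_empty] at q1
    have q3 : W = ∅ := Finset.card_eq_zero.1 (by omega)
    simp [q3, val]

end CapDom

namespace CapDom

variable {e : Env} {n : ℕ} {G : SimpleGraph (Fin n)} {c : Fin n → ℕ}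

/-! ### The search -/

/-- The sets of at most `(n + 5) / 6` vertices. -/
def smallSets (n : ℕ) : Finset (Finset ℕ) :=
  (Finset.range n).powerset.filter fun W => W.card ≤ (n + 5) / 6

theorem mem_smallSets {W : Finset ℕ} :
    W ∈ smallSets n ↔ (∀ v ∈ W, v < n) ∧ W.card ≤ (n + 5) / 6 := by
  simp [smallSets, Finset.subset_iff]

/-- A set of `b` vertices is as good as what the matchings for `W` yield. -/
def Beats (G : SimpleGraph (Fin n)) (c : Fin n → ℕ) (W : Finset ℕ) (b : ℕ) : Prop :=
  ∀ k m a, IsMatch (n * n) (copyAdj G c W) k m → k + 2 * a = n * n → b + a ≤ n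

theorem Beats.mono {W : Finset ℕ} {b b' : ℕ} (h : Beats G c W b) (hb : b' ≤ b) : Beats G c W b' :=
  fun k m a hm ha => (Nat.add_le_add_right hb a).trans (h k m a hm ha)

/-- All sets before the set in array `20` have been tried. -/
structure Search (e : Env) (G : SimpleGraph (Fin n)) (c : Fin n → ℕ) (s : St) : Prop where
  tables : Tables e n s
  keeps : Keeps G c s
  mem : support e.N (s.arr 20 0) ∈ smallSets n
  tried : ∀ W ∈ smallSets n, val W < val (support e.N (s.arr 20 0)) → Beats G c W (s.reg 84)

/-- All sets have been tried. -/
structure Searched (G : SimpleGraph (Fin n)) (c : Fin n → ℕ) (s : St) : Prop where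
  keeps : Keeps G c s
  tried : ∀ W ∈ smallSets n, Beats G c W (s.reg 84)

/-- Try the current set, and go on to the next one. -/
def body : Cmd := .seq evaluate advance

theorem Keeps.frame {s s' : St} (h : Keeps G c s) (hr : s'.reg 84 = s.reg 84) (ha : s'.arr 0 = s.arr 0) :
    Keeps G c s' := by
  have : kept n s' = kept n s := by simp [kept, ha]
  rw [Keeps, this, hr]
  exact h

/-- One round extends the verified range of sets by the current one. As `advance` finds the
immediate successor, nothing remains untried before the new set; if there is no successor, the
search is complete. -/
theorem body_spec (he : Presents e G c) (hn : 0 < n) {s : St} (h : Search e G c s) :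
    (body.run e s).reg 70 ≠ 0 ∧ Search e G c (body.run e s) ∧
        val (support e.N (s.arr 20 0)) < val (support e.N ((body.run e s).arr 20 0)) ∨
      (body.run e s).reg 70 = 0 ∧ Searched G c (body.run e s) := by
  have hnN : n ≤ e.N := he.size ▸ Nat.le_mul_self n
  obtain ⟨h1, h2⟩ := mem_smallSets.1 h.mem
  obtain ⟨g1, g2, g3, g4, g5⟩ := evaluate_spec (U := ↑(support e.N (s.arr 20 0))) he hn h.tables
    (fun v hv => by
      rw [Finset.mem_coe, mem_support]
      exact ⟨fun h => ⟨by omega, h⟩, fun h => h.2⟩) h.keeps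
  set B := support e.N (s.arr 20 0) with hB
  have hrun : body.run e s = advance.run e (evaluate.run e s) := rfl
  rw [hrun]
  set s1 := evaluate.run e s with hs1
  have f1 : ∀ r, r ∉ [70, 71, 73, 74, 86, 87, 89, 90] → (advance.run e s1).reg r = s1.reg r :=
    fun r hr => Cmd.run_reg e (by
      simp at hr
      simp [advance, countRow, carry, flip, Cmd.wregs, hr]) s1
  have f2 : ∀ A, A ≠ 20 → (advance.run e s1).arr A = s1.arr A := fun A hA =>
    Cmd.run_arr e (by simp [advance, countRow, carry, flip, Cmd.warrs, hA]) s1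
  have f3 : Keeps G c (advance.run e s1) := g3.frame (f1 84 (by simp)) (f2 0 (by simp))
  have f4 : Tables e n (advance.run e s1) :=
    g1.frame (fun r hr => f1 r (by simp; omega)) fun A hA => f2 A (by omega)
  have f5 : ∀ W ∈ smallSets n, val W ≤ val B → Beats G c W ((advance.run e s1).reg 84) := by
    intro W hW hle
    rw [f1 84 (by simp)]
    rcases hle.lt_or_eq with hlt | heq
    · exact (h.tried W hW hlt).mono g4
    · rw [val_injective heq]
      exact g5
  rcases advance_spec (s := s1) (B := B) hn hnN g1.zero g1.one g1.nreg g1.bound (by rw [g2]) h1 h2 with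
    ⟨p1, p2, p3, p4, p5⟩ | ⟨p1, p2⟩
  · left
    refine ⟨by rw [p1]; simp, ⟨f4, f3, mem_smallSets.2 ⟨p2, p3⟩, fun W hW hlt => ?_⟩, p4⟩
    refine f5 W hW (not_lt.1 fun hlt' => ?_)
    exact absurd (p5 W (mem_smallSets.1 hW).2 hlt') (not_le.2 hlt)
  · right
    exact ⟨p1, f3, fun W hW => f5 W hW (p2 W (mem_smallSets.1 hW).1 (mem_smallSets.1 hW).2)⟩

/-- For the graph without vertices no inner loop runs at all, so termination of the search needs a
separate argument. -/
theorem body_zero (hN : e.N = 0) (s : St) : (body.run e s).reg 70 = 0 := by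
  simp [body, advance, Cmd.run, hN, iter, countRow]

theorem setUp_search (he : Presents e G c) (hn : 0 < n) {s : St}
    (hs : ∀ r, s.reg r = if r = 60 then n else 0) (ha : s.arr 20 0 = fun _ => 0) :
    (setUp.run e s).reg 70 ≠ 0 ∧ Search e G c (setUp.run e s) := by
  obtain ⟨h1, h2, h3, h4, h5⟩ := setUp_spec he.size hn hs
  have hk : kept n (setUp.run e s) = Finset.univ := by
    ext v
    simp [kept, h4 v v.2]
  have hB : support e.N ((setUp.run e s).arr 20 0) = ∅ := by
    ext v
    simp [h5, ha]
  refine ⟨by rw [h3]; simp, h1, ⟨by rw [hk, h2]; simp, by rw [hk]; exact isCapDomSet_univ G c⟩, ?_, ?_⟩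
  · rw [hB, mem_smallSets]
    simp
  · rw [hB]
    simp [val]

/-- The set `U` from `exists_good_matching` is among those tried, and a set that beats its matching
meets the guarantee. -/
theorem Searched.le {s : St} (h : Searched G c s) : 3 * (kept n s).card ≤ 5 * capDomNumber G c := by
  obtain ⟨U, hU, k, m, hm, a, ha, hle⟩ := exists_good_matching G c
  have hW : U.map Fin.valEmbedding ∈ smallSets n := by
    rw [mem_smallSets, Finset.card_map]
    refine ⟨fun v hv => ?_, hU⟩
    obtain ⟨u, -, rfl⟩ := Finset.mem_map.1 hv
    exact u.2
  have hset : {v : ℕ | ∃ u ∈ U, (u : ℕ) = v} = ↑(U.map Fin.valEmbedding) := by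
    ext v
    simp
  rw [hset] at hm
  have := h.tried _ hW k m a hm ha
  rw [← h.keeps.1]
  omega

/-! ### The machine program -/

/-- The natural number that indexes the invariant is a variant: it drops by one in each round, and
so bounds the number of rounds. The loop may stop earlier. -/
theorem Exec.loop {b C r : ℕ} {B : Prog} (I : ℕ → Memory → Prop) (F : Memory → Prop)
    (hw : ∀ j m, I j m → m.Within b)
    (h : ∀ j m, I j m → m.reg r = 0 ∧ F m ∨
      m.reg r ≠ 0 ∧ ∃ i, j = i + 1 ∧ ∀ l, ∃ m', Exec b C ⟨B :: l, m⟩ ⟨l, m'⟩ ∧ I i m') :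
    ∀ j m, I j m → ∀ l, ∃ m', Exec b (j * (C + 1) + 1) ⟨.loop r B :: l, m⟩ ⟨l, m'⟩ ∧
      m'.Within b ∧ F m' := by
  intro j
  induction j with
  | zero =>
    intro m hm l
    rcases h 0 m hm with ⟨h1, h2⟩ | ⟨-, i, hi, -⟩
    · refine ⟨m, (Exec.head (hw _ _ hm) (T := 0) ?_).mono (by omega), hw _ _ hm, h2⟩
      simp only [Config.step, h1]
      exact Exec.refl (hw _ _ hm)
    · omega
  | succ j ih =>
    intro m hm l
    rcases h _ m hm with ⟨h1, h2⟩ | ⟨h1, i, hi, h2⟩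
    · refine ⟨m, (Exec.head (hw _ _ hm) (T := 0) ?_).mono (by omega), hw _ _ hm, h2⟩
      simp only [Config.step, h1]
      exact Exec.refl (hw _ _ hm)
    · obtain rfl : j = i := by omega
      obtain ⟨m1, e1, i1⟩ := h2 (.loop r B :: l)
      obtain ⟨m2, e2, w2, f2⟩ := ih m1 i1 l
      refine ⟨m2, ?_, w2, f2⟩
      have step : Exec b (C + 1) ⟨.loop r B :: l, m⟩ ⟨.loop r B :: l, m1⟩ := by
        refine Exec.head (hw _ _ hm) ?_
        simp only [Config.step]
        rw [if_pos h1]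
        exact e1
      refine (step.trans e2).mono ?_
      rw [add_one_mul]
      omega

/-- The variant is a bound for the number of small sets not smaller, as binary numbers, than the
current one. It decreases because the values strictly increase. -/
theorem search_exec {b : ℕ} (hb : e.N * e.N + 2 * e.N + 40 ≤ b) (hadj : ∀ i, e.adj i ≤ 1)
    (he : Presents e G c) {s : St} {m : Memory} (hr : Rel e s m) (hm : m.Within b)
    (h : 0 < n → s.reg 70 ≠ 0 ∧ Search e G c s) (l : List Prog) :
    ∃ s' m', Exec b (((smallSets n).card + 1) * (body.cost e.N + 1) + 1)
      ⟨.loop 150 (body.compile 0) :: l, m⟩ ⟨l, m'⟩ ∧ Rel e s' m' ∧ (0 < n → Searched G c s') := by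
  have key := Exec.loop (b := b) (C := body.cost e.N) (r := 150) (B := body.compile 0)
    (fun j m => m.Within b ∧ ∃ s, Rel e s m ∧ (s.reg 70 = 0 ∧ (0 < n → Searched G c s) ∨
      s.reg 70 ≠ 0 ∧ 0 < j ∧ (0 < n → Search e G c s ∧
        ((smallSets n).filter fun W => val (support e.N (s.arr 20 0)) ≤ val W).card ≤ j)))
    (fun m => ∃ s, Rel e s m ∧ (0 < n → Searched G c s)) (fun _ _ h => h.1) ?_
    ((smallSets n).card + 1) m ⟨hm, s, hr, ?_⟩ l
  · obtain ⟨m', e', -, s', r', f'⟩ := key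
    exact ⟨s', m', e', r', f'⟩
  · rintro j m ⟨hm, s, hr, ⟨h1, h2⟩ | ⟨h1, hj, h2⟩⟩
    · exact Or.inl ⟨by rw [hr.reg 70, h1], s, hr, h2⟩
    · refine Or.inr ⟨by rw [hr.reg 70]; exact h1, j - 1, by omega, fun l => ?_⟩
      obtain ⟨m', e', r', -⟩ := simulates e b hb hadj body 0 s m hr hm l
      refine ⟨m', e', e'.within_right, body.run e s, r', ?_⟩
      by_cases hn : 0 < n
      swap
      · have hN : e.N = 0 := by
          rw [he.size]
          obtain rfl : n = 0 := by omega
          rfl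
        exact Or.inl ⟨body_zero hN s, fun h => absurd h hn⟩
      obtain ⟨g1, g2⟩ := h2 hn
      rcases body_spec he hn g1 with ⟨p1, p2, p3⟩ | ⟨p1, p2⟩
      · refine Or.inr ⟨p1, ?_, fun _ => ⟨p2, ?_⟩⟩
        all_goals
          have q1 := Finset.card_lt_card (s := (smallSets n).filter fun W =>
              val (support e.N ((body.run e s).arr 20 0)) ≤ val W)
            (t := (smallSets n).filter fun W => val (support e.N (s.arr 20 0)) ≤ val W) (by
              rw [Finset.ssubset_iff_of_subset]
              · exact ⟨_, Finset.mem_filter.2 ⟨g1.mem, le_rfl⟩, fun h =>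
                  absurd (Finset.mem_filter.1 h).2 (not_le.2 p3)⟩
              · intro W hW
                rw [Finset.mem_filter] at hW ⊢
                exact ⟨hW.1, p3.le.trans hW.2⟩)
        · have q2 : 0 < ((smallSets n).filter fun W =>
              val (support e.N ((body.run e s).arr 20 0)) ≤ val W).card :=
            Finset.card_pos.2 ⟨_, Finset.mem_filter.2 ⟨p2.mem, le_rfl⟩⟩
          omega
        · omega
      · exact Or.inl ⟨p1, fun _ => p2⟩
  · by_cases h70 : s.reg 70 = 0
    · exact Or.inl ⟨h70, fun hn => absurd h70 (h hn).1⟩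
    · exact Or.inr ⟨h70, by omega, fun hn => ⟨(h hn).2,
        (Finset.card_filter_le _ _).trans (by omega)⟩⟩

end CapDom

/-! ### The complete machine program. -/

namespace CapDom

variable {n : ℕ}

/-- Compute the square of `n` and its multiples. -/
def prelude : Prog :=
  .seq (blk [.const 6 1, .add 130 0 5, .add 7 0 5])
    (.seq (.loop 7 (blk [.add 1 1 0, .sub 7 7 6])) (.seq (blk [.add 7 1 5])
      (.loop 7 (blk [.store 3 9 8, .add 8 8 1, .add 9 9 6, .sub 7 7 6]))))

/-- The program for the capacitated dominating set problem. -/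
def program : Prog := .seq prelude (.seq (setUp.compile 0) (.loop 150 (body.compile 0)))

/-- Register `1` is being computed. -/
structure Squaring (b n : ℕ) (m₀ : Memory) (j : ℕ) (m : Memory) : Prop where
  within : m.Within b
  arr : m.arr = m₀.arr
  reg_zero : m.reg 0 = n
  reg_five : m.reg 5 = 0
  reg_six : m.reg 6 = 1
  reg_seven : m.reg 7 = j
  reg_eight : m.reg 8 = 0
  reg_nine : m.reg 9 = 0
  reg_one : m.reg 1 + j * n = n * n
  reg : ∀ r, m.reg (2 * r + 10) = if r = 60 then n else 0

/-- Array `3` is being computed. -/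
structure Tabulating (b n : ℕ) (m₀ : Memory) (j : ℕ) (m : Memory) : Prop where
  within : m.Within b
  arr : ∀ A, A ≠ 3 → m.arr A = m₀.arr A
  reg_one : m.reg 1 = n * n
  reg_five : m.reg 5 = 0
  reg_six : m.reg 6 = 1
  reg_seven : m.reg 7 = j
  le : j ≤ n * n
  reg_nine : m.reg 9 = n * n - j
  reg_eight : m.reg 8 = (n * n - j) * (n * n)
  mul : ∀ i < n * n - j, m.arr 3 i = i * (n * n)
  reg : ∀ r, m.reg (2 * r + 10) = if r = 60 then n else 0

/-- The machine has no multiplication, so `n²` and the table of its multiples, needed to address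
two-dimensional arrays, are found by repeated addition. Register `130` is register `60` of the
state. The input arrays stay in place, since the state uses the even arrays from `2` on. -/
theorem prelude_exec {b : ℕ} {m₀ : Memory} (hm : m₀.Within b) (hr : ∀ r, m₀.reg r = if r = 0 then n else 0)
    (ha : ∀ A i, 2 ≤ A → m₀.arr A i = 0) (hb : n * n * (n * n) + 2 * (n * n) + 40 ≤ b)
    (l : List Prog) :
    ∃ m', Exec b (n * 6 + n * n * 10 + 30) ⟨prelude :: l, m₀⟩ ⟨l, m'⟩ ∧
      Rel ⟨n * n, m₀.arr 0, m₀.arr 1⟩ ⟨fun r => if r = 60 then n else 0, fun _ _ _ => 0⟩ m' := by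
  have hnn : n ≤ n * n := Nat.le_mul_self n
  have sz : ∀ x, x ≤ n * n * (n * n) + 2 * (n * n) + 40 → x.size ≤ b := fun x hx =>
    size_le_of_le (hx.trans hb)
  set m₁ := ((m₀.setReg 6 1).setReg 130 n).setReg 7 n with hm₁
  have w₁ : m₁.Within b := ((hm.setReg (sz _ (by omega))).setReg (sz _ (by omega))).setReg
    (sz _ (by omega))
  have e₁ : ∀ l, Exec b 7 ⟨blk [.const 6 1, .add 130 0 5, .add 7 0 5] :: l, m₀⟩ ⟨l, m₁⟩ := by
    intro l
    have := Exec.blk (b := b) (l := l) [.const 6 1, .add 130 0 5, .add 7 0 5] hm (by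
      have h1 := sz 1 (by omega)
      have h2 := sz n (by omega)
      simp [Safe, Memory.reg_setReg, hr]
      all_goals with_reducible repeat' (first | assumption | apply Memory.Within.setReg | apply And.intro))
    simpa [Memory.reg_setReg, hr, hm₁] using this
  obtain ⟨m₂, e₂, -, i₂⟩ := Exec.loop (b := b) (C := 5) (r := 7) (B := blk [.add 1 1 0, .sub 7 7 6])
    (Squaring b n m₀) (Squaring b n m₀ 0) (fun _ _ h => h.within) (by
      intro j m h
      rcases j with _ | j
      · exact Or.inl ⟨h.reg_seven, h⟩
      refine Or.inr ⟨by rw [h.reg_seven]; omega, j, rfl, fun l => ?_⟩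
      have h1 := h.reg_one
      rw [add_one_mul] at h1
      have w : ((m.setReg 1 (m.reg 1 + n)).setReg 7 j).Within b :=
        (h.within.setReg (sz _ (by omega))).setReg (size_mono (y := j + 1) (by omega)
          (by rw [← h.reg_seven]; exact h.within.1 7))
      refine ⟨(m.setReg 1 (m.reg 1 + n)).setReg 7 j, ?_, w, h.arr, ?_, ?_, ?_, ?_, ?_, ?_, ?_, ?_⟩
      · have := Exec.blk (b := b) (l := l) [.add 1 1 0, .sub 7 7 6] h.within (by
          have h2 := sz (m.reg 1 + n) (by omega)
          have h3 := h.within.setReg (r := 1) h2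
          simp [Safe, Memory.reg_setReg, h.reg_zero, h.reg_six, h.reg_seven, h3, w])
        simpa [Memory.reg_setReg, h.reg_zero, h.reg_six, h.reg_seven] using this
      pick_goal 8
      · intro r
        rw [Memory.reg_setReg, if_neg (by omega), Memory.reg_setReg, if_neg (by omega), h.reg]
      all_goals simp [Memory.reg_setReg, h.reg_zero, h.reg_five, h.reg_six, h.reg_eight, h.reg_nine]
      omega) n m₁
    ⟨w₁, rfl, by simp [hm₁, Memory.reg_setReg, hr], by simp [hm₁, Memory.reg_setReg, hr],
      by simp [hm₁, Memory.reg_setReg], by simp [hm₁, Memory.reg_setReg],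
      by simp [hm₁, Memory.reg_setReg, hr], by simp [hm₁, Memory.reg_setReg, hr],
      by simp [hm₁, Memory.reg_setReg, hr], fun r => by
        rw [hm₁, Memory.reg_setReg, if_neg (by omega), Memory.reg_setReg, Memory.reg_setReg,
          if_neg (by omega : ¬ 2 * r + 10 = 6), hr, if_neg (by omega : ¬ 2 * r + 10 = 0)]
        exact if_congr (by omega) rfl rfl⟩
    (.seq (blk [.add 7 1 5])
      (.loop 7 (blk [.store 3 9 8, .add 8 8 1, .add 9 9 6, .sub 7 7 6])) :: l)
  have hN : m₂.reg 1 = n * n := by simpa using i₂.reg_one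
  have w₃ : (m₂.setReg 7 (n * n)).Within b := i₂.within.setReg (sz _ (by omega))
  have e₃ : ∀ l, Exec b 3 ⟨blk [.add 7 1 5] :: l, m₂⟩ ⟨l, m₂.setReg 7 (n * n)⟩ := by
    intro l
    have := Exec.blk (b := b) (l := l) [.add 7 1 5] i₂.within (by
      simp [Safe, hN, i₂.reg_five, w₃])
    simpa [hN, i₂.reg_five] using this
  obtain ⟨m₄, e₄, -, i₄⟩ := Exec.loop (b := b) (C := 9) (r := 7)
    (B := blk [.store 3 9 8, .add 8 8 1, .add 9 9 6, .sub 7 7 6])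
    (Tabulating b n m₀) (Tabulating b n m₀ 0) (fun _ _ h => h.within) (by
      intro j m h
      rcases j with _ | j
      · exact Or.inl ⟨h.reg_seven, h⟩
      refine Or.inr ⟨by rw [h.reg_seven]; omega, j, rfl, fun l => ?_⟩
      have hle := h.le
      obtain ⟨i, hi⟩ : ∃ i, n * n = i + (j + 1) := ⟨n * n - (j + 1), by omega⟩
      have h8 := h.reg_eight
      have h9 := h.reg_nine
      have hi' : n * n - (j + 1) = i := by omega
      have hi'' : n * n - j = i + 1 := by omega
      have hmul := h.mul
      rw [hi'] at h8 h9 hmul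
      have hsq : (i + 1) * (n * n) ≤ n * n * (n * n) := Nat.mul_le_mul_right _ (by omega)
      have hsq' : (i + 1) * (n * n) = i * (n * n) + n * n := by ring
      have z1 := sz (i * (n * n)) (by omega)
      have z2 := sz ((i + 1) * (n * n)) (by omega)
      have z3 := sz (i + 1) (by omega)
      have z4 := sz j (by omega)
      have y1 := h.within.setArr (A := 3) (i := i) z1 (by omega)
      have y2 := y1.setReg (r := 8) z2
      have y3 := y2.setReg (r := 9) z3
      have y4 := y3.setReg (r := 7) z4
      refine ⟨_, ?_, y4, ?_, ?_, ?_, ?_, ?_, by omega, ?_, ?_, ?_, ?_⟩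
      · have := Exec.blk (b := b) (l := l) [.store 3 9 8, .add 8 8 1, .add 9 9 6, .sub 7 7 6]
          h.within (by
          simp [Safe, Memory.reg_setReg, Memory.reg_setArr, h.reg_one, h.reg_six, h.reg_seven, h8, h9,
            ← hsq', y1, y2, y3, y4])
        simpa [Memory.reg_setReg, Memory.reg_setArr, h.reg_one, h.reg_six, h.reg_seven, h8, h9,
            ← hsq'] using this
      · intro A hA
        rw [← h.arr A hA]
        funext x
        simp [Memory.arr_setReg, Memory.arr_setArr, hA]
      · simp [Memory.reg_setReg, Memory.reg_setArr, h.reg_one]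
      · simp [Memory.reg_setReg, Memory.reg_setArr, h.reg_five]
      · simp [Memory.reg_setReg, Memory.reg_setArr, h.reg_six]
      · simp [Memory.reg_setReg]
      · simp [Memory.reg_setReg, hi'']
      · simp [Memory.reg_setReg, hi'']
      · intro x hx
        rw [hi''] at hx
        simp only [Memory.arr_setReg, Memory.arr_setArr, true_and]
        split_ifs with hxi
        · rw [hxi]
        · exact hmul x (by omega)
      · intro r
        simp only [Memory.reg_setReg, Memory.reg_setArr]
        rw [if_neg (by omega), if_neg (by omega), if_neg (by omega), h.reg]) (n * n)
    (m₂.setReg 7 (n * n))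
    ⟨w₃, fun A _ => by rw [Memory.arr_setReg, i₂.arr], by simp [Memory.reg_setReg, hN],
      by simp [Memory.reg_setReg, i₂.reg_five], by simp [Memory.reg_setReg, i₂.reg_six],
      by simp [Memory.reg_setReg], le_rfl, by simp [Memory.reg_setReg, i₂.reg_nine],
      by simp [Memory.reg_setReg, i₂.reg_eight], fun i hi => by omega, fun r => by
        rw [Memory.reg_setReg, if_neg (by omega), i₂.reg]⟩ l
  refine ⟨m₄, (Exec.seq hm (e₁ _) (Exec.seq w₁ e₂ (Exec.seq i₂.within (e₃ _) e₄))).mono (by omega),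
    i₄.reg_one, i₄.reg_five, i₄.arr 0 (by simp), i₄.arr 1 (by simp), by simpa using i₄.mul,
    i₄.reg, fun A i j hi hj => ?_, fun r => ?_, fun A i j hi hj => by simp⟩
  · rw [i₄.arr _ (by omega), ha _ _ (by omega)]
  · dsimp only
    split_ifs <;> omega

end CapDom

/-! ### Counting the small sets, the time bound, and the conclusion. -/

namespace CapDom

variable {n : ℕ}

/-! ### The running time -/

/-- A bound for the running time of the program. -/
def time (n : ℕ) : ℕ :=
  n * 6 + n * n * 10 + 30 + (setUp.cost (n * n) +
    (((smallSets n).card + 1) * (body.cost (n * n) + 1) + 1) + 1) + 1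

/-- Each small set has weight at least `5 ^ (-⌈n/6⌉)`, and all subsets together have weight `(1 +
1/5) ^ n`. The weight `1/5` is the odds of density `1/6`. -/
theorem card_smallSets_le (n : ℕ) : ((smallSets n).card : ℝ) ≤ 8 * 1.5696 ^ n := by
  have h1 : ∑ W ∈ (Finset.range n).powerset, (1 / 5 : ℝ) ^ W.card = (6 / 5) ^ n := by
    have := Finset.sum_pow_mul_eq_add_pow (1 / 5 : ℝ) 1 (Finset.range n)
    simp only [one_pow, mul_one, Finset.card_range] at this
    rw [this]
    norm_num
  have h2 : ((smallSets n).card : ℝ) * (1 / 5) ^ ((n + 5) / 6) ≤ (6 / 5) ^ n := by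
    rw [← h1, ← nsmul_eq_mul, ← Finset.sum_const]
    calc ∑ _W ∈ smallSets n, (1 / 5 : ℝ) ^ ((n + 5) / 6)
        ≤ ∑ W ∈ smallSets n, (1 / 5 : ℝ) ^ W.card := Finset.sum_le_sum fun W hW =>
          pow_le_pow_of_le_one (by norm_num) (by norm_num) (Finset.mem_filter.1 hW).2
      _ ≤ _ := Finset.sum_le_sum_of_subset_of_nonneg (Finset.filter_subset _ _)
          fun W _ _ => by positivity
  -- `1.308` slightly exceeds the sixth root of `5`; the rounding in `⌈n/6⌉` costs at most the
  -- factor `1.308 ^ 5`, which is below `8`.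
  have h3 : (5 : ℝ) ^ ((n + 5) / 6) ≤ 1.308 ^ 5 * 1.308 ^ n := by
    calc (5 : ℝ) ^ ((n + 5) / 6) ≤ (1.308 ^ 6) ^ ((n + 5) / 6) :=
          pow_le_pow_left₀ (by norm_num) (by norm_num) _
      _ = 1.308 ^ (6 * ((n + 5) / 6)) := by rw [pow_mul]
      _ ≤ 1.308 ^ (5 + n) := pow_le_pow_right₀ (by norm_num) (by omega)
      _ = _ := pow_add _ _ _
  calc ((smallSets n).card : ℝ)
      = ((smallSets n).card : ℝ) * (1 / 5) ^ ((n + 5) / 6) * 5 ^ ((n + 5) / 6) := by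
        rw [mul_assoc, ← mul_pow]
        norm_num
    _ ≤ (6 / 5) ^ n * (1.308 ^ 5 * 1.308 ^ n) := mul_le_mul h2 h3 (by positivity) (by positivity)
    _ = 1.308 ^ 5 * 1.5696 ^ n := by
        rw [mul_left_comm, ← mul_pow]
        norm_num
    _ ≤ _ := mul_le_mul_of_nonneg_right (by norm_num) (by positivity)

theorem time_le : ∃ C k : ℕ, ∀ n, time n ≤ C * (n * n + 1) ^ k * ((smallSets n).card + 1) := by
  obtain ⟨C, k, h⟩ := Cmd.cost_le setUp
  obtain ⟨C', k', h'⟩ := Cmd.cost_le body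
  refine ⟨C + C' + 60, k + k' + 1, fun n => ?_⟩
  set M := n * n + 1 with hM
  set Q := M ^ (k + k' + 1) with hQ
  set K := (smallSets n).card + 1 with hK
  have hnn : n ≤ n * n := Nat.le_mul_self n
  have p1 : M ^ k ≤ Q := Nat.pow_le_pow_right (by omega) (by omega)
  have p2 : M ^ k' ≤ Q := Nat.pow_le_pow_right (by omega) (by omega)
  have p3 : M ≤ Q := by
    calc M = M ^ 1 := (pow_one _).symm
      _ ≤ Q := Nat.pow_le_pow_right (by omega) (by omega)
  have h1 := (h (n * n)).trans (Nat.mul_le_mul_left C p1)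
  have h2 := (h' (n * n)).trans (Nat.mul_le_mul_left C' p2)
  have h3 : time n ≤ (C * Q + 58 * Q) * K + (C' * Q + 2 * Q) * K := by
    have h4 : K * (body.cost (n * n) + 1) ≤ (C' * Q + Q) * K := by
      rw [mul_comm]
      exact Nat.mul_le_mul_right _ (by omega)
    have h5 : C * Q + 58 * Q ≤ (C * Q + 58 * Q) * K := Nat.le_mul_of_pos_right _ (by omega)
    have h6 : (C' * Q + 2 * Q) * K = (C' * Q + Q) * K + Q * K := by ring
    rw [time, ← hK]
    omega
  calc time n ≤ _ := h3
    _ = (C + C' + 60) * Q * K := by ring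

theorem time_isBigO : (fun n => (time n : ℝ)) =O[atTop] fun n => (1.57 : ℝ) ^ n := by
  obtain ⟨C, k, h⟩ := time_le
  -- The polynomial factor is absorbed by the gap between `1.5696 = 1.2 · 1.308` and `1.57`.
  have h1 : (fun n : ℕ => (n : ℝ) ^ (2 * k) * (1.5696 : ℝ) ^ n) =O[atTop] fun n => (1.57 : ℝ) ^ n :=
    (isLittleO_pow_const_mul_const_pow_const_pow_of_norm_lt (2 * k) (by norm_num)).isBigO
  refine IsBigO.trans (IsBigO.of_bound (C * 2 ^ k * 9) ?_) h1
  filter_upwards [eventually_ge_atTop 1] with n hn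
  have hn' : (1 : ℝ) ≤ n := by exact_mod_cast hn
  have h2 : (time n : ℝ) ≤ C * (n * n + 1) ^ k * ((smallSets n).card + 1) := by exact_mod_cast h n
  have h3 := card_smallSets_le n
  have h4 : (1 : ℝ) ≤ 1.5696 ^ n := one_le_pow₀ (by norm_num)
  have h5 : ((n : ℝ) * n + 1) ^ k ≤ 2 ^ k * n ^ (2 * k) := by
    rw [pow_mul, ← mul_pow]
    exact pow_le_pow_left₀ (by positivity) (by nlinarith) _
  rw [Real.norm_of_nonneg (by positivity), Real.norm_of_nonneg (by positivity)]
  calc (time n : ℝ) ≤ C * (n * n + 1) ^ k * ((smallSets n).card + 1) := h2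
    _ ≤ C * (2 ^ k * n ^ (2 * k)) * (9 * 1.5696 ^ n) :=
        mul_le_mul (mul_le_mul_of_nonneg_left h5 (by positivity)) (by linarith) (by positivity)
          (by positivity)
    _ = _ := by ring

/-! ### Correctness -/

variable (G : SimpleGraph (Fin n)) (c : Fin n → ℕ)

/-- The environment in which the commands of the program are run. -/
noncomputable def inputEnv : Env := ⟨n * n, (inputMemory G c).arr 0, (inputMemory G c).arr 1⟩

theorem presents_inputEnv : Presents (inputEnv G c) G c where
  size := rfl
  cap := by
    funext v
    simp [inputEnv, inputMemory, gcap]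
  adj u hu v hv := by
    simp only [inputEnv, inputMemory, gadj]
    simp only [one_ne_zero, if_false, if_true, ne_eq, ite_eq_right_iff, Classical.not_imp,
      not_false_eq_true, and_true]
    constructor
    · rintro ⟨u', v', h, h'⟩
      obtain ⟨rfl, rfl⟩ := (index_inj hv v'.2).1 h'
      exact ⟨hu, hv, h⟩
    · rintro ⟨hu, hv, h⟩
      exact ⟨⟨u, hu⟩, ⟨v, hv⟩, h, rfl⟩

theorem inputEnv_adj_le (i : ℕ) : (inputEnv G c).adj i ≤ 1 := by
  simp only [inputEnv, inputMemory]
  split_ifs <;> simp_all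

theorem inputMemory_within {b : ℕ} (hb : inputSize c + 1 ≤ b) : (inputMemory G c).Within b := by
  have hn : n * n ≤ inputSize c := by
    rw [inputSize, pow_two]
    omega
  have hnn : n ≤ n * n := Nat.le_mul_self n
  have hc : ∀ v, (c v).size ≤ b := by
    intro v
    have : (c v).size ≤ ∑ v, (c v).size :=
      Finset.single_le_sum (f := fun v => (c v).size) (fun _ _ => Nat.zero_le _) (Finset.mem_univ v)
    rw [inputSize] at hb
    omega
  refine ⟨fun r => ?_, fun A i => ?_, fun A i hi => ?_⟩
  · simp only [inputMemory]
    split_ifs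
    · exact size_le_of_le (by omega)
    · simp
  · simp only [inputMemory]
    split_ifs
    · exact hc _
    · simp
    · exact size_le_of_le (by omega)
    · simp
    · simp
  · simp only [inputMemory]
    rw [dif_neg (by omega), if_neg (c := ∃ u v : Fin n, G.Adj u v ∧ i = u * n + v)]
    · simp
    · rintro ⟨u, v, -, h⟩
      have := index_lt u.2 v.2
      omega

theorem program_exec {b : ℕ} (hb : n * n * (n * n) + 2 * (n * n) + 40 ≤ b)
    (hb' : inputSize c + 1 ≤ b) :
    ∃ m', Exec b (time n) ⟨[program], inputMemory G c⟩ ⟨[], m'⟩ ∧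
      IsCapDomSet G c (outputSet n m') ∧ 3 * (outputSet n m').card ≤ 5 * capDomNumber G c := by
  have w0 := inputMemory_within G c hb'
  have he := presents_inputEnv G c
  have hadj := inputEnv_adj_le G c
  obtain ⟨m₁, e₁, r₁⟩ := prelude_exec (n := n) w0 (fun r => rfl)
    (fun A i hA => by
      simp only [inputMemory]
      rw [if_neg (by omega), if_neg (by omega)]) hb
    [.seq (setUp.compile 0) (.loop 150 (body.compile 0))]
  have r₁' : Rel (inputEnv G c) ⟨fun r => if r = 60 then n else 0, fun _ _ _ => 0⟩ m₁ := r₁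
  obtain ⟨m₂, e₂, r₂, -⟩ := simulates (inputEnv G c) b hb hadj setUp 0 _ m₁ r₁' e₁.within_right
    [.loop 150 (body.compile 0)]
  obtain ⟨s', m₃, e₃, r₃, f₃⟩ := search_exec hb hadj he r₂ e₂.within_right
    (fun hn => setUp_search he hn (fun r => rfl) rfl) []
  refine ⟨m₃, (Exec.seq w0 e₁ (Exec.seq e₁.within_right e₂ e₃)).mono le_rfl, ?_⟩
  -- The search has established nothing for `n = 0`, but there every set of vertices is empty.
  rcases Nat.eq_zero_or_pos n with rfl | hn
  · have h1 : outputSet 0 m₃ = Finset.univ := Subsingleton.elim _ _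
    rw [h1]
    exact ⟨isCapDomSet_univ G c, by simp⟩
  · have h1 : outputSet n m₃ = kept n s' := by
      ext v
      have hv : (v : ℕ) < (inputEnv G c).N := lt_of_lt_of_le v.2 (Nat.le_mul_self n)
      have := r₃.arr 0 0 v (by omega) hv
      simp only [zero_mul, zero_add, mul_zero] at this
      simp [outputSet, kept, this]
    rw [h1]
    exact ⟨(f₃ hn).keeps.2, (f₃ hn).le⟩

end CapDom

theorem mainTheorem4 :
    ∃ (P : CapDom.Prog) (T : ℕ → ℕ) (q : Polynomial ℕ),
      ((fun n => (T n : ℝ)) =O[atTop] fun n => (1.57 : ℝ) ^ n) ∧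
      ∀ (n : ℕ) (G : SimpleGraph (Fin n)) (c : Fin n → ℕ),
        CapDom.HaltsWithin P (CapDom.inputMemory G c) (T n) ∧
        CapDom.RunsWithinSpace P (CapDom.inputMemory G c) (q.eval (CapDom.inputSize c)) ∧
        ∃ S : Finset (Fin n),
          S = CapDom.outputSet n (CapDom.exec P (CapDom.inputMemory G c) (T n)).mem ∧
          CapDom.IsCapDomSet G c S ∧
          (S.card : ℝ) ≤ 5 / 3 * (CapDom.capDomNumber G c : ℝ) := by
  -- The simulation needs `N² + 2N + 40` with `N = n²`, and `n²` is at most the input size; the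
  -- digits of the capacities are covered as well.
  refine ⟨CapDom.program, CapDom.time, .X * .X + 2 * .X + 40, CapDom.time_isBigO, fun n G c => ?_⟩
  have hn : n * n ≤ CapDom.inputSize c := by
    rw [CapDom.inputSize, pow_two]
    omega
  have hq : (Polynomial.X * Polynomial.X + 2 * Polynomial.X + 40 : Polynomial ℕ).eval
      (CapDom.inputSize c) = CapDom.inputSize c * CapDom.inputSize c + 2 * CapDom.inputSize c + 40 := by
    simp
  obtain ⟨m', h, h1, h2⟩ := CapDom.program_exec G c (b := Polynomial.eval (CapDom.inputSize c)
    (Polynomial.X * Polynomial.X + 2 * Polynomial.X + 40)) (by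
      rw [hq]
      have := Nat.mul_le_mul hn hn
      omega) (by
      rw [hq]
      omega)
  obtain ⟨g1, g2⟩ := h.halts
  refine ⟨by rw [CapDom.HaltsWithin, g1], g2, _, rfl, ?_⟩
  rw [g1]
  refine ⟨h1, ?_⟩
  have : (3 * ((CapDom.outputSet n m').card : ℝ)) ≤ 5 * (CapDom.capDomNumber G c : ℝ) := by
    exact_mod_cast h2
  linarith
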